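/- Let $q:[0,\infty)\to\mathbb R$ be $C^\infty$ on $[0,\infty)$ and in the limit point case at infinity, and let $\mathcal H=L_2(0,\infty)$ (complex-valued functions). Let $L_0=-\frac{d^2}{dx^2}+q$ be the operator in $\mathcal H$ with domain $\{y\in \mathcal H\cap H^2_{\rm loc}([0,\infty)) : y(0)=y'(0)=0,\ -y''+qy\in \mathcal H\}$, and assume that it is positive definite: for some $\varkappa>0$, $(L_0y,y)\ge\varkappa\|y\|^2$ for all $y\in{\rm Dom}\,L_0$. Let $L$ be the Friedrichs extension of $L_0$ and $\mathcal K={\rm Ker}\,L_0^*$. For $T\ge 0$ let $\overline{\mathcal U^T}$ be the closure of the set of states $u^h(T)=-h(T)+\int_0^T L^{-1/2}\sin[(T-s)L^{1/2}]\,h''(s)\,ds$, where $h$ runs over the $C^\infty$ functions $[0,\infty)\to\mathcal K$ vanishing near $0$. For a closed subspace $\mathcal G\subseteq\mathcal H$ let $I^0\mathcal G=\mathcal G$ and, for $t>0$, let $I^t\mathcal G$ be the closure of $\{\int_0^t L^{-1/2}\sin[(t-s)L^{1/2}]\,g(s)\,ds : g\in L_2^{\rm loc}([0,\infty);\mathcal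 G)\}$. Let $\mathfrak L$ be the smallest family of closed subspaces of $\mathcal H$ that contains all $\overline{\mathcal U^T}$, $T\ge0$, is closed under $\mathcal A\vee\mathcal B=\overline{\mathcal A+\mathcal B}$, $\mathcal A\cap\mathcal B$ and $\mathcal A^\perp$, and is invariant under all $I^t$, $t\ge0$. Let $\overline{\mathcal F}$ be the set of the functions $t\mapsto I^t\mathcal A$, $t\ge 0$, with $\mathcal A\in\mathfrak L$, together with all limits of sequences of such functions (for every $t$, strong convergence of the orthogonal projections), ordered by pointwise inclusion. The wave spectrum $\Omega$ is the set of atoms (minimal non-zero elements) of $\overline{\mathcal F}$. Let $\omega\in\Omega$. Then there is exactly one $x_\omega\in[0,\infty)$ such that for every $t\ge0$ $$\omega(t)=\{y\in\mathcal H : y=0 \text{ a.e. outside } \{x\ge0 : |x-x_\omega|<t\}\},$$ and the eikonal $\tau_\omega=\int_{[0,\infty)}t\,dP_{\omega(t)}$, where $P_{\omega(t)}$ is the orthogonal projection onto $\omega(t)$ (that is, $\tau_\omega y=\lim_{T\to\infty}\int_{[0,T]}t\,d(P_{\omega(t)}y)$, with norm-convergent Riemann–Stieltjes integrals, on the domain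 of all $y$ for which the limit exists in $\mathcal H$), is an unbounded self-adjoint operator with domain $${\rm Dom}\,\tau_\omega=\Big\{y\in L_2(0,\infty) : \int_0^\infty(1+x)^2|y(x)|^2\,dx<\infty\Big\},$$ and for every $y\in{\rm Dom}\,\tau_\omega$, for almost every $x\in(0,\infty)$, $$(\tau_\omega y)(x)=|x-x_\omega|\,y(x).$$ -/

import Mathlib

open Set Filter Topology MeasureTheory
open scoped NNReal

noncomputable section

namespace WaveModel

/-! ### Norm-convergent Riemann-Stieltjes integrals -/

section Stieltjes

variable {H : Type*} [NormedAddCommGroup H] [NormedSpace ℂ H]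

/-- `z = ∫_{[0,T]} t dF(t)`: limit in norm of the Riemann-Stieltjes sums
`∑ᵢ sᵢ (F(tᵢ₊₁) - F(tᵢ))`, `sᵢ ∈ [tᵢ, tᵢ₊₁]`, as the mesh of the partition
`0 = t₀ ≤ t₁ ≤ … ≤ tₙ = T` tends to zero. -/
def IsStieltjesIntegral (F : ℝ≥0 → H) (T : ℝ≥0) (z : H) : Prop :=
  ∀ ε > 0, ∃ δ > 0, ∀ (n : ℕ) (t s : ℕ → ℝ≥0), t 0 = 0 → t n = T →
    (∀ i < n, t i ≤ s i ∧ s i ≤ t (i + 1) ∧ (t (i + 1) : ℝ) - t i ≤ δ) →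
    ‖∑ i ∈ Finset.range n, ((s i : ℝ) : ℂ) • (F (t (i + 1)) - F (t i)) - z‖ ≤ ε

theorem IsStieltjesIntegral.unique {F : ℝ≥0 → H} {T : ℝ≥0} {z z' : H}
    (h : IsStieltjesIntegral F T z) (h' : IsStieltjesIntegral F T z') : z = z' := by
  rw [← sub_eq_zero, ← norm_le_zero_iff]
  refine le_of_forall_pos_le_add fun ε hε => ?_
  obtain ⟨δ, hδ, hd⟩ := h (ε / 2) (half_pos hε)
  obtain ⟨δ', hδ', hd'⟩ := h' (ε / 2) (half_pos hε)
  obtain ⟨n, hn⟩ := exists_nat_gt ((T : ℝ) / min δ δ')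
  have hm : 0 < min δ δ' := lt_min hδ hδ'
  have hn0 : (0 : ℝ) < n := lt_of_le_of_lt (by positivity) hn
  have hn0' : (n : ℝ≥0) ≠ 0 := by
    intro h0
    have : ((n : ℝ≥0) : ℝ) = 0 := by rw [h0]; rfl
    simp at this
    simp [this] at hn0
  let t : ℕ → ℝ≥0 := fun i => (i : ℝ≥0) / n * T
  have ht0 : t 0 = 0 := by simp [t]
  have htn : t n = T := by simp [t, hn0']
  have hstep : ∀ i < n, t i ≤ t i ∧ t i ≤ t (i + 1) ∧
      (t (i + 1) : ℝ) - t i ≤ min δ δ' := by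
    intro i _
    refine ⟨le_rfl, ?_, ?_⟩
    · simp only [t]
      gcongr
      simp
    · have : (t (i + 1) : ℝ) - t i = T / n := by
        simp only [t]
        push_cast
        field_simp
        ring
      rw [this, div_le_iff₀ hn0]
      rw [div_lt_iff₀ hm] at hn
      linarith
  have e := hd n t t ht0 htn fun i hi =>
    ⟨(hstep i hi).1, (hstep i hi).2.1, (hstep i hi).2.2.trans (min_le_left _ _)⟩
  have e' := hd' n t t ht0 htn fun i hi =>
    ⟨(hstep i hi).1, (hstep i hi).2.1, (hstep i hi).2.2.trans (min_le_right _ _)⟩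
  generalize (∑ i ∈ Finset.range n, ((t i : ℝ) : ℂ) • (F (t (i + 1)) - F (t i))) = S at e e'
  have : z - z' = (S - z') - (S - z) := by abel
  rw [this]
  linarith [norm_sub_le (S - z') (S - z)]

theorem IsStieltjesIntegral.add {F G : ℝ≥0 → H} {T : ℝ≥0} {z w : H}
    (h : IsStieltjesIntegral F T z) (h' : IsStieltjesIntegral G T w) :
    IsStieltjesIntegral (fun t => F t + G t) T (z + w) := by
  intro ε hε
  obtain ⟨δ, hδ, hd⟩ := h (ε / 2) (half_pos hε)
  obtain ⟨δ', hδ', hd'⟩ := h' (ε / 2) (half_pos hε)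
  refine ⟨min δ δ', lt_min hδ hδ', fun n t s h0 hn hst => ?_⟩
  have e := hd n t s h0 hn fun i hi =>
    ⟨(hst i hi).1, (hst i hi).2.1, (hst i hi).2.2.trans (min_le_left _ _)⟩
  have e' := hd' n t s h0 hn fun i hi =>
    ⟨(hst i hi).1, (hst i hi).2.1, (hst i hi).2.2.trans (min_le_right _ _)⟩
  have : (∑ i ∈ Finset.range n,
        ((s i : ℝ) : ℂ) • ((F (t (i + 1)) + G (t (i + 1))) - (F (t i) + G (t i)))) - (z + w) =
      ((∑ i ∈ Finset.range n, ((s i : ℝ) : ℂ) • (F (t (i + 1)) - F (t i))) - z) +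
      ((∑ i ∈ Finset.range n, ((s i : ℝ) : ℂ) • (G (t (i + 1)) - G (t i))) - w) := by
    rw [sub_add_sub_comm, ← Finset.sum_add_distrib]
    congr 1
    refine Finset.sum_congr rfl fun i _ => ?_
    rw [← smul_add]
    congr 1
    abel
  rw [this]
  linarith [norm_add_le
    ((∑ i ∈ Finset.range n, ((s i : ℝ) : ℂ) • (F (t (i + 1)) - F (t i))) - z)
    ((∑ i ∈ Finset.range n, ((s i : ℝ) : ℂ) • (G (t (i + 1)) - G (t i))) - w)]

theorem IsStieltjesIntegral.smul {F : ℝ≥0 → H} {T : ℝ≥0} {z : H} (c : ℂ)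
    (h : IsStieltjesIntegral F T z) : IsStieltjesIntegral (fun t => c • F t) T (c • z) := by
  intro ε hε
  have hc : 0 < ‖c‖ + 1 := by positivity
  obtain ⟨δ, hδ, hd⟩ := h (ε / (‖c‖ + 1)) (by positivity)
  refine ⟨δ, hδ, fun n t s h0 hn hst => ?_⟩
  have e := hd n t s h0 hn hst
  have : (∑ i ∈ Finset.range n,
        ((s i : ℝ) : ℂ) • (c • F (t (i + 1)) - c • F (t i))) - c • z =
      c • ((∑ i ∈ Finset.range n, ((s i : ℝ) : ℂ) • (F (t (i + 1)) - F (t i))) - z) := by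
    rw [smul_sub, Finset.smul_sum]
    congr 1
    refine Finset.sum_congr rfl fun i _ => ?_
    rw [← smul_sub, smul_comm]
  rw [this, norm_smul]
  rw [le_div_iff₀ hc] at e
  nlinarith [norm_nonneg c, norm_nonneg
    ((∑ i ∈ Finset.range n, ((s i : ℝ) : ℂ) • (F (t (i + 1)) - F (t i))) - z)]

end Stieltjes

/-! ### The wave spectrum of a positive definite symmetric operator -/

section General

variable {H : Type*} [NormedAddCommGroup H] [InnerProductSpace ℂ H]

/-- `L₀` is positive definite: `(L₀ y, y)` is real and `(L₀ y, y) ≥ κ ‖y‖²` on the domain,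
for some `κ > 0`. -/
def IsPositiveDefinite (L₀ : H →ₗ.[ℂ] H) : Prop :=
  ∃ κ : ℝ, 0 < κ ∧ ∀ y : L₀.domain,
    (inner ℂ (L₀ y) (y : H)).im = 0 ∧ κ * ‖(y : H)‖ ^ 2 ≤ (inner ℂ (L₀ y) (y : H)).re

/-- `f_t(R)` for `f_t(r) = √r sin(t / √r)` (with `f_t(0) = 0`), by the continuous functional
calculus. For `R = L⁻¹` this is the operator `L^{-1/2} sin(t L^{1/2})`. -/
def sineOperator [CompleteSpace H] (R : H →L[ℂ] H) (t : ℝ) : H →L[ℂ] H :=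
  cfc (fun r : ℝ => √r * Real.sin (t / √r)) R

/-- The Duhamel integral `v^g(t) = ∫₀ᵗ L^{-1/2} sin((t - s) L^{1/2}) g(s) ds`, `R = L⁻¹`: the
solution of `v'' + L v = g`, `v(0) = v'(0) = 0`. -/
def duhamel [CompleteSpace H] (R : H →L[ℂ] H) (g : ℝ → H) (t : ℝ) : H :=
  ∫ s in (0 : ℝ)..t, sineOperator R (t - s) (g s)

variable [CompleteSpace H]

/-- The kernel of the adjoint of `L₀`. -/
def defectSpace (L₀ : H →ₗ.[ℂ] H) : Set H := {y | (y, (0 : H)) ∈ L₀.adjoint.graph}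

/-- The graph of the Friedrichs extension `L` of a positive definite operator `L₀`: the
restriction of `L₀*` to those elements of `Dom L₀*` that lie in the completion of `Dom L₀` with
respect to the form `(L₀ u, u)`. -/
def friedrichsGraph (L₀ : H →ₗ.[ℂ] H) : Set (H × H) :=
  {p | p ∈ L₀.adjoint.graph ∧ ∃ u : ℕ → L₀.domain,
    Tendsto (fun n => (u n : H)) atTop (𝓝 p.1) ∧
    ∀ ε > 0, ∃ N, ∀ m ≥ N, ∀ n ≥ N,
      ‖inner ℂ (L₀ (u m - u n)) ((u m - u n : L₀.domain) : H)‖ < ε}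

open Classical in
/-- The bounded everywhere defined inverse `L⁻¹` of the Friedrichs extension `L` of `L₀`. (It
exists if `L₀` is densely defined and positive definite; the value is `0` if there is no such
operator.) -/
def friedrichsInverse (L₀ : H →ₗ.[ℂ] H) : H →L[ℂ] H :=
  if h : ∃ R : H →L[ℂ] H, ∀ y f, (y, f) ∈ friedrichsGraph L₀ ↔ y = R f then h.choose else 0

/-- Smooth boundary controls: `C^∞` functions of time `t ≥ 0` with values in `Ker L₀*` that
vanish near `t = 0` (extended by zero to `t < 0`). -/
def IsControl (L₀ : H →ₗ.[ℂ] H) (h : ℝ → H) : Prop :=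
  ContDiff ℝ (⊤ : ℕ∞) h ∧ (∀ t, h t ∈ defectSpace L₀) ∧ ∃ ε > 0, ∀ t < ε, h t = 0

/-- The wave `u^h(t) = -h(t) + ∫₀ᵗ L^{-1/2} sin((t - s) L^{1/2}) h''(s) ds`, the solution of
`u'' + L₀* u = 0`, `u(0) = u'(0) = 0`, `(L⁻¹ L₀* - 1) u = h`. -/
def wave (L₀ : H →ₗ.[ℂ] H) (h : ℝ → H) (t : ℝ) : H :=
  -h t + duhamel (friedrichsInverse L₀) (iteratedDeriv 2 h) t

/-- The reachable subspace: the closure of the linear set `{u^h(T) | h a control}`. -/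
def reachableSubspace (L₀ : H →ₗ.[ℂ] H) (T : ℝ≥0) : ClosedSubmodule ℂ H :=
  (Submodule.span ℂ {f : H | ∃ h : ℝ → H, IsControl L₀ h ∧ f = wave L₀ h T}).closure

/-- The wave isotony: `I⁰ = id`, and for `t > 0`, `Iᵗ G` is the closure of the linear set
`{v^g(t) | g ∈ L₂^loc([0,∞); G)}`. -/
def waveIsotony (L₀ : H →ₗ.[ℂ] H) (t : ℝ≥0) (G : ClosedSubmodule ℂ H) : ClosedSubmodule ℂ H :=
  if t = 0 then G else
    (Submodule.span ℂ {f : H | ∃ g : ℝ → H, (∀ s, g s ∈ G) ∧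
      (∀ b : ℝ, MemLp g 2 (volume.restrict (Ioc 0 b))) ∧
      f = duhamel (friedrichsInverse L₀) g t}).closure

/-- The minimal family of closed subspaces that contains all reachable subspaces, is a lattice
(closed under `∨`, `∩` and `⊥`), and is invariant under the wave isotony. -/
inductive MemWaveLattice (L₀ : H →ₗ.[ℂ] H) : ClosedSubmodule ℂ H → Prop
  | reachable (T : ℝ≥0) : MemWaveLattice L₀ (reachableSubspace L₀ T)
  | sup {A B : ClosedSubmodule ℂ H} :
      MemWaveLattice L₀ A → MemWaveLattice L₀ B → MemWaveLattice L₀ (A ⊔ B)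
  | inf {A B : ClosedSubmodule ℂ H} :
      MemWaveLattice L₀ A → MemWaveLattice L₀ B → MemWaveLattice L₀ (A ⊓ B)
  | orthogonal {A : ClosedSubmodule ℂ H} : MemWaveLattice L₀ A → MemWaveLattice L₀ Aᗮ
  | isotony (t : ℝ≥0) {A : ClosedSubmodule ℂ H} :
      MemWaveLattice L₀ A → MemWaveLattice L₀ (waveIsotony L₀ t A)

/-- The orthogonal projection onto a closed subspace. -/
def proj (A : ClosedSubmodule ℂ H) : H →L[ℂ] H := A.toSubmodule.starProjection

/-- The functions `t ↦ Iᵗ A`, `A` in the lattice, and all limits of convergent sequences of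
these. Convergence is pointwise in `t`, in the sense of strong convergence of the projections. -/
def waveFunctions (L₀ : H →ₗ.[ℂ] H) : Set (ℝ≥0 → ClosedSubmodule ℂ H) :=
  {ω | ∃ A : ℕ → ClosedSubmodule ℂ H, (∀ n, MemWaveLattice L₀ (A n)) ∧
    ∀ (t : ℝ≥0) (y : H),
      Tendsto (fun n => proj (waveIsotony L₀ t (A n)) y) atTop (𝓝 (proj (ω t) y))}

/-- The wave spectrum: the set of atoms of `waveFunctions L₀`, ordered pointwise by inclusion. -/
def waveSpectrum (L₀ : H →ₗ.[ℂ] H) : Set (ℝ≥0 → ClosedSubmodule ℂ H) :=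
  {ω | ω ∈ waveFunctions L₀ ∧ ω ≠ ⊥ ∧ ∀ ω' ∈ waveFunctions L₀, ω' ≠ ⊥ → ω' ≤ ω → ω' = ω}

/-! ### Eikonals -/

/-- The graph of the eikonal `τ_ω = ∫_{[0,∞)} t dP_{ω(t)}`: the pairs `(y, z)` such that
`z = lim_{T → ∞} ∫_{[0,T]} t d(P_{ω(t)} y)` in norm. -/
def eikonalGraph (ω : ℝ≥0 → ClosedSubmodule ℂ H) : Submodule ℂ (H × H) where
  carrier := {p | ∃ Z : ℝ≥0 → H,
    (∀ T, IsStieltjesIntegral (fun t => proj (ω t) p.1) T (Z T)) ∧ Tendsto Z atTop (𝓝 p.2)}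
  add_mem' := by
    rintro p p' ⟨Z, hZ, hl⟩ ⟨Z', hZ', hl'⟩
    refine ⟨fun T => Z T + Z' T, fun T => ?_, hl.add hl'⟩
    simpa only [Prod.fst_add, map_add] using (hZ T).add (hZ' T)
  zero_mem' := by
    refine ⟨fun _ => 0, fun T ε hε => ⟨1, one_pos, fun n t s _ _ _ => ?_⟩, tendsto_const_nhds⟩
    simpa using hε.le
  smul_mem' := by
    rintro c p ⟨Z, hZ, hl⟩
    refine ⟨fun T => c • Z T, fun T => ?_, hl.const_smul c⟩
    simpa only [Prod.smul_fst, map_smul] using (hZ T).smul c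

/-- `eikonalGraph ω` is the graph of an operator. -/
theorem eikonalGraph_functional (ω : ℝ≥0 → ClosedSubmodule ℂ H) (p : H × H)
    (hp : p ∈ eikonalGraph ω) (h0 : p.1 = 0) : p.2 = 0 := by
  obtain ⟨Z, hZ, hl⟩ := hp
  have hZ0 : Z = fun _ => 0 := by
    funext T
    refine (hZ T).unique fun ε hε => ⟨1, one_pos, fun n t s _ _ _ => ?_⟩
    simpa [h0] using hε.le
  rw [hZ0] at hl
  exact (tendsto_nhds_unique hl tendsto_const_nhds)

/-- The eikonal `τ_ω = ∫_{[0,∞)} t dP_{ω(t)}`, an operator with its maximal domain. -/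
def eikonal (ω : ℝ≥0 → ClosedSubmodule ℂ H) : H →ₗ.[ℂ] H := (eikonalGraph ω).toLinearPMap

end General

/-! ### The Sturm-Liouville operator on the half-line -/

/-- Lebesgue measure on the half-line `(0, ∞)`. -/
abbrev halfLine : Measure ℝ := volume.restrict (Ioi 0)

/-- The complex Hilbert space `L₂(0, ∞)`. -/
abbrev L2 : Type := Lp ℂ 2 halfLine

/-- `-u'' + q u = z` on `[0, ∞)` with `v = u'`: `u` is `C¹` with derivative `v`, and `v` is
locally absolutely continuous with `v' = q u - z` almost everywhere. -/
structure SolvesSL (q : ℝ → ℝ) (z u v : ℝ → ℂ) : Prop where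
  deriv : ∀ x ≥ 0, HasDerivWithinAt u (v x) (Ici 0) x
  integrable : ∀ x ≥ 0, IntervalIntegrable (fun s => (q s : ℂ) * u s - z s) volume 0 x
  integral : ∀ x ≥ 0, v x = v 0 + ∫ s in (0 : ℝ)..x, ((q s : ℂ) * u s - z s)

/-- The limit point case at infinity: for no `μ` are all solutions of `-u'' + q u = μ u` square
integrable. -/
def IsLimitPoint (q : ℝ → ℝ) : Prop :=
  ∀ μ : ℂ, ∃ u v : ℝ → ℂ, SolvesSL q (fun x => μ * u x) u v ∧ ¬ MemLp u 2 halfLine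

/-- The graph of the minimal operator `y ↦ -y'' + q y` in `L₂(0, ∞)`, with
`y ∈ H²_loc([0, ∞))`, `y(0) = y'(0) = 0`, `-y'' + q y ∈ L₂(0, ∞)`. -/
def slGraph (q : ℝ → ℝ) : Submodule ℂ (L2 × L2) where
  carrier := {p | ∃ u v : ℝ → ℂ, p.1 =ᵐ[halfLine] u ∧ SolvesSL q p.2 u v ∧ u 0 = 0 ∧ v 0 = 0}
  add_mem' := by
    rintro p p' ⟨u, v, hu, hs, h0, h1⟩ ⟨u', v', hu', hs', h0', h1'⟩
    have hz := Lp.coeFn_add p.2 p'.2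
    have key : ∀ x : ℝ, 0 ≤ x → ∀ᵐ s, s ∈ uIoc (0 : ℝ) x →
        ((q s : ℂ) * u s - p.2 s) + ((q s : ℂ) * u' s - p'.2 s) =
        (q s : ℂ) * (u + u') s - (p + p').2 s := by
      intro x hx
      filter_upwards [(ae_restrict_iff' measurableSet_Ioi).1 hz] with s hs hsx
      rw [uIoc_of_le hx] at hsx
      have := hs hsx.1
      simp only [Prod.snd_add, this, Pi.add_apply]
      ring
    refine ⟨u + u', v + v', ?_, ⟨fun x hx => (hs.deriv x hx).add (hs'.deriv x hx),
      fun x hx => ?_, fun x hx => ?_⟩, by simp [h0, h0'], by simp [h1, h1']⟩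
    · exact (Lp.coeFn_add p.1 p'.1).trans (hu.add hu')
    · refine ((hs.integrable x hx).add (hs'.integrable x hx)).congr_ae ?_
      exact (ae_restrict_iff' measurableSet_uIoc).2 (key x hx)
    · rw [← intervalIntegral.integral_congr_ae (key x hx),
        intervalIntegral.integral_add (hs.integrable x hx) (hs'.integrable x hx)]
      simp only [Pi.add_apply]
      rw [hs.integral x hx, hs'.integral x hx, h1, h1']
      ring
  zero_mem' := by
    have hz : ((0 : L2) : ℝ → ℂ) =ᵐ[halfLine] 0 := Lp.coeFn_zero _ _ _
    have key : ∀ x : ℝ, 0 ≤ x → ∀ᵐ s, s ∈ uIoc (0 : ℝ) x →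
        (0 : ℂ) = (q s : ℂ) * (0 : ℝ → ℂ) s - (0 : L2 × L2).2 s := by
      intro x hx
      filter_upwards [(ae_restrict_iff' measurableSet_Ioi).1 hz] with s hs hsx
      rw [uIoc_of_le hx] at hsx
      have := hs hsx.1
      simpa using this
    refine ⟨0, 0, hz, ⟨fun x hx => hasDerivWithinAt_const _ _ _, fun x hx => ?_,
      fun x hx => ?_⟩, rfl, rfl⟩
    · refine (intervalIntegrable_const (c := (0 : ℂ))).congr_ae ?_
      exact (ae_restrict_iff' measurableSet_uIoc).2 (key x hx)
    · rw [← intervalIntegral.integral_congr_ae (key x hx)]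
      simp
  smul_mem' := by
    rintro c p ⟨u, v, hu, hs, h0, h1⟩
    have hz := Lp.coeFn_smul c p.2
    have key : ∀ x : ℝ, 0 ≤ x → ∀ᵐ s, s ∈ uIoc (0 : ℝ) x →
        c * ((q s : ℂ) * u s - p.2 s) =
        (q s : ℂ) * (c • u) s - (c • p).2 s := by
      intro x hx
      filter_upwards [(ae_restrict_iff' measurableSet_Ioi).1 hz] with s hs hsx
      rw [uIoc_of_le hx] at hsx
      have := hs hsx.1
      simp only [Prod.smul_snd, this, Pi.smul_apply, smul_eq_mul]
      ring
    refine ⟨c • u, c • v, ?_, ⟨fun x hx => (hs.deriv x hx).const_smul c,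
      fun x hx => ?_, fun x hx => ?_⟩, by simp [h0], by simp [h1]⟩
    · exact (Lp.coeFn_smul c p.1).trans (hu.const_smul c)
    · refine ((hs.integrable x hx).const_mul c).congr_ae ?_
      exact (ae_restrict_iff' measurableSet_uIoc).2 (key x hx)
    · rw [← intervalIntegral.integral_congr_ae (key x hx),
        intervalIntegral.integral_const_mul]
      simp only [Pi.smul_apply, smul_eq_mul]
      rw [hs.integral x hx, h1]
      ring

/-- `slGraph q` is the graph of an operator. -/
theorem slGraph_functional (q : ℝ → ℝ) (p : L2 × L2) (hp : p ∈ slGraph q) (h0 : p.1 = 0) :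
    p.2 = 0 := by
  obtain ⟨u, v, hu, hs, -, hv0⟩ := hp
  have hcont : ContinuousOn u (Ici 0) := fun x hx => (hs.deriv x hx).continuousWithinAt
  have hz : ((0 : L2) : ℝ → ℂ) =ᵐ[halfLine] 0 := Lp.coeFn_zero _ _ _
  rw [h0] at hu
  have hae : u =ᵐ[halfLine] fun _ => (0 : ℂ) := hu.symm.trans hz
  have hpos : EqOn u (fun _ => 0) (Ioi 0) :=
    Measure.eqOn_open_of_ae_eq hae isOpen_Ioi (hcont.mono Ioi_subset_Ici_self)
      continuousOn_const
  have hv : ∀ x > 0, v x = 0 := by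
    intro x hx
    have h1 : HasDerivAt u (v x) x := (hs.deriv x hx.le).hasDerivAt (Ici_mem_nhds hx)
    have h2 : HasDerivAt u 0 x := (hasDerivAt_const x (0 : ℂ)).congr_of_eventuallyEq
      (eventually_of_mem (Ioi_mem_nhds hx) hpos)
    exact h1.unique h2
  have hint : ∀ x > 0, (∫ s in (0 : ℝ)..x, ((q s : ℂ) * u s - p.2 s)) = 0 := by
    intro x hx
    have := hs.integral x hx.le
    rw [hv x hx, hv0, zero_add] at this
    exact this.symm
  have hfin : ∀ n : ℕ, ∀ᵐ x, x ∈ Ioo (0 : ℝ) n → p.2 x = 0 := by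
    intro n
    have hI := hs.integrable n n.cast_nonneg
    filter_upwards [hI.ae_hasDerivAt_integral] with x hx hxn
    have hxm : x ∈ uIcc (0 : ℝ) n := by
      rw [uIcc_of_le n.cast_nonneg]
      exact ⟨hxn.1.le, hxn.2.le⟩
    have h1 := hx hxm 0 left_mem_uIcc
    have h2 : HasDerivAt (fun x => ∫ s in (0 : ℝ)..x, ((q s : ℂ) * u s - p.2 s)) 0 x :=
      (hasDerivAt_const x (0 : ℂ)).congr_of_eventuallyEq
        (eventually_of_mem (Ioi_mem_nhds hxn.1) hint)
    have h3 := h1.unique h2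
    rw [hpos hxn.1] at h3
    simpa using h3
  refine Lp.ext (EventuallyEq.trans ?_ hz.symm)
  refine (ae_restrict_iff' measurableSet_Ioi).2 ?_
  filter_upwards [ae_all_iff.2 hfin] with x hx hx0
  obtain ⟨n, hn⟩ := exists_nat_gt x
  exact hx n ⟨hx0, hn⟩

/-- The minimal Sturm-Liouville operator `L₀ = -d²/dx² + q` in `L₂(0, ∞)`. -/
def slOperator (q : ℝ → ℝ) : L2 →ₗ.[ℂ] L2 := (slGraph q).toLinearPMap

/-- `L₂(E) = {y ∈ L₂(0, ∞) | y = 0 almost everywhere outside E}`. -/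
def subspaceOn (E : Set ℝ) : ClosedSubmodule ℂ L2 where
  carrier := {y | ∀ᵐ x ∂halfLine, x ∉ E → y x = 0}
  add_mem' := by
    intro a b ha hb
    filter_upwards [ha, hb, Lp.coeFn_add a b] with x h1 h2 h3 hx
    rw [h3, Pi.add_apply, h1 hx, h2 hx, add_zero]
  zero_mem' := by
    filter_upwards [Lp.coeFn_zero ℂ 2 halfLine] with x h1 _
    rw [h1, Pi.zero_apply]
  smul_mem' := by
    intro c a ha
    filter_upwards [ha, Lp.coeFn_smul c a] with x h1 h2 hx
    rw [h2, Pi.smul_apply, h1 hx, smul_zero]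
  isClosed' := by
    refine IsSeqClosed.isClosed fun f g hf hfg => ?_
    obtain ⟨ns, -, hns⟩ := (tendstoInMeasure_of_tendsto_Lp hfg).exists_seq_tendsto_ae
    have hall : ∀ᵐ x ∂halfLine, ∀ n, x ∉ E → f n x = 0 := ae_all_iff.2 fun n => hf n
    filter_upwards [hns, hall] with x h1 h2 hx
    refine tendsto_nhds_unique h1 ?_
    simp only [h2 _ hx]
    exact tendsto_const_nhds

/-- The function `ω_x(t) = L₂({x}ᵗ)`, where `{x}ᵗ` is the open `t`-neighbourhood of `x` in the
half-line `[0, ∞)`. -/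
def pointAtom (x : ℝ≥0) (t : ℝ≥0) : ClosedSubmodule ℂ L2 :=
  subspaceOn {s | 0 ≤ s ∧ dist s x < t}

end WaveModel
end

/-! Write `S(t) = L^{-1/2} sin(t L^{1/2})`. The abstract objects reduce to geometry on the
half-line: the closure of the reachable set at time `T` is `L₂(0, T)` (`reachableSubspace_eq`), and
for `t > 0` the isotony `Iᵗ` sends `L₂(E)` to `L₂` of the open `t`-neighbourhood of the essential
support of `E` (`waveIsotony_subspaceOn`). Hence every lattice element is some `L₂(E)` with `E`
measurable.

Both facts come from one uniqueness theorem for `w_tt = w_xx - q w` in a characteristic cone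
(`eq_zero_of_cone`). In one space dimension `x` and `t` are interchangeable. With `t` as evolution
variable the theorem gives finite speed of propagation, hence the upper bounds for both subspaces.
With `x` as evolution variable it says that a wave with zero Cauchy data on the segment `x = x₀`,
`|t| < T`, vanishes in the cone over that segment. Applied to elements of the orthogonal
complements, this gives the opposite inclusions: orthogonality to the reachable set makes the normal
derivative at `0` vanish, and orthogonality to `Iᵗ L₂(E)` makes the wave vanish on `E`, hence with
its `x`-derivative at each point of the essential support.

The uniqueness theorem needs pointwise values and derivatives. The range of `L⁻¹` is shown to
consist of `H²_loc` functions with `u(0) = 0`, so that point values and derivatives of `L⁻¹ f` are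
represented by vectors `e(x)` and `d(x)` (`exists_evaluation`). The wave with data `L⁻³ g` then has
a continuous field `waveField`, reflected oddly through `0`. General data are treated by the
smoothing operators `h⁻¹ S(h)`: they converge strongly to `1`, their seventh powers map into the
range of `L⁻³`, and `S(s) S(h)` is an integral of `S` over a time window, so that vanishing
statements survive on a slightly shorter interval.

For the spectrum, intervals shrinking to `x` show that `t ↦ L₂({x}ᵗ)` is a limit of lattice
functions. Conversely, a non-zero limit of lattice functions keeps essential support points in a
bounded interval; an accumulation point `a` of these satisfies `pointAtom a ≤ ω`
(`exists_pointAtom_le`). So every atom is a `pointAtom`. For such an atom `P_{ω(t)}` is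
multiplication by the indicator of `|x - x_ω| < t`, and the Stieltjes integral is multiplication by
`|x - x_ω|`, from which the assertions about the domain, self-adjointness and unboundedness follow.
-/

open Set Filter Topology MeasureTheory
open scoped NNReal

noncomputable section

namespace WaveModel

/-! ### The Friedrichs extension and its bounded inverse -/

section Friedrichs

variable {H : Type*} [NormedAddCommGroup H] [InnerProductSpace ℂ H]

/-- Polarization: the form is real at `x + y` and at `x + i y`. -/
theorem IsPositiveDefinite.symmetric {L₀ : H →ₗ.[ℂ] H} (hp : IsPositiveDefinite L₀)
    (x y : L₀.domain) : inner ℂ (L₀ x) (y : H) = inner ℂ (x : H) (L₀ y) := by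
  obtain ⟨κ, -, h⟩ := hp
  have him : ∀ z : L₀.domain, inner ℂ (L₀ z) (z : H) = inner ℂ (z : H) (L₀ z) := by
    intro z
    rw [← inner_conj_symm (z : H) (L₀ z)]
    exact (Complex.conj_eq_iff_im.2 (h z).1).symm
  have h1 := him (x + y)
  have h2 := him (x + Complex.I • y)
  simp only [LinearPMap.map_add, LinearPMap.map_smul, Submodule.coe_add, Submodule.coe_smul,
    inner_add_left, inner_add_right, inner_smul_left, inner_smul_right, him x, him y,
    Complex.conj_I] at h1 h2
  have h3 : inner ℂ (L₀ x) (y : H) + inner ℂ (L₀ y) (x : H) =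
      inner ℂ (x : H) (L₀ y) + inner ℂ (y : H) (L₀ x) := by linear_combination h1
  have h4 : Complex.I * (inner ℂ (L₀ x) (y : H) - inner ℂ (L₀ y) (x : H)) =
      Complex.I * (inner ℂ (x : H) (L₀ y) - inner ℂ (y : H) (L₀ x)) := by linear_combination h2
  have h5 := mul_left_cancel₀ Complex.I_ne_zero h4
  linear_combination (h3 + h5) / 2

variable [CompleteSpace H]

theorem mem_adjoint_graph_iff {L₀ : H →ₗ.[ℂ] H} (hd : Dense (L₀.domain : Set H)) (y f : H) :
    (y, f) ∈ L₀.adjoint.graph ↔ ∀ x : L₀.domain, inner ℂ f (x : H) = inner ℂ y (L₀ x) := by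
  constructor
  · intro h x
    obtain ⟨z, hz1, hz2⟩ := (LinearPMap.mem_graph_iff _).1 h
    have := LinearPMap.adjoint_isFormalAdjoint hd z x
    simp only at hz1 hz2
    rw [← hz1, ← hz2]
    exact this
  · intro h
    refine (LinearPMap.mem_graph_iff _).2
      ⟨⟨y, LinearPMap.mem_adjoint_domain_of_exists y ⟨f, h⟩⟩, rfl, ?_⟩
    exact LinearPMap.adjoint_apply_eq hd _ h

/-- The Friedrichs construction, for the form of `L₀` carried by a pre-Hilbert space `V`. -/
theorem exists_friedrichs_inverse_of_form {L₀ : H →ₗ.[ℂ] H} (hd : Dense (L₀.domain : Set H))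
    {V : Type*} [NormedAddCommGroup V] [InnerProductSpace ℂ V] (e : V ≃ₗ[ℂ] L₀.domain)
    (he : ∀ x y, inner ℂ x y = inner ℂ (L₀ (e x)) (e y : H)) {κ : ℝ} (hκ : 0 < κ)
    (hb : ∀ x, κ * ‖(e x : H)‖ ^ 2 ≤ ‖x‖ ^ 2) :
    ∃ R : H →L[ℂ] H, (∀ y f, (y, f) ∈ friedrichsGraph L₀ ↔ y = R f) ∧
      R.IsPositive ∧ Function.Injective R := by
  have hsymm : ∀ x y, inner ℂ x y = inner ℂ (e x : H) (L₀ (e y)) := by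
    intro x y
    rw [← inner_conj_symm, he, inner_conj_symm]
  have hbound : ∀ x : V, ‖((L₀.domain.subtype ∘ₗ e.toLinearMap : V →ₗ[ℂ] H)) x‖ ≤
      (√κ)⁻¹ * ‖x‖ := by
    intro x
    have hs : 0 < √κ := Real.sqrt_pos.2 hκ
    rw [← div_eq_inv_mul, le_div_iff₀ hs]
    refine le_of_sq_le_sq ?_ (norm_nonneg x)
    rw [mul_pow, Real.sq_sqrt hκ.le, mul_comm]
    exact hb x
  let J : V →L[ℂ] H := LinearMap.mkContinuous _ _ hbound
  have hJ : ∀ x, J x = (e x : H) := fun x => rfl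
  let j : UniformSpace.Completion V →L[ℂ] H := J.extend UniformSpace.Completion.toComplL
  have hj : ∀ x : V, j (x : UniformSpace.Completion V) = (e x : H) := by
    intro x
    exact ContinuousLinearMap.extend_eq J
      (UniformSpace.Completion.denseRange_coe) (UniformSpace.Completion.isUniformInducing_coe _) x
  -- This identity says that `j v` determines `v`, since `V` is dense in its completion; the form
  -- completion thus sits inside `H`.
  have key : ∀ (x : V) (v : UniformSpace.Completion V),
      inner ℂ (x : UniformSpace.Completion V) v = inner ℂ (L₀ (e x)) (j v) := by
    intro x v
    refine UniformSpace.Completion.induction_on v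
      (isClosed_eq (by fun_prop) (by fun_prop)) fun w => ?_
    rw [UniformSpace.Completion.inner_coe, hj, he]
  -- The inverse is `j j*`: for `v = j* f` the form product of `x` and `v` equals the product of `e
  -- x` and `f` in `H`, which is the weak form of `L (j v) = f`.
  refine ⟨j ∘L j.adjoint, fun y f => ⟨?_, ?_⟩, j.isPositive_self_comp_adjoint, ?_⟩
  · rintro ⟨hy, u, hu, hc⟩
    rw [mem_adjoint_graph_iff hd] at hy
    let w : ℕ → UniformSpace.Completion V := fun n => (e.symm (u n) : V)
    have hcau : CauchySeq w := by
      refine Metric.cauchySeq_iff.2 fun ε hε => ?_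
      obtain ⟨N, hN⟩ := hc (ε ^ 2) (by positivity)
      refine ⟨N, fun m hm n hn => ?_⟩
      have h1 := hN m hm n hn
      simp only [w]
      rw [dist_eq_norm, ← UniformSpace.Completion.coe_sub, UniformSpace.Completion.norm_coe]
      rw [← abs_norm]
      refine abs_lt_of_sq_lt_sq ?_ hε.le
      rw [← map_sub, ← inner_self_eq_norm_sq (𝕜 := ℂ), he, e.apply_symm_apply]
      exact (Complex.re_le_norm _).trans_lt h1
    obtain ⟨v, hv⟩ := cauchySeq_tendsto_of_complete hcau
    have hjv : j v = y := by
      refine tendsto_nhds_unique ((j.continuous.tendsto v).comp hv) ?_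
      refine hu.congr fun n => ?_
      simp only [w, Function.comp, hj, e.apply_symm_apply]
    have : v = j.adjoint f := by
      refine ext_inner_left ℂ fun z => UniformSpace.Completion.induction_on z
        (isClosed_eq (by fun_prop) (by fun_prop)) fun x => ?_
      rw [key, hjv, ContinuousLinearMap.adjoint_inner_right, hj]
      rw [← inner_conj_symm, ← hy (e x), inner_conj_symm]
    rw [← hjv, this]
    rfl
  · rintro rfl
    refine ⟨(mem_adjoint_graph_iff hd _ _).2 fun x => ?_, ?_⟩
    · have h1 := key (e.symm x) (j.adjoint f)
      rw [ContinuousLinearMap.adjoint_inner_right, hj, e.apply_symm_apply] at h1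
      rw [← inner_conj_symm, h1, inner_conj_symm]
      rfl
    · obtain ⟨w, hw, hl⟩ : ∃ w : ℕ → UniformSpace.Completion V,
          (∀ n, w n ∈ range ((↑) : V → UniformSpace.Completion V)) ∧
          Tendsto w atTop (𝓝 (j.adjoint f)) :=
        mem_closure_iff_seq_limit.1 ((UniformSpace.Completion.denseRange_coe (α := V)).closure_range ▸
          mem_univ (j.adjoint f))
      choose u hu using hw
      refine ⟨fun n => e (u n), ?_, fun ε hε => ?_⟩
      · refine ((j.continuous.tendsto _).comp hl).congr fun n => ?_
        simp only [Function.comp, ← hu, hj]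
      · obtain ⟨N, hN⟩ := Metric.cauchySeq_iff.1 hl.cauchySeq (√ε) (Real.sqrt_pos.2 hε)
        refine ⟨N, fun m hm n hn => ?_⟩
        have := hN m hm n hn
        rw [dist_eq_norm, ← hu, ← hu, ← UniformSpace.Completion.coe_sub,
          UniformSpace.Completion.norm_coe, Real.lt_sqrt (norm_nonneg _)] at this
        rw [← map_sub, ← he, inner_self_eq_norm_sq_to_K]
        simpa using this
  · rw [injective_iff_map_eq_zero]
    intro f hf
    -- `j j* f = 0` gives `‖j* f‖² = (f, j j* f) = 0`; then `f` is orthogonal to the range of `j`,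
    -- which contains the dense domain of `L₀`.
    have h0 : j.adjoint f = 0 := by
      rw [← inner_self_eq_zero (𝕜 := ℂ), ContinuousLinearMap.adjoint_inner_left]
      have : j (j.adjoint f) = 0 := hf
      rw [this, inner_zero_right]
    refine hd.eq_zero_of_inner_left (𝕜 := ℂ) fun x hx => ?_
    have h1 : inner ℂ f (j (e.symm ⟨x, hx⟩ : V)) = 0 := by
      rw [← ContinuousLinearMap.adjoint_inner_left, h0, inner_zero_left]
    rwa [hj, e.apply_symm_apply] at h1

/-- A copy of the domain of `L₀`, to carry the form of `L₀` as inner product. -/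
def FormDomain (L₀ : H →ₗ.[ℂ] H) : Type _ := L₀.domain

instance (L₀ : H →ₗ.[ℂ] H) : AddCommGroup (FormDomain L₀) :=
  inferInstanceAs (AddCommGroup L₀.domain)

instance (L₀ : H →ₗ.[ℂ] H) : Module ℂ (FormDomain L₀) :=
  inferInstanceAs (Module ℂ L₀.domain)

theorem exists_friedrichs_inverse {L₀ : H →ₗ.[ℂ] H} (hd : Dense (L₀.domain : Set H))
    (hp : IsPositiveDefinite L₀) :
    ∃ R : H →L[ℂ] H, (∀ y f, (y, f) ∈ friedrichsGraph L₀ ↔ y = R f) ∧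
      R.IsPositive ∧ Function.Injective R := by
  have hs := hp.symmetric
  obtain ⟨κ, hκ, h⟩ := hp
  let e : FormDomain L₀ ≃ₗ[ℂ] L₀.domain := LinearEquiv.refl ℂ L₀.domain
  let core : InnerProductSpace.Core ℂ (FormDomain L₀) :=
    { inner := fun x y => inner ℂ (L₀ (e x)) (e y : H)
      conj_inner_symm := fun x y => by
        rw [hs, inner_conj_symm]
      re_inner_nonneg := fun x => le_trans (by positivity) (h (e x)).2
      add_left := fun x y z => by rw [map_add, LinearPMap.map_add, inner_add_left]
      smul_left := fun x y r => by rw [map_smul, LinearPMap.map_smul, inner_smul_left]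
      definite := fun x hx => by
        have h2 := (h (e x)).2
        rw [hx] at h2
        have h3 : ‖(e x : H)‖ ^ 2 ≤ 0 := by
          simp only [Complex.zero_re] at h2
          nlinarith
        have h4 : (e x : H) = 0 := by
          rw [← norm_eq_zero]
          nlinarith [norm_nonneg (e x : H)]
        exact e.injective (by rw [map_zero]; exact Subtype.ext h4) }
  let _ : NormedAddCommGroup (FormDomain L₀) := core.toNormedAddCommGroup
  let _ : InnerProductSpace ℂ (FormDomain L₀) := InnerProductSpace.ofCore core.toCore
  refine exists_friedrichs_inverse_of_form hd e (fun _ _ => rfl) hκ fun x => ?_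
  rw [← inner_self_eq_norm_sq (𝕜 := ℂ) x]
  exact (h (e x)).2

/-- The graph condition determines the operator, so the choice in `friedrichsInverse` agrees with
the constructed operator and inherits its positivity and injectivity. -/
theorem friedrichsInverse_spec {L₀ : H →ₗ.[ℂ] H} (hd : Dense (L₀.domain : Set H))
    (hp : IsPositiveDefinite L₀) :
    (∀ y f, (y, f) ∈ friedrichsGraph L₀ ↔ y = friedrichsInverse L₀ f) ∧
      (friedrichsInverse L₀).IsPositive ∧ Function.Injective (friedrichsInverse L₀) := by
  obtain ⟨R, h1, h2, h3⟩ := exists_friedrichs_inverse hd hp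
  have hex : ∃ R : H →L[ℂ] H, ∀ y f, (y, f) ∈ friedrichsGraph L₀ ↔ y = R f := ⟨R, h1⟩
  have heq : friedrichsInverse L₀ = hex.choose := dif_pos hex
  have h4 : ∀ y f, (y, f) ∈ friedrichsGraph L₀ ↔ y = friedrichsInverse L₀ f := by
    rw [heq]
    exact hex.choose_spec
  have h5 : friedrichsInverse L₀ = R :=
    ContinuousLinearMap.ext fun f => ((h1 _ _).1 ((h4 _ f).2 rfl))
  exact ⟨h4, h5 ▸ h2, h5 ▸ h3⟩

end Friedrichs

/-! ### Scalar estimates for the symbols of the sine and cosine operators -/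

section SineCosine

/-- The factor `b (t / √r)` oscillates as `r → 0` and has a default value at `r = 0`; being bounded,
it is tamed by `f 0 = 0`. The functional calculus needs this because the spectrum of `L⁻¹` may
contain `0`. -/
theorem continuousOn_mul_comp_div_sqrt {f b : ℝ → ℝ} (hf : Continuous f) (h0 : f 0 = 0)
    (hb : Continuous b) (hb1 : ∀ x, |b x| ≤ 1) (t : ℝ) :
    ContinuousOn (fun r => f r * b (t / √r)) (Ici 0) := by
  intro r hr
  rcases eq_or_lt_of_le (mem_Ici.1 hr) with rfl | hr0
  · have h1 : Tendsto (fun r => |f r|) (𝓝[Ici 0] 0) (𝓝 0) := by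
      have := (hf.abs.tendsto 0).mono_left (nhdsWithin_le_nhds (s := Ici 0))
      simpa [h0] using this
    unfold ContinuousWithinAt
    simp only [h0, zero_mul]
    refine squeeze_zero_norm (fun r => ?_) h1
    rw [Real.norm_eq_abs, abs_mul]
    exact mul_le_of_le_one_right (abs_nonneg _) (hb1 _)
  · refine ContinuousAt.continuousWithinAt ?_
    have : √r ≠ 0 := (Real.sqrt_pos.2 hr0).ne'
    fun_prop (disch := assumption)

/-- A first-order Taylor estimate with a remainder uniform in the base point, which later becomes a
remainder uniform over the spectrum. -/
theorem abs_sub_sub_mul_le_sq {g g' : ℝ → ℝ} (hg : ∀ x, HasDerivAt g (g' x) x)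
    (hl : ∀ x y, |g' x - g' y| ≤ |x - y|) (a b : ℝ) :
    |g (a + b) - g a - b * g' a| ≤ b ^ 2 := by
  have hd : ∀ x ∈ uIcc 0 b, HasDerivWithinAt (fun x => g (a + x) - x * g' a)
      (g' (a + x) - g' a) (uIcc 0 b) x := by
    intro x _
    have h1 : HasDerivAt (fun x => g (a + x)) (g' (a + x)) x := (hg (a + x)).comp_const_add a x
    have h2 := h1.sub ((hasDerivAt_id x).mul_const (g' a))
    rw [one_mul] at h2
    exact h2.hasDerivWithinAt
  have h := (convex_uIcc (0 : ℝ) b).norm_image_sub_le_of_norm_hasDerivWithin_le (C := |b|) hd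
    (fun x hx => ?_) left_mem_uIcc right_mem_uIcc
  · simp only [add_zero, zero_mul, sub_zero, Real.norm_eq_abs] at h
    rw [← sq_abs b, sq]
    convert h using 2
    ring
  · have := hl (a + x) a
    rw [add_sub_cancel_left] at this
    refine this.trans ?_
    have h3 := abs_sub_left_of_mem_uIcc hx
    simpa using h3

theorem abs_sin_sub_sin_le (x y : ℝ) : |Real.sin x - Real.sin y| ≤ |x - y| := by
  have := Real.lipschitzWith_sin.dist_le_mul x y
  simpa [Real.dist_eq] using this

theorem abs_cos_sub_cos_le (x y : ℝ) : |Real.cos x - Real.cos y| ≤ |x - y| := by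
  have := Real.lipschitzWith_cos.dist_le_mul x y
  simpa [Real.dist_eq] using this

end SineCosine

/-! ### The sine and cosine operator functions and smoothing in time -/

section Operators

variable {H : Type*} [NormedAddCommGroup H] [InnerProductSpace ℂ H] [CompleteSpace H]

/-- The operator `L⁻¹ cos(t L^{1/2})`, `R = L⁻¹`. -/
def cosineOperator (R : H →L[ℂ] H) (t : ℝ) : H →L[ℂ] H :=
  cfc (fun r : ℝ => r * Real.cos (t / √r)) R

variable {R : H →L[ℂ] H}

theorem continuousOn_sine_symbol (t : ℝ) :
    ContinuousOn (fun r : ℝ => √r * Real.sin (t / √r)) (Ici 0) :=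
  continuousOn_mul_comp_div_sqrt Real.continuous_sqrt Real.sqrt_zero Real.continuous_sin
    Real.abs_sin_le_one t

theorem continuousOn_cosine_symbol (t : ℝ) :
    ContinuousOn (fun r : ℝ => r * Real.cos (t / √r)) (Ici 0) :=
  continuousOn_mul_comp_div_sqrt continuous_id rfl Real.continuous_cos
    Real.abs_cos_le_one t

theorem spectrum_subset_Ici (hR : R.IsPositive) : spectrum ℝ R ⊆ Ici 0 := fun _ hx =>
  spectrum_nonneg_of_nonneg ((ContinuousLinearMap.nonneg_iff_isPositive R).2 hR) hx

theorem isSelfAdjoint_sineOperator (R : H →L[ℂ] H) (t : ℝ) :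
    IsSelfAdjoint (sineOperator R t) :=
  cfc_predicate _ _

theorem inner_sineOperator_left (R : H →L[ℂ] H) (t : ℝ) (x y : H) :
    inner ℂ (sineOperator R t x) y = inner ℂ x (sineOperator R t y) := by
  rw [← ContinuousLinearMap.adjoint_inner_left, (isSelfAdjoint_sineOperator R t).adjoint_eq]

theorem sineOperator_neg (R : H →L[ℂ] H) (t : ℝ) : sineOperator R (-t) = -sineOperator R t := by
  rw [sineOperator, sineOperator, ← cfc_neg]
  congr 1
  ext r
  rw [neg_div, Real.sin_neg, mul_neg]

theorem sineOperator_zero (R : H →L[ℂ] H) : sineOperator R 0 = 0 := by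
  simp [sineOperator]

/-- The prefactor `√r` cancels the Lipschitz constant `1/√r` of `t ↦ sin (t / √r)`, uniformly over
the spectrum. -/
theorem norm_sineOperator_sub_le (hR : R.IsPositive) (t s : ℝ) :
    ‖sineOperator R t - sineOperator R s‖ ≤ |t - s| := by
  have hs := spectrum_subset_Ici hR
  rw [sineOperator, sineOperator,
    ← cfc_sub _ _ R ((continuousOn_sine_symbol t).mono hs) ((continuousOn_sine_symbol s).mono hs)]
  refine norm_cfc_le (abs_nonneg _) fun r hr => ?_
  rcases eq_or_lt_of_le (Real.sqrt_nonneg r) with h0 | h0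
  · simp [← h0]
  · rw [← mul_sub, Real.norm_eq_abs, abs_mul, abs_of_pos h0]
    refine (mul_le_mul_of_nonneg_left (abs_sin_sub_sin_le _ _) h0.le).trans (le_of_eq ?_)
    rw [← sub_div, abs_div, abs_of_pos h0]
    field_simp

theorem norm_sineOperator_le (hR : R.IsPositive) (t : ℝ) : ‖sineOperator R t‖ ≤ |t| := by
  simpa [sineOperator_zero] using norm_sineOperator_sub_le hR t 0

theorem continuous_sineOperator (hR : R.IsPositive) : Continuous (sineOperator R) := by
  refine (LipschitzWith.of_dist_le_mul (K := 1) fun t s => ?_).continuous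
  rw [dist_eq_norm, Real.dist_eq, NNReal.coe_one, one_mul]
  exact norm_sineOperator_sub_le hR t s

theorem mul_sineOperator (hR : R.IsPositive) (t : ℝ) :
    R * sineOperator R t = cfc (fun r : ℝ => r * (√r * Real.sin (t / √r))) R := by
  have hs := spectrum_subset_Ici hR
  have hsa : IsSelfAdjoint R := hR.isSelfAdjoint
  conv_lhs => enter [1]; rw [← cfc_id' ℝ R]
  rw [sineOperator, ← cfc_mul _ _ R (continuousOn_id' _) ((continuousOn_sine_symbol t).mono hs)]

theorem sineOperator_mul_comm (hR : R.IsPositive) (t : ℝ) :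
    sineOperator R t * R = R * sineOperator R t := by
  have hsa : IsSelfAdjoint R := hR.isSelfAdjoint
  have h := cfc_commute_cfc (R := ℝ) (fun r => √r * Real.sin (t / √r)) (fun r : ℝ => r) R
  rw [cfc_id' ℝ R] at h
  exact h

theorem sineOperator_apply_comm (hR : R.IsPositive) (t : ℝ) (x : H) :
    sineOperator R t (R x) = R (sineOperator R t x) :=
  DFunLike.congr_fun (sineOperator_mul_comm hR t) x

theorem cosineOperator_zero (hR : R.IsPositive) : cosineOperator R 0 = R := by
  have hsa : IsSelfAdjoint R := hR.isSelfAdjoint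
  simp [cosineOperator, cfc_id' ℝ R]

theorem hasDerivAt_of_norm_sub_le_sq {E : Type*} [NormedAddCommGroup E] [NormedSpace ℝ E]
    {f : ℝ → E} {f' : E} {t K : ℝ} (h : ∀ τ, ‖f (t + τ) - f t - τ • f'‖ ≤ K * τ ^ 2) :
    HasDerivAt f f' t := by
  rw [hasDerivAt_iff_isLittleO_nhds_zero]
  refine Asymptotics.IsBigO.trans_isLittleO (g := fun τ : ℝ => τ ^ 2) ?_
    (Asymptotics.isLittleO_pow_id one_lt_two)
  refine Asymptotics.IsBigO.of_bound K (Eventually.of_forall fun τ => ?_)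
  simpa using h τ

/-- Multiplication by `R` makes the derivative exist in operator norm: the Taylor remainder of the
symbol is at most `r √r (τ/√r)² = √r τ²`, bounded on the spectrum. -/
theorem hasDerivAt_mul_sineOperator (hR : R.IsPositive) (t : ℝ) :
    HasDerivAt (fun t => R * sineOperator R t) (cosineOperator R t) t := by
  have hs := spectrum_subset_Ici hR
  have hc : ∀ t, ContinuousOn (fun r : ℝ => r * (√r * Real.sin (t / √r))) (spectrum ℝ R) :=
    fun t => continuousOn_id.mul ((continuousOn_sine_symbol t).mono hs)
  have hc' := (continuousOn_cosine_symbol t).mono hs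
  -- The constant bounds `√r` on the spectrum; the factor `‖1‖` avoids a nontriviality assumption on
  -- `H`.
  refine hasDerivAt_of_norm_sub_le_sq (K := √(‖R‖ * ‖(1 : H →L[ℂ] H)‖)) fun τ => ?_
  have h12 : ContinuousOn (fun r : ℝ => r * (√r * Real.sin ((t + τ) / √r)) -
      r * (√r * Real.sin (t / √r))) (spectrum ℝ R) := (hc _).sub (hc _)
  have hcs : ContinuousOn (fun r : ℝ => τ • (r * Real.cos (t / √r))) (spectrum ℝ R) :=
    hc'.const_smul τ
  rw [mul_sineOperator hR, mul_sineOperator hR, cosineOperator,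
    ← cfc_smul _ _ R hc', ← cfc_sub _ _ R (hc _) (hc _),
    ← cfc_sub _ _ R h12 hcs]
  refine norm_cfc_le (by positivity) fun r hr => ?_
  have hr0 := hs hr
  have hr1 : r ≤ ‖R‖ * ‖(1 : H →L[ℂ] H)‖ :=
    (le_abs_self r).trans (spectrum.norm_le_norm_mul_of_mem hr)
  rcases eq_or_lt_of_le (Real.sqrt_nonneg r) with h0 | h0
  · have : r = 0 := by
      have := Real.sq_sqrt hr0
      rw [← h0] at this
      simpa using this.symm
    simp [this]
    positivity
  · have key := abs_sub_sub_mul_le_sq Real.hasDerivAt_sin abs_cos_sub_cos_le (t / √r) (τ / √r)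
    have e : r * (√r * Real.sin ((t + τ) / √r)) - r * (√r * Real.sin (t / √r)) -
        τ • (r * Real.cos (t / √r)) = r * √r * (Real.sin (t / √r + τ / √r) - Real.sin (t / √r) -
          τ / √r * Real.cos (t / √r)) := by
      rw [add_div, smul_eq_mul]
      field_simp
    rw [e, Real.norm_eq_abs, abs_mul, abs_of_nonneg (mul_nonneg hr0 h0.le)]
    refine (mul_le_mul_of_nonneg_left key (mul_nonneg hr0 h0.le)).trans ?_
    have e2 : r * √r * (τ / √r) ^ 2 = √r * τ ^ 2 := by
      rw [div_pow, Real.sq_sqrt hr0]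
      have : r ≠ 0 := (Real.sqrt_pos.1 h0).ne'
      field_simp
    rw [e2]
    gcongr

/-- Here the remainder of the symbol is at most `r (τ/√r)² = τ²`, so the constant is `1`. -/
theorem hasDerivAt_cosineOperator (hR : R.IsPositive) (t : ℝ) :
    HasDerivAt (cosineOperator R) (-sineOperator R t) t := by
  have hs := spectrum_subset_Ici hR
  have hc : ∀ t, ContinuousOn (fun r : ℝ => r * Real.cos (t / √r)) (spectrum ℝ R) :=
    fun t => (continuousOn_cosine_symbol t).mono hs
  have hc' := (continuousOn_sine_symbol t).mono hs
  have hlip : ∀ x y : ℝ, |-Real.sin x - -Real.sin y| ≤ |x - y| := by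
    intro x y
    rw [neg_sub_neg, abs_sub_comm]
    exact abs_sin_sub_sin_le x y
  refine hasDerivAt_of_norm_sub_le_sq (K := 1) fun τ => ?_
  have h12 : ContinuousOn (fun r : ℝ => r * Real.cos ((t + τ) / √r) -
      r * Real.cos (t / √r)) (spectrum ℝ R) := (hc _).sub (hc _)
  have hcs : ContinuousOn (fun r : ℝ => τ • (√r * Real.sin (t / √r))) (spectrum ℝ R) :=
    hc'.const_smul τ
  rw [smul_neg, sub_neg_eq_add, cosineOperator, cosineOperator, sineOperator,
    ← cfc_smul _ _ R hc', ← cfc_sub _ _ R (hc _) (hc _),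
    ← cfc_add R _ _ h12 hcs]
  refine norm_cfc_le (by positivity) fun r hr => ?_
  have hr0 := hs hr
  rcases eq_or_lt_of_le (Real.sqrt_nonneg r) with h0 | h0
  · have : r = 0 := by
      have := Real.sq_sqrt hr0
      rw [← h0] at this
      simpa using this.symm
    simp [this]
    positivity
  · have key := abs_sub_sub_mul_le_sq Real.hasDerivAt_cos hlip (t / √r) (τ / √r)
    have hne : r ≠ 0 := (Real.sqrt_pos.1 h0).ne'
    have hsq : √r * √r = r := Real.mul_self_sqrt hr0
    have e : r * Real.cos ((t + τ) / √r) - r * Real.cos (t / √r) +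
        τ • (√r * Real.sin (t / √r)) = r * (Real.cos (t / √r + τ / √r) - Real.cos (t / √r) -
          τ / √r * -Real.sin (t / √r)) := by
      have : r * (τ / √r) = τ * √r := by
        rw [mul_div_assoc', div_eq_iff h0.ne']
        linear_combination -τ * hsq
      rw [add_div, smul_eq_mul]
      linear_combination -Real.sin (t / √r) * this
    rw [e, Real.norm_eq_abs, abs_mul, abs_of_nonneg hr0]
    refine (mul_le_mul_of_nonneg_left key hr0).trans (le_of_eq ?_)
    rw [div_pow, Real.sq_sqrt hr0]
    field_simp

theorem hasDerivAt_operator_apply {E : Type*} [NormedAddCommGroup E] [NormedSpace ℂ E]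
    {F : ℝ → E →L[ℂ] E} {F' : E →L[ℂ] E} {t : ℝ} (h : HasDerivAt F F' t) (x : E) :
    HasDerivAt (fun t => F t x) (F' x) t :=
  ((ContinuousLinearMap.apply ℂ E x).restrictScalars ℝ).hasFDerivAt.comp_hasDerivAt t h

theorem continuous_sineOperator_apply (hR : R.IsPositive) (x : H) :
    Continuous fun t => sineOperator R t x :=
  (continuous_sineOperator hR).clm_apply continuous_const

theorem sineOperator_mul_sineOperator (hR : R.IsPositive) (s h : ℝ) :
    sineOperator R s * sineOperator R h =
      (2⁻¹ : ℝ) • (cosineOperator R (s - h) - cosineOperator R (s + h)) := by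
  have hs := spectrum_subset_Ici hR
  have hc : ∀ t, ContinuousOn (fun r : ℝ => r * Real.cos (t / √r)) (spectrum ℝ R) :=
    fun t => (continuousOn_cosine_symbol t).mono hs
  have hc' : ∀ t, ContinuousOn (fun r : ℝ => √r * Real.sin (t / √r)) (spectrum ℝ R) :=
    fun t => (continuousOn_sine_symbol t).mono hs
  have h12 : ContinuousOn (fun r : ℝ => r * Real.cos ((s - h) / √r) -
      r * Real.cos ((s + h) / √r)) (spectrum ℝ R) := (hc _).sub (hc _)
  rw [sineOperator, sineOperator, cosineOperator, cosineOperator, ← cfc_sub _ _ R (hc _) (hc _),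
    ← cfc_smul _ _ R h12, ← cfc_mul _ _ R (hc' _) (hc' _)]
  refine cfc_congr fun r hr => ?_
  have hsq : √r * √r = r := Real.mul_self_sqrt (hs hr)
  simp only [smul_eq_mul, sub_div, add_div, Real.cos_sub, Real.cos_add]
  linear_combination Real.sin (s / √r) * Real.sin (h / √r) * hsq

/-- The product formula for sines gives a difference of cosine operators, which is then an integral
of their derivative. Its use: a linear property of `S(σ) x` on a time interval passes to `S(s) S(h)
x` on the interval shortened by `h`. -/
theorem sineOperator_sineOperator_apply (hR : R.IsPositive) (s h : ℝ) (x : H) :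
    sineOperator R s (sineOperator R h x) =
      (2⁻¹ : ℝ) • ∫ σ in (s - h)..(s + h), sineOperator R σ x := by
  have h1 := DFunLike.congr_fun (sineOperator_mul_sineOperator hR s h) x
  have h2 : ∫ σ in (s - h)..(s + h), -sineOperator R σ x =
      cosineOperator R (s + h) x - cosineOperator R (s - h) x :=
    intervalIntegral.integral_eq_sub_of_hasDerivAt
      (fun t _ => hasDerivAt_operator_apply (hasDerivAt_cosineOperator hR t) x)
      ((continuous_sineOperator_apply hR x).neg.intervalIntegrable _ _)
  rw [intervalIntegral.integral_neg] at h2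
  have h3 : ∫ σ in (s - h)..(s + h), sineOperator R σ x =
      cosineOperator R (s - h) x - cosineOperator R (s + h) x := by
    rw [← neg_inj, h2, neg_sub]
  rw [h3]
  exact h1

/-- Powers of `L^{-1/2} sin(h L^{1/2})` map into the domains of powers of `L`. -/
theorem exists_sineOperator_pow_seven_eq (hR : R.IsPositive) (h : ℝ) :
    ∃ G : H →L[ℂ] H, sineOperator R h ^ 7 = R ^ 3 * G := by
  have hs := spectrum_subset_Ici hR
  have hsa : IsSelfAdjoint R := hR.isSelfAdjoint
  have hb : ∀ x : ℝ, |Real.sin x ^ 7| ≤ 1 := fun x => by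
    rw [abs_pow]
    exact pow_le_one₀ (abs_nonneg _) (Real.abs_sin_le_one x)
  -- Of the seven factors `√r`, six give `r³`; the seventh is kept so that the remaining symbol is
  -- continuous at `0`.
  have hc : ContinuousOn (fun r : ℝ => √r * Real.sin (h / √r) ^ 7) (spectrum ℝ R) :=
    (continuousOn_mul_comp_div_sqrt Real.continuous_sqrt Real.sqrt_zero
      (Real.continuous_sin.pow 7) hb h).mono hs
  refine ⟨cfc (fun r : ℝ => √r * Real.sin (h / √r) ^ 7) R, ?_⟩
  have h3 : R ^ 3 = cfc (fun r : ℝ => r ^ 3) R := (cfc_pow_id R 3).symm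
  rw [h3, sineOperator, ← cfc_pow _ _ R ((continuousOn_sine_symbol h).mono hs),
    ← cfc_mul _ _ R (by fun_prop) hc]
  refine cfc_congr fun r hr => ?_
  have hsq : √r * √r = r := Real.mul_self_sqrt (hs hr)
  calc (√r * Real.sin (h / √r)) ^ 7 = (√r * √r) ^ 3 * (√r * Real.sin (h / √r) ^ 7) := by ring
    _ = _ := by rw [hsq]

/-- `h⁻¹ L^{-1/2} sin(h L^{1/2})`. -/
def averageOperator (R : H →L[ℂ] H) (h : ℝ) : H →L[ℂ] H := h⁻¹ • sineOperator R h

theorem norm_averageOperator_le (hR : R.IsPositive) (h : ℝ) : ‖averageOperator R h‖ ≤ 1 := by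
  rw [averageOperator, norm_smul, norm_inv, Real.norm_eq_abs]
  rcases eq_or_ne h 0 with rfl | h0
  · simp
  · rw [inv_mul_le_iff₀ (abs_pos.2 h0), mul_one]
    exact norm_sineOperator_le hR h

theorem norm_averageOperator_apply_le (hR : R.IsPositive) (h : ℝ) (x : H) :
    ‖averageOperator R h x‖ ≤ ‖x‖ := by
  simpa using (averageOperator R h).le_of_opNorm_le (norm_averageOperator_le hR h) x

/-- On the range of `R` the averages are difference quotients at `0` of `R S(h)`, whose derivative
there is `R`; the bound `‖h⁻¹ S(h)‖ ≤ 1` extends convergence to the closure. -/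
theorem tendsto_averageOperator (hR : R.IsPositive) (hd : DenseRange R) (x : H) :
    Tendsto (fun h => averageOperator R h x) (𝓝[>] 0) (𝓝 x) := by
  have hrange : ∀ y, Tendsto (fun h => averageOperator R h (R y)) (𝓝[>] 0) (𝓝 (R y)) := by
    intro y
    have h1 := hasDerivAt_operator_apply (hasDerivAt_mul_sineOperator hR 0) y
    rw [cosineOperator_zero hR] at h1
    have h2 := (hasDerivAt_iff_tendsto_slope.1 h1).mono_left
      (nhdsWithin_mono (0 : ℝ) (s := Ioi 0) fun x hx => (ne_of_gt hx))
    refine h2.congr fun h => ?_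
    simp [slope, averageOperator, sineOperator_zero, sineOperator_apply_comm hR]
  refine Metric.tendsto_nhds.2 fun ε hε => ?_
  obtain ⟨y, hy⟩ := hd.exists_dist_lt x (show 0 < ε / 3 by positivity)
  have h1 := Metric.tendsto_nhds.1 (hrange y) (ε / 3) (by positivity)
  filter_upwards [h1] with h hh
  rw [dist_comm, dist_eq_norm] at hy
  rw [dist_eq_norm] at hh ⊢
  have h3 := norm_averageOperator_apply_le hR h (R y - x)
  rw [map_sub] at h3
  have e : averageOperator R h x - x = -(averageOperator R h (R y) - averageOperator R h x) +
      (averageOperator R h (R y) - R y) + (R y - x) := by abel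
  rw [e]
  have h4 := norm_add₃_le (a := -(averageOperator R h (R y) - averageOperator R h x))
    (b := averageOperator R h (R y) - R y) (c := R y - x)
  rw [norm_neg] at h4
  linarith

theorem tendsto_averageOperator_pow (hR : R.IsPositive) (hd : DenseRange R) (x : H) (n : ℕ) :
    Tendsto (fun h => (averageOperator R h ^ n) x) (𝓝[>] 0) (𝓝 x) := by
  induction n with
  | zero => simp
  | succ n ih =>
    have h1 := tendsto_averageOperator hR hd x
    rw [tendsto_iff_norm_sub_tendsto_zero] at ih h1 ⊢
    refine squeeze_zero (fun _ => norm_nonneg _) (fun h => ?_) (by simpa only [add_zero] using ih.add h1)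
    have e : (averageOperator R h ^ (n + 1)) x - x =
        averageOperator R h ((averageOperator R h ^ n) x - x) + (averageOperator R h x - x) := by
      rw [pow_succ', mul_apply_eq_comp, map_sub]
      abel
    rw [e]
    exact (norm_add_le _ _).trans (add_le_add_left (norm_averageOperator_apply_le hR h _) _)

theorem averageOperator_pow_apply (R : H →L[ℂ] H) (h : ℝ) (n : ℕ) (x : H) :
    (averageOperator R h ^ n) x = (h⁻¹ ^ n) • (sineOperator R h ^ n) x := by
  rw [averageOperator, smul_pow]
  rfl

end Operators

/-! ### Integration by parts for absolutely continuous functions -/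

section ByParts

/-- Integration by parts for two indefinite integrals. -/
theorem integral_primitive_mul_add {g h : ℝ → ℂ} {b : ℝ} (hb : 0 ≤ b)
    (hg : IntervalIntegrable g volume 0 b) (hh : IntervalIntegrable h volume 0 b) :
    (∫ x in (0 : ℝ)..b, (∫ s in (0 : ℝ)..x, h s) * g x) +
      (∫ x in (0 : ℝ)..b, h x * ∫ s in (0 : ℝ)..x, g s) =
      (∫ x in (0 : ℝ)..b, h x) * ∫ x in (0 : ℝ)..b, g x := by
  have hg' : Integrable g (volume.restrict (Ioc 0 b)) :=
    (intervalIntegrable_iff_integrableOn_Ioc_of_le hb).1 hg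
  have hh' : Integrable h (volume.restrict (Ioc 0 b)) :=
    (intervalIntegrable_iff_integrableOn_Ioc_of_le hb).1 hh
  have hprod := hh'.mul_prod hg'
  -- Fubini on the square `(0, b]²`: the first integral is that of `h(s) g(x)` over `s ≤ x`, the
  -- second over `x < s`, and together they give the product.
  have hA : MeasurableSet {p : ℝ × ℝ | p.1 ≤ p.2} := measurableSet_le measurable_fst measurable_snd
  have e1 : (∫ x in (0 : ℝ)..b, (∫ s in (0 : ℝ)..x, h s) * g x) =
      ∫ s in Ioc 0 b, ∫ x in Ioc 0 b,
        {p : ℝ × ℝ | p.1 ≤ p.2}.indicator (fun p : ℝ × ℝ => h p.1 * g p.2) (s, x) := by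
    rw [intervalIntegral.integral_of_le hb, integral_integral_swap
      (f := fun s x => {p : ℝ × ℝ | p.1 ≤ p.2}.indicator (fun p : ℝ × ℝ => h p.1 * g p.2) (s, x))
      (hprod.indicator hA)]
    refine setIntegral_congr_fun measurableSet_Ioc fun x hx => ?_
    have : ∀ s, {p : ℝ × ℝ | p.1 ≤ p.2}.indicator (fun p : ℝ × ℝ => h p.1 * g p.2) (s, x) =
        (Iic x).indicator h s * g x := by
      intro s
      by_cases hs : s ≤ x <;> simp [indicator, hs]
    simp only [this]
    rw [integral_mul_const, integral_indicator measurableSet_Iic,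
      Measure.restrict_restrict measurableSet_Iic, intervalIntegral.integral_of_le hx.1.le]
    congr 3
    ext s
    simp only [mem_Ioc, mem_inter_iff, mem_Iic]
    exact ⟨fun h => ⟨h.2, h.1, h.2.trans hx.2⟩, fun h => ⟨h.2.1, h.1⟩⟩
  have e2 : (∫ x in (0 : ℝ)..b, h x * ∫ s in (0 : ℝ)..x, g s) =
      ∫ s in Ioc 0 b, ∫ x in Ioc 0 b,
        {p : ℝ × ℝ | p.1 ≤ p.2}ᶜ.indicator (fun p : ℝ × ℝ => h p.1 * g p.2) (s, x) := by
    rw [intervalIntegral.integral_of_le hb]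
    refine setIntegral_congr_fun measurableSet_Ioc fun s hs => ?_
    have : ∀ x, {p : ℝ × ℝ | p.1 ≤ p.2}ᶜ.indicator (fun p : ℝ × ℝ => h p.1 * g p.2) (s, x) =
        h s * (Iio s).indicator g x := by
      intro x
      by_cases hx : x < s
      · simp [indicator, hx]
      · simp [indicator, hx, not_lt.1 hx]
    simp only [this]
    rw [integral_const_mul, integral_indicator measurableSet_Iio,
      Measure.restrict_restrict measurableSet_Iio, intervalIntegral.integral_of_le hs.1.le,
      integral_Ioc_eq_integral_Ioo]
    congr 4
    ext x
    simp only [mem_Ioo, mem_inter_iff, mem_Iio, mem_Ioc]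
    exact ⟨fun h => ⟨h.2, h.1, h.2.le.trans hs.2⟩, fun h => ⟨h.2.1, h.1⟩⟩
  have h1 := (hprod.indicator hA).integral_prod_left
  have h2 := (hprod.indicator hA.compl).integral_prod_left
  rw [e1, e2, ← integral_add h1 h2, intervalIntegral.integral_of_le hb,
    intervalIntegral.integral_of_le hb, ← integral_mul_const]
  refine integral_congr_ae ?_
  filter_upwards [(hprod.indicator hA).prod_right_ae, (hprod.indicator hA.compl).prod_right_ae]
    with s hs1 hs2
  rw [← integral_add hs1 hs2, ← integral_const_mul]
  congr 1
  ext x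
  exact congrFun (indicator_self_add_compl {p : ℝ × ℝ | p.1 ≤ p.2}
    (fun p : ℝ × ℝ => h p.1 * g p.2)) (s, x)

end ByParts

/-! ### Test functions, Green's formula and density of the minimal domain -/

section HalfLine

variable {q : ℝ → ℝ}

theorem continuous_comp_abs (hq : ContinuousOn q (Ici 0)) : Continuous fun x => q |x| :=
  hq.comp_continuous continuous_abs fun x => abs_nonneg x

theorem SolvesSL.congr_ae {z z' u v : ℝ → ℂ} (h : SolvesSL q z u v) (hz : z =ᵐ[halfLine] z') :
    SolvesSL q z' u v := by
  have key : ∀ x : ℝ, 0 ≤ x → ∀ᵐ s, s ∈ uIoc (0 : ℝ) x →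
      (q s : ℂ) * u s - z s = (q s : ℂ) * u s - z' s := by
    intro x hx
    filter_upwards [(ae_restrict_iff' measurableSet_Ioi).1 hz] with s hs hsx
    rw [uIoc_of_le hx] at hsx
    rw [hs hsx.1]
  refine ⟨h.deriv, fun x hx => (h.integrable x hx).congr_ae ?_, fun x hx => ?_⟩
  · exact (ae_restrict_iff' measurableSet_uIoc).2 (key x hx)
  · rw [← intervalIntegral.integral_congr_ae (key x hx)]
    exact h.integral x hx

/-- Smooth compactly supported functions on the line. -/
def IsTest (η : ℝ → ℂ) : Prop := ContDiff ℝ (⊤ : ℕ∞) η ∧ HasCompactSupport η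

/-- The expression `-η'' + q η` on the half-line, with `q` extended evenly. -/
def slExpr (q : ℝ → ℝ) (η : ℝ → ℂ) (x : ℝ) : ℂ := (q |x| : ℂ) * η x - deriv (deriv η) x

theorem IsTest.continuous {η : ℝ → ℂ} (h : IsTest η) : Continuous η := h.1.continuous

theorem IsTest.hasDerivAt {η : ℝ → ℂ} (h : IsTest η) (x : ℝ) : HasDerivAt η (deriv η x) x :=
  (h.1.differentiable (by simp) x).hasDerivAt

theorem IsTest.derivative {η : ℝ → ℂ} (h : IsTest η) : IsTest (deriv η) :=
  ⟨(contDiff_infty_iff_deriv.1 h.1).2, h.2.deriv⟩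

theorem IsTest.memLp {η : ℝ → ℂ} (h : IsTest η) : MemLp η 2 halfLine :=
  h.continuous.memLp_of_hasCompactSupport h.2

theorem IsTest.continuous_slExpr {η : ℝ → ℂ} (h : IsTest η) (hq : ContinuousOn q (Ici 0)) :
    Continuous (slExpr q η) :=
  ((Complex.continuous_ofReal.comp (continuous_comp_abs hq)).mul h.continuous).sub
    h.derivative.derivative.continuous

theorem IsTest.hasCompactSupport_slExpr {η : ℝ → ℂ} (h : IsTest η) :
    HasCompactSupport (slExpr q η) :=
  (h.2.mul_left).sub h.derivative.derivative.2

theorem IsTest.memLp_slExpr {η : ℝ → ℂ} (h : IsTest η) (hq : ContinuousOn q (Ici 0)) :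
    MemLp (slExpr q η) 2 halfLine :=
  (h.continuous_slExpr hq).memLp_of_hasCompactSupport h.hasCompactSupport_slExpr

theorem IsTest.solvesSL {η : ℝ → ℂ} (h : IsTest η) :
    SolvesSL q (slExpr q η) η (deriv η) := by
  have key : ∀ x : ℝ, 0 ≤ x → ∀ᵐ s, s ∈ uIoc (0 : ℝ) x →
      deriv (deriv η) s = (q s : ℂ) * η s - slExpr q η s := by
    intro x hx
    refine Eventually.of_forall fun s hs => ?_
    rw [uIoc_of_le hx] at hs
    rw [slExpr, abs_of_pos hs.1]
    ring
  refine ⟨fun x _ => (h.hasDerivAt x).hasDerivWithinAt, fun x hx => ?_, fun x hx => ?_⟩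
  · refine IntervalIntegrable.congr_ae ?_ ((ae_restrict_iff' measurableSet_uIoc).2 (key x hx))
    exact h.derivative.derivative.continuous.intervalIntegrable _ _
  · rw [← intervalIntegral.integral_congr_ae (key x hx),
      intervalIntegral.integral_eq_sub_of_hasDerivAt (fun t _ => h.derivative.hasDerivAt t)
      (h.derivative.derivative.continuous.intervalIntegrable _ _)]
    ring

theorem mem_slGraph {u v z : ℝ → ℂ} (hu : MemLp u 2 halfLine) (hz : MemLp z 2 halfLine)
    (h : SolvesSL q z u v) (h0 : u 0 = 0) (h1 : v 0 = 0) :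
    (hu.toLp u, hz.toLp z) ∈ slGraph q :=
  ⟨u, v, hu.coeFn_toLp, h.congr_ae hz.coeFn_toLp.symm, h0, h1⟩

theorem slOperator_graph (q : ℝ → ℝ) : (slOperator q).graph = slGraph q :=
  Submodule.toLinearPMap_graph_eq _ (slGraph_functional q)

theorem exists_domain_of_mem_slGraph {p : L2 × L2} (hp : p ∈ slGraph q) :
    ∃ x : (slOperator q).domain, (x : L2) = p.1 ∧ slOperator q x = p.2 := by
  rw [← slOperator_graph] at hp
  exact (LinearPMap.mem_graph_iff _).1 hp

theorem mem_slGraph_of_domain (x : (slOperator q).domain) :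
    ((x : L2), slOperator q x) ∈ slGraph q := by
  rw [← slOperator_graph]
  exact LinearPMap.mem_graph _ x

theorem L2_inner_eq (f g : L2) : inner ℂ f g = ∫ x in Ioi (0 : ℝ), (starRingEnd ℂ) (f x) * g x := by
  rw [L2.inner_def]
  refine integral_congr_ae (Eventually.of_forall fun x => ?_)
  simp only [RCLike.inner_apply, mul_comm]

theorem inner_toLp_left {f : ℝ → ℂ} (hf : MemLp f 2 halfLine) (g : L2) :
    inner ℂ (hf.toLp f) g = ∫ x in Ioi (0 : ℝ), (starRingEnd ℂ) (f x) * g x := by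
  rw [L2_inner_eq]
  refine integral_congr_ae ?_
  filter_upwards [hf.coeFn_toLp] with x hx
  rw [hx]

theorem inner_toLp_toLp {f g : ℝ → ℂ} (hf : MemLp f 2 halfLine) (hg : MemLp g 2 halfLine) :
    inner ℂ (hf.toLp f) (hg.toLp g) = ∫ x in Ioi (0 : ℝ), (starRingEnd ℂ) (f x) * g x := by
  rw [inner_toLp_left]
  refine integral_congr_ae ?_
  filter_upwards [hg.coeFn_toLp] with x hx
  rw [hx]

/-- The integral over the half-line of a function that vanishes beyond `b`. -/
theorem setIntegral_Ioi_eq_intervalIntegral {f : ℝ → ℂ} {b : ℝ} (hb : 0 ≤ b)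
    (hf : ∀ᵐ x ∂halfLine, b < x → f x = 0) :
    ∫ x in Ioi (0 : ℝ), f x = ∫ x in (0 : ℝ)..b, f x := by
  rw [intervalIntegral.integral_of_le hb]
  refine setIntegral_eq_of_subset_of_ae_sdiff_eq_zero measurableSet_Ioi.nullMeasurableSet
    Ioc_subset_Ioi_self ?_
  filter_upwards [(ae_restrict_iff' measurableSet_Ioi).1 hf] with x hx hxd
  exact hx hxd.1 (not_le.1 fun h => hxd.2 ⟨hxd.1, h⟩)

theorem _root_.HasCompactSupport.exists_forall_ge_eq_zero {f : ℝ → ℂ} (hf : HasCompactSupport f) :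
    ∃ b > 0, ∀ x, b ≤ |x| → f x = 0 := by
  obtain ⟨r, hr⟩ := hf.isCompact.isBounded.subset_closedBall 0
  refine ⟨|r| + 1, by positivity, fun x hx => ?_⟩
  by_contra h
  have h1 := hr (subset_tsupport _ h)
  rw [Metric.mem_closedBall, dist_zero_right, Real.norm_eq_abs] at h1
  linarith [le_abs_self r]

theorem IsTest.conj {η : ℝ → ℂ} (h : IsTest η) : IsTest fun x => (starRingEnd ℂ) (η x) := by
  refine ⟨Complex.conjCLE.contDiff.comp h.1, ?_⟩
  exact h.2.comp_left (g := starRingEnd ℂ) (map_zero _)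

theorem IsTest.slExpr_conj {η : ℝ → ℂ} (h : IsTest η) (x : ℝ) :
    slExpr q (fun x => (starRingEnd ℂ) (η x)) x = (starRingEnd ℂ) (slExpr q η x) := by
  have h1 : ∀ {φ : ℝ → ℂ}, IsTest φ → deriv (fun x => (starRingEnd ℂ) (φ x)) =
      fun x => (starRingEnd ℂ) (deriv φ x) := by
    intro φ hφ
    ext x
    exact (Complex.conjCLE.toContinuousLinearMap.hasFDerivAt.comp_hasDerivAt x
      (hφ.hasDerivAt x)).deriv
  rw [slExpr, h1 h, h1 h.derivative, slExpr, map_sub, map_mul, Complex.conj_ofReal]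

theorem IsTest.exists_bound (q : ℝ → ℝ) {η : ℝ → ℂ} (h : IsTest η) :
    ∃ b > 0, ∀ x, b ≤ x → η x = 0 ∧ deriv η x = 0 ∧ slExpr q η x = 0 := by
  obtain ⟨b₁, h₁, hb₁⟩ := h.2.exists_forall_ge_eq_zero
  obtain ⟨b₂, h₂, hb₂⟩ := h.derivative.2.exists_forall_ge_eq_zero
  obtain ⟨b₃, h₃, hb₃⟩ := (h.hasCompactSupport_slExpr (q := q)).exists_forall_ge_eq_zero
  refine ⟨max b₁ (max b₂ b₃), by positivity, fun x hx => ?_⟩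
  have hx' := hx.trans (le_abs_self x)
  simp only [max_le_iff] at hx'
  exact ⟨hb₁ x hx'.1, hb₂ x hx'.2.1, hb₃ x hx'.2.2⟩

theorem SolvesSL.continuousOn_fst {z u v : ℝ → ℂ} (h : SolvesSL q z u v) :
    ContinuousOn u (Ici 0) := fun x hx => (h.deriv x hx).continuousWithinAt

theorem continuousOn_primitive_of_integrable {w : ℝ → ℂ}
    (h : ∀ x ≥ 0, IntervalIntegrable w volume 0 x) :
    ContinuousOn (fun x => ∫ s in (0 : ℝ)..x, w s) (Ici 0) := by
  intro x hx
  have h1 : IntegrableOn w (uIcc 0 (x + 1)) := by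
    rw [uIcc_of_le (by linarith [mem_Ici.1 hx]), integrableOn_Icc_iff_integrableOn_Ioc]
    exact (intervalIntegrable_iff_integrableOn_Ioc_of_le (by linarith [mem_Ici.1 hx])).1
      (h (x + 1) (by linarith [mem_Ici.1 hx]))
  have h2 := intervalIntegral.continuousOn_primitive_interval h1
  rw [uIcc_of_le (by linarith [mem_Ici.1 hx])] at h2
  refine (h2 x ⟨hx, by linarith⟩).mono_of_mem_nhdsWithin ?_
  have : Iio (x + 1) ∈ 𝓝 x := Iio_mem_nhds (by linarith)
  filter_upwards [self_mem_nhdsWithin, mem_nhdsWithin_of_mem_nhds this] with y h3 h4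
  exact ⟨h3, h4.le⟩

theorem SolvesSL.continuousOn_snd {z u v : ℝ → ℂ} (h : SolvesSL q z u v) :
    ContinuousOn v (Ici 0) :=
  (continuousOn_const.add (continuousOn_primitive_of_integrable h.integrable)).congr h.integral

theorem SolvesSL.intervalIntegrable_snd {z u v : ℝ → ℂ} (h : SolvesSL q z u v) {x : ℝ}
    (hx : 0 ≤ x) : IntervalIntegrable v volume 0 x :=
  (h.continuousOn_snd.mono (by rw [uIcc_of_le hx]; exact Icc_subset_Ici_self)).intervalIntegrable

theorem SolvesSL.fst_eq {z u v : ℝ → ℂ} (h : SolvesSL q z u v) {x : ℝ} (hx : 0 ≤ x) :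
    u x = u 0 + ∫ s in (0 : ℝ)..x, v s := by
  rw [intervalIntegral.integral_eq_sub_of_hasDerivAt_of_le hx
    (h.continuousOn_fst.mono Icc_subset_Ici_self)
    (fun y hy => (h.deriv y hy.1.le).hasDerivAt (Ici_mem_nhds hy.1)) (h.intervalIntegrable_snd hx)]
  ring

/-- Green's formula on the half-line, for a function with zero Cauchy data at `0`. -/
theorem integral_slExpr_mul {η u v z : ℝ → ℂ} (hη : IsTest η) (h : SolvesSL q z u v)
    (h0 : u 0 = 0) (h1 : v 0 = 0) {b : ℝ} (hb : 0 ≤ b) (hηb : η b = 0) (hηb' : deriv η b = 0)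
    (hz : IntervalIntegrable z volume 0 b) :
    ∫ x in (0 : ℝ)..b, slExpr q η x * u x = ∫ x in (0 : ℝ)..b, η x * z x := by
  have hsub : uIcc 0 b ⊆ Ici 0 := by rw [uIcc_of_le hb]; exact Icc_subset_Ici_self
  have hu : ContinuousOn u (uIcc 0 b) := h.continuousOn_fst.mono hsub
  have hv : ContinuousOn v (uIcc 0 b) := h.continuousOn_snd.mono hsub
  have hη2 := hη.derivative.derivative.continuous
  have hη1 := hη.derivative.continuous
  have hη0 := hη.continuous
  set w : ℝ → ℂ := fun s => (q s : ℂ) * u s - z s with hw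
  have hwi : IntervalIntegrable w volume 0 b := h.integrable b hb
  have prim1 : ∀ x, ∫ s in (0 : ℝ)..x, deriv (deriv η) s = deriv η x - deriv η 0 := fun x =>
    intervalIntegral.integral_eq_sub_of_hasDerivAt (fun t _ => hη.derivative.hasDerivAt t)
      (hη2.intervalIntegrable _ _)
  have prim0 : ∀ x, ∫ s in (0 : ℝ)..x, deriv η s = η x - η 0 := fun x =>
    intervalIntegral.integral_eq_sub_of_hasDerivAt (fun t _ => hη.hasDerivAt t)
      (hη1.intervalIntegrable _ _)
  -- Two integrations by parts, with `u` the primitive of `v` and `v` the primitive of `w`; the zero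
  -- data of `u`, `v` at `0` and of `η` at `b` remove the boundary terms.
  have a1 := integral_primitive_mul_add hb (h.intervalIntegrable_snd hb)
    (hη2.intervalIntegrable 0 b)
  have a2 := integral_primitive_mul_add hb hwi (hη1.intervalIntegrable 0 b)
  simp only [prim1, prim0, hηb, hηb'] at a1 a2
  have c1 : ∫ x in (0 : ℝ)..b, deriv (deriv η) x * ∫ s in (0 : ℝ)..x, v s =
      ∫ x in (0 : ℝ)..b, deriv (deriv η) x * u x := by
    refine intervalIntegral.integral_congr fun x hx => ?_
    rw [h.fst_eq (hsub hx), h0, zero_add]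
  have c2 : ∫ x in (0 : ℝ)..b, deriv η x * ∫ s in (0 : ℝ)..x, w s =
      ∫ x in (0 : ℝ)..b, deriv η x * v x := by
    refine intervalIntegral.integral_congr fun x hx => ?_
    rw [h.integral x (hsub hx), h1, zero_add]
  have c3 : ∫ x in (0 : ℝ)..b, (deriv η x - deriv η 0) * v x =
      (∫ x in (0 : ℝ)..b, deriv η x * v x) - deriv η 0 * ∫ x in (0 : ℝ)..b, v x := by
    simp only [sub_mul]
    have i1 : IntervalIntegrable (fun x => deriv η x * v x) volume 0 b :=
      (hη1.continuousOn.mul hv).intervalIntegrable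
    have i2 : IntervalIntegrable (fun x => deriv η 0 * v x) volume 0 b :=
      (continuousOn_const.mul hv).intervalIntegrable
    rw [intervalIntegral.integral_sub i1 i2, intervalIntegral.integral_const_mul]
  have c4 : ∫ x in (0 : ℝ)..b, (η x - η 0) * w x =
      (∫ x in (0 : ℝ)..b, η x * w x) - η 0 * ∫ x in (0 : ℝ)..b, w x := by
    simp only [sub_mul]
    rw [intervalIntegral.integral_sub (hwi.continuousOn_mul hη0.continuousOn)
      (hwi.const_mul _), intervalIntegral.integral_const_mul]
  rw [c1, c3] at a1
  rw [c2, c4] at a2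
  have key : ∫ x in (0 : ℝ)..b, deriv (deriv η) x * u x = ∫ x in (0 : ℝ)..b, η x * w x := by
    linear_combination a1 - a2
  have d1 : ∫ x in (0 : ℝ)..b, slExpr q η x * u x =
      ∫ x in (0 : ℝ)..b, ((η x * w x + η x * z x) - deriv (deriv η) x * u x) := by
    refine intervalIntegral.integral_congr fun x hx => ?_
    simp only [slExpr, hw, abs_of_nonneg (mem_Ici.1 (hsub hx))]
    ring
  have hzi : IntervalIntegrable (fun x => η x * z x) volume 0 b :=
    hz.continuousOn_mul hη0.continuousOn
  have hwi' : IntervalIntegrable (fun x => η x * w x) volume 0 b :=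
    hwi.continuousOn_mul hη0.continuousOn
  have hui : IntervalIntegrable (fun x => deriv (deriv η) x * u x) volume 0 b :=
    (hη2.continuousOn.mul hu).intervalIntegrable
  rw [d1, intervalIntegral.integral_sub (hwi'.add hzi) hui, intervalIntegral.integral_add hwi' hzi, key]
  ring

/-- An `L₂` function is integrable on bounded intervals. -/
theorem _root_.MeasureTheory.MemLp.intervalIntegrable_of_halfLine {f : ℝ → ℂ}
    (hf : MemLp f 2 halfLine) {b : ℝ} (hb : 0 ≤ b) : IntervalIntegrable f volume 0 b := by
  rw [intervalIntegrable_iff_integrableOn_Ioc_of_le hb]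
  have h1 : MemLp f 2 (volume.restrict (Ioc 0 b)) :=
    hf.mono_measure (Measure.restrict_mono Ioc_subset_Ioi_self le_rfl)
  exact h1.integrable (by norm_num)

/-- Elements of the minimal domain have zero Cauchy data at `0`, so Green's formula leaves no
boundary term whatever the values of `η` and `η'` at `0`. Every test function therefore lies in the
domain of `L₀*`. -/
theorem inner_slExpr_toLp (hq : ContinuousOn q (Ici 0)) {η : ℝ → ℂ} (hη : IsTest η) {p : L2 × L2}
    (hp : p ∈ slGraph q) :
    inner ℂ ((hη.memLp_slExpr hq).toLp _) p.1 = inner ℂ (hη.memLp.toLp _) p.2 := by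
  obtain ⟨u, v, hu, hs, h0, h1⟩ := hp
  obtain ⟨b, hb, hηb⟩ := hη.conj.exists_bound q
  have hG := integral_slExpr_mul hη.conj hs h0 h1 hb.le (hηb b le_rfl).1 (hηb b le_rfl).2.1
    ((Lp.memLp p.2).intervalIntegrable_of_halfLine hb.le)
  rw [inner_toLp_left, inner_toLp_left]
  have e : ∫ x in Ioi (0 : ℝ), (starRingEnd ℂ) (slExpr q η x) * p.1 x =
      ∫ x in Ioi (0 : ℝ), (starRingEnd ℂ) (slExpr q η x) * u x := by
    refine integral_congr_ae ?_
    filter_upwards [hu] with x hx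
    rw [hx]
  rw [e, setIntegral_Ioi_eq_intervalIntegral hb.le, setIntegral_Ioi_eq_intervalIntegral hb.le]
  · simpa only [hη.slExpr_conj] using hG
  · refine Eventually.of_forall fun x hx => ?_
    rw [(hηb x hx.le).1, zero_mul]
  · refine Eventually.of_forall fun x hx => ?_
    rw [← hη.slExpr_conj, (hηb x hx.le).2.2, zero_mul]

theorem toLp_mem_slGraph (hq : ContinuousOn q (Ici 0)) {η : ℝ → ℂ} (hη : IsTest η)
    (h0 : η 0 = 0) (h1 : deriv η 0 = 0) :
    (hη.memLp.toLp _, (hη.memLp_slExpr hq).toLp _) ∈ slGraph q :=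
  mem_slGraph hη.memLp (hη.memLp_slExpr hq) hη.solvesSL h0 h1

/-- A function in `L₂(0,∞)` that is orthogonal to the test functions in an open set `U` vanishes
on `U`. -/
theorem ae_eq_zero_of_inner_test_eq_zero {U : Set ℝ} (hU : IsOpen U) (f : L2)
    (h : ∀ (η : ℝ → ℂ) (hη : IsTest η), tsupport η ⊆ U → inner ℂ (hη.memLp.toLp _) f = 0) :
    ∀ᵐ x ∂halfLine, x ∈ U → f x = 0 := by
  have hloc : LocallyIntegrable f halfLine := (Lp.memLp f).locallyIntegrable (by norm_num)
  refine hU.ae_eq_zero_of_integral_contDiff_smul_eq_zero (hloc.locallyIntegrableOn U)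
    fun g hg1 hg2 hg3 => ?_
  have hη : IsTest fun x => (g x : ℂ) :=
    ⟨Complex.ofRealCLM.contDiff.comp hg1, hg2.comp_left (g := ((↑) : ℝ → ℂ)) Complex.ofReal_zero⟩
  have h2 := h _ hη ?_
  · rw [inner_toLp_left] at h2
    simpa using h2
  · refine (closure_mono ?_).trans hg3
    intro x hx
    simpa using hx

theorem IsTest.eq_zero_of_tsupport_subset {η : ℝ → ℂ} (hs : tsupport η ⊆ Ioi 0) :
    η 0 = 0 ∧ deriv η 0 = 0 := by
  have h0 : (0 : ℝ) ∉ tsupport η := fun h => lt_irrefl (0 : ℝ) (hs h)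
  have h1 := notMem_tsupport_iff_eventuallyEq.1 h0
  exact ⟨h1.eq_of_nhds, by rw [h1.deriv_eq]; exact deriv_const _ _⟩

/-- The domain contains the test functions supported in `(0, ∞)`, and only `0` is orthogonal to all
of these. -/
theorem dense_domain_slOperator (hq : ContinuousOn q (Ici 0)) :
    Dense ((slOperator q).domain : Set L2) := by
  rw [Submodule.dense_iff_topologicalClosure_eq_top, Submodule.topologicalClosure_eq_top_iff,
    Submodule.eq_bot_iff]
  intro f hf
  have h1 := ae_eq_zero_of_inner_test_eq_zero isOpen_Ioi f fun η hη hs => by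
    obtain ⟨h0, h1⟩ := IsTest.eq_zero_of_tsupport_subset hs
    obtain ⟨x, hx, -⟩ := exists_domain_of_mem_slGraph (toLp_mem_slGraph hq hη h0 h1)
    simp only at hx
    rw [← hx]
    exact hf x x.2
  refine Lp.ext ?_
  filter_upwards [h1, ae_restrict_mem measurableSet_Ioi, Lp.coeFn_zero ℂ 2 halfLine]
    with x h2 h3 h4
  rw [h2 h3, h4, Pi.zero_apply]

end HalfLine

/-! ### The Friedrichs domain contains test functions with Dirichlet condition -/

section SLInverse

variable {q : ℝ → ℝ}

/-- The inverse of the Friedrichs extension of the minimal Sturm-Liouville operator. -/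
abbrev slInverse (q : ℝ → ℝ) : L2 →L[ℂ] L2 := friedrichsInverse (slOperator q)

theorem mem_friedrichsGraph_iff (hq : ContinuousOn q (Ici 0))
    (hpos : IsPositiveDefinite (slOperator q)) (y f : L2) :
    (y, f) ∈ friedrichsGraph (slOperator q) ↔ y = slInverse q f :=
  (friedrichsInverse_spec (dense_domain_slOperator hq) hpos).1 y f

theorem isPositive_slInverse (hq : ContinuousOn q (Ici 0))
    (hpos : IsPositiveDefinite (slOperator q)) : (slInverse q).IsPositive :=
  (friedrichsInverse_spec (dense_domain_slOperator hq) hpos).2.1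

theorem injective_slInverse (hq : ContinuousOn q (Ici 0))
    (hpos : IsPositiveDefinite (slOperator q)) : Function.Injective (slInverse q) :=
  (friedrichsInverse_spec (dense_domain_slOperator hq) hpos).2.2

theorem inner_slInverse_left (hq : ContinuousOn q (Ici 0))
    (hpos : IsPositiveDefinite (slOperator q)) (x y : L2) :
    inner ℂ (slInverse q x) y = inner ℂ x (slInverse q y) :=
  (isPositive_slInverse hq hpos).isSymmetric x y

theorem denseRange_slInverse (hq : ContinuousOn q (Ici 0))
    (hpos : IsPositiveDefinite (slOperator q)) : DenseRange (slInverse q) := by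
  have h : (slInverse q).rangeᗮ = ⊥ := by
    rw [Submodule.eq_bot_iff]
    intro x hx
    refine injective_slInverse hq hpos ?_
    rw [map_zero]
    refine ext_inner_left ℂ fun y => ?_
    rw [← inner_slInverse_left hq hpos, inner_zero_right]
    exact hx _ ⟨y, rfl⟩
  have h2 := Submodule.topologicalClosure_eq_top_iff.2 h
  have h3 := Submodule.dense_iff_topologicalClosure_eq_top.2 h2
  exact h3

/-- The Friedrichs extension contains `L₀`: a constant approximating sequence suffices, and symmetry
puts the pair in the graph of the adjoint. -/
theorem slInverse_eq_of_mem_slGraph (hq : ContinuousOn q (Ici 0))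
    (hpos : IsPositiveDefinite (slOperator q)) {p : L2 × L2} (hp : p ∈ slGraph q) :
    slInverse q p.2 = p.1 := by
  obtain ⟨x, h1, h2⟩ := exists_domain_of_mem_slGraph hp
  symm
  rw [← mem_friedrichsGraph_iff hq hpos]
  refine ⟨(mem_adjoint_graph_iff (dense_domain_slOperator hq) _ _).2 fun z => ?_,
    fun _ => x, ?_, fun ε hε => ⟨0, fun m _ n _ => ?_⟩⟩
  · rw [← h1, ← h2, hpos.symmetric]
  · simp only [h1]
    exact tendsto_const_nhds
  · simpa using hε

/-- The exponential boundary layer `e^{-nx} η(x)`. -/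
def boundaryLayer (η : ℝ → ℂ) (n : ℝ) (x : ℝ) : ℂ := (Real.exp (-(n * x)) : ℂ) * η x

theorem IsTest.boundaryLayer {η : ℝ → ℂ} (h : IsTest η) (n : ℝ) :
    IsTest (boundaryLayer η n) := by
  refine ⟨ContDiff.mul ?_ h.1, h.2.mul_left⟩
  refine Complex.ofRealCLM.contDiff.comp (Real.contDiff_exp.comp ?_)
  fun_prop

theorem hasDerivAt_boundaryLayer {η : ℝ → ℂ} (h : IsTest η) (n x : ℝ) :
    HasDerivAt (boundaryLayer η n)
      ((Real.exp (-(n * x)) : ℂ) * (deriv η x - n * η x)) x := by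
  have h1 : HasDerivAt (fun x : ℝ => Real.exp (-(n * x))) (Real.exp (-(n * x)) * -(n * 1)) x :=
    ((hasDerivAt_id x).const_mul n).neg.exp
  refine (h1.ofReal_comp.mul (h.hasDerivAt x)).congr_deriv ?_
  push_cast
  ring

theorem deriv_boundaryLayer {η : ℝ → ℂ} (h : IsTest η) (n : ℝ) :
    deriv (boundaryLayer η n) =
      fun x => boundaryLayer (deriv η) n x - n * boundaryLayer η n x := by
  ext x
  rw [(hasDerivAt_boundaryLayer h n x).deriv, boundaryLayer, boundaryLayer]
  ring

theorem slExpr_boundaryLayer {η : ℝ → ℂ} (h : IsTest η) (n x : ℝ) :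
    slExpr q (boundaryLayer η n) x = (Real.exp (-(n * x)) : ℂ) *
      (slExpr q η x + 2 * n * deriv η x - n ^ 2 * η x) := by
  have h1 := (hasDerivAt_boundaryLayer h.derivative n x).sub
    ((hasDerivAt_boundaryLayer h n x).const_mul (n : ℂ))
  rw [slExpr, deriv_boundaryLayer h]
  have h2 : deriv (fun x => WaveModel.boundaryLayer (deriv η) n x -
    n * WaveModel.boundaryLayer η n x) x = _ := h1.deriv
  rw [h2, WaveModel.boundaryLayer, slExpr]
  ring

theorem mul_exp_neg_le_one (x : ℝ) : x * Real.exp (-x) ≤ 1 := by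
  have := Real.add_one_le_exp x
  rw [Real.exp_neg, mul_inv_le_iff₀ (Real.exp_pos x)]
  linarith

/-- If `η(0) = 0`, then `e^{-nx} η` has the same Cauchy data at `0` as `η`. Since `|η(x)| ≤ C x`,
the layer has supremum `O(1/n)`, while its image under `-d²/dx² + q` is `O(n)` on a width `O(1/n)`,
hence bounded in `L₁`. The form energy of the layer is thus `O(1/n)`. -/
theorem exists_boundaryLayer_bounds (hq : ContinuousOn q (Ici 0)) {η : ℝ → ℂ} (h : IsTest η)
    (h0 : η 0 = 0) :
    ∃ C > 0, ∀ n : ℝ, 1 ≤ n → (∀ x > 0, ‖boundaryLayer η n x‖ ≤ C / n) ∧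
      (∫ x in Ioi (0 : ℝ), ‖boundaryLayer η n x‖) ≤ C ∧
      (∫ x in Ioi (0 : ℝ), ‖slExpr q (boundaryLayer η n) x‖) ≤ C := by
  obtain ⟨C₁, hC₁⟩ := h.derivative.continuous.bounded_above_of_compact_support h.derivative.2
  obtain ⟨C₂, hC₂⟩ := (h.continuous_slExpr hq).bounded_above_of_compact_support
    h.hasCompactSupport_slExpr
  set C := max C₁ C₂ with hC
  have hC0 : 0 ≤ C := (norm_nonneg _).trans ((hC₁ 0).trans (le_max_left _ _))
  have b1 : ∀ x, ‖deriv η x‖ ≤ C := fun x => (hC₁ x).trans (le_max_left _ _)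
  have b2 : ∀ x, ‖slExpr q η x‖ ≤ C := fun x => (hC₂ x).trans (le_max_right _ _)
  have b0 : ∀ x > 0, ‖η x‖ ≤ C * x := by
    intro x hx
    have := Convex.norm_image_sub_le_of_norm_deriv_le (fun y _ => (h.hasDerivAt y).differentiableAt)
      (fun y _ => b1 y) convex_univ (mem_univ 0) (mem_univ x)
    simpa [h0, abs_of_pos hx] using this
  have hint : ∀ n : ℝ, 1 ≤ n → IntegrableOn (fun x => Real.exp (-(n / 2) * x)) (Ioi 0) :=
    fun n hn => integrableOn_exp_mul_Ioi (by linarith) 0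
  have hval : ∀ n : ℝ, 1 ≤ n → ∫ x in Ioi (0 : ℝ), Real.exp (-(n / 2) * x) = 2 / n := by
    intro n hn
    rw [integral_exp_mul_Ioi (by linarith) 0]
    simp
  have hpt : ∀ n : ℝ, 1 ≤ n → ∀ x > 0, Real.exp (-(n * x)) * (n * x) ≤ 1 := fun n _ x _ => by
    rw [mul_comm]; exact mul_exp_neg_le_one _
  -- One half of the exponential absorbs a factor `n x`, the other half is integrated and gives `2 /
  -- n`.
  have hexp2 : ∀ n x : ℝ, Real.exp (-(n * x)) =
      Real.exp (-(n / 2) * x) * Real.exp (-(n / 2 * x)) := by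
    intro n x
    rw [← Real.exp_add]
    ring_nf
  have hnorm : ∀ n x, ‖boundaryLayer η n x‖ = Real.exp (-(n * x)) * ‖η x‖ := by
    intro n x
    rw [boundaryLayer, norm_mul, Complex.norm_real, Real.norm_eq_abs, Real.abs_exp]
  have hL : ∀ n : ℝ, 1 ≤ n → ∀ x > 0, ‖boundaryLayer η n x‖ ≤ C / n := by
    intro n hn x hx
    have hn0 : 0 < n := by linarith
    rw [hnorm, le_div_iff₀ hn0]
    calc Real.exp (-(n * x)) * ‖η x‖ * n ≤ Real.exp (-(n * x)) * (C * x) * n := by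
          gcongr
          exact b0 x hx
      _ = C * (Real.exp (-(n * x)) * (n * x)) := by ring
      _ ≤ C * 1 := by gcongr; exact hpt n hn x hx
      _ = C := mul_one C
  -- `10 C` is `5 C n · 2 / n` from the second-order expression, the largest of the three bounds;
  -- the `1` makes it positive when `C = 0`.
  refine ⟨10 * C + 1, by positivity, fun n hn => ?_⟩
  have hn0 : 0 < n := by linarith
  refine ⟨fun x hx => (hL n hn x hx).trans (by gcongr; linarith), ?_, ?_⟩
  · have hle : ∀ x ∈ Ioi (0 : ℝ), ‖boundaryLayer η n x‖ ≤
        2 * C * Real.exp (-(n / 2) * x) := by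
      intro x hx
      rw [hnorm, hexp2]
      have h1 := hpt (n / 2 * 2) (by linarith) (x / 2) (by simpa using hx)
      have e : n / 2 * 2 * (x / 2) = n / 2 * x := by ring
      rw [e] at h1
      calc Real.exp (-(n / 2) * x) * Real.exp (-(n / 2 * x)) * ‖η x‖
          ≤ Real.exp (-(n / 2) * x) * Real.exp (-(n / 2 * x)) * (C * x) := by
            gcongr
            exact b0 x hx
        _ ≤ Real.exp (-(n / 2) * x) * Real.exp (-(n / 2 * x)) * (C * (n * x)) := by
            gcongr
            nlinarith [mem_Ioi.1 hx]
        _ = 2 * C * Real.exp (-(n / 2) * x) * (Real.exp (-(n / 2 * x)) * (n / 2 * x)) := by ring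
        _ ≤ 2 * C * Real.exp (-(n / 2) * x) * 1 := by gcongr
        _ = _ := mul_one _
    have hi := (h.boundaryLayer n).continuous.integrable_of_hasCompactSupport (μ := halfLine)
      (h.boundaryLayer n).2
    refine (setIntegral_mono_on hi.norm ((hint n hn).const_mul _) measurableSet_Ioi hle).trans ?_
    rw [integral_const_mul, hval n hn, mul_div_assoc', div_le_iff₀ hn0]
    nlinarith
  · have hle : ∀ x ∈ Ioi (0 : ℝ), ‖slExpr q (boundaryLayer η n) x‖ ≤
        5 * C * n * Real.exp (-(n / 2) * x) := by
      intro x hx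
      rw [slExpr_boundaryLayer h, norm_mul, Complex.norm_real, Real.norm_eq_abs, Real.abs_exp]
      have h1 := hpt (n / 2 * 2) (by linarith) (x / 2) (by simpa using hx)
      have e : n / 2 * 2 * (x / 2) = n / 2 * x := by ring
      rw [e] at h1
      have h2 : Real.exp (-(n / 2 * x)) ≤ 1 := by
        rw [Real.exp_le_one_iff]
        have := mem_Ioi.1 hx
        have : 0 ≤ n / 2 * x := by positivity
        linarith
      have h3 : ‖slExpr q η x + 2 * n * deriv η x - n ^ 2 * η x‖ ≤
          C + 2 * n * C + n ^ 2 * (C * x) := by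
        refine (norm_sub_le _ _).trans (add_le_add ((norm_add_le _ _).trans
          (add_le_add (b2 x) ?_)) ?_)
        · simp only [norm_mul, Complex.norm_real, Complex.norm_ofNat, Real.norm_eq_abs,
            abs_of_pos hn0]
          gcongr
          exact b1 x
        · simp only [norm_mul, norm_pow, Complex.norm_real, Real.norm_eq_abs,
            abs_of_pos hn0]
          gcongr
          exact b0 x hx
      have hx0 := mem_Ioi.1 hx
      calc Real.exp (-(n * x)) * ‖slExpr q η x + 2 * n * deriv η x - n ^ 2 * η x‖
          ≤ Real.exp (-(n / 2) * x) * Real.exp (-(n / 2 * x)) *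
              (C + 2 * n * C + n ^ 2 * (C * x)) := by
            rw [hexp2]
            gcongr
        _ = Real.exp (-(n / 2) * x) * (C * (1 + 2 * n) * Real.exp (-(n / 2 * x)) +
              2 * C * n * (Real.exp (-(n / 2 * x)) * (n / 2 * x))) := by ring
        _ ≤ Real.exp (-(n / 2) * x) * (C * (n + 2 * n) * 1 + 2 * C * n * 1) := by gcongr
        _ = _ := by ring
    have hi := ((h.boundaryLayer n).continuous_slExpr hq).integrable_of_hasCompactSupport
      (μ := halfLine) (h.boundaryLayer n).hasCompactSupport_slExpr
    refine (setIntegral_mono_on hi.norm ((hint n hn).const_mul _) measurableSet_Ioi hle).trans ?_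
    rw [integral_const_mul, hval n hn]
    field_simp
    linarith

theorem norm_inner_toLp_le {f g : ℝ → ℂ} (hf : MemLp f 2 halfLine) (hg : MemLp g 2 halfLine)
    (hfi : Integrable f halfLine) {K C : ℝ} (hK : (∫ x in Ioi (0 : ℝ), ‖f x‖) ≤ K) (hC : 0 ≤ C)
    (hb : ∀ x > 0, ‖g x‖ ≤ C) : ‖inner ℂ (hf.toLp f) (hg.toLp g)‖ ≤ K * C := by
  rw [inner_toLp_toLp]
  refine (norm_integral_le_of_norm_le (hfi.norm.mul_const C) ?_).trans ?_
  · filter_upwards [ae_restrict_mem measurableSet_Ioi] with x hx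
    rw [norm_mul, RCLike.norm_conj]
    gcongr
    exact hb x hx
  · rw [integral_mul_const]
    gcongr

/-- Smooth compactly supported functions that vanish at `0` belong to the domain of the
Friedrichs extension. -/
theorem slInverse_slExpr (hq : ContinuousOn q (Ici 0))
    (hpos : IsPositiveDefinite (slOperator q)) {η : ℝ → ℂ} (h : IsTest η) (h0 : η 0 = 0) :
    slInverse q ((h.memLp_slExpr hq).toLp _) = h.memLp.toLp _ := by
  symm
  rw [← mem_friedrichsGraph_iff hq hpos]
  obtain ⟨C, hC, hb⟩ := exists_boundaryLayer_bounds hq h h0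
  have hr : ∀ n : ℕ, IsTest (boundaryLayer η (n + 1)) := fun n => h.boundaryLayer _
  -- Subtracting the layer cancels `η'(0)`, so that the difference lies in the domain of `L₀`.
  have hd : ∀ n : ℕ, (h.memLp.toLp _ - (hr n).memLp.toLp _,
      (h.memLp_slExpr hq).toLp _ - ((hr n).memLp_slExpr hq).toLp _) ∈ slGraph q := by
    intro n
    have ht : IsTest (η - boundaryLayer η (n + 1)) := ⟨h.1.sub (hr n).1, h.2.sub (hr n).2⟩
    have hderiv : deriv (η - boundaryLayer η (n + 1)) =
        deriv η - deriv (boundaryLayer η (n + 1)) := by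
      ext x
      exact ((h.hasDerivAt x).sub ((hr n).hasDerivAt x)).deriv
    have hexpr : slExpr q (η - boundaryLayer η (n + 1)) =
        slExpr q η - slExpr q (boundaryLayer η (n + 1)) := by
      have hderiv2 : deriv (deriv η - deriv (boundaryLayer η (n + 1))) =
          deriv (deriv η) - deriv (deriv (boundaryLayer η (n + 1))) := by
        ext x
        exact ((h.derivative.hasDerivAt x).sub ((hr n).derivative.hasDerivAt x)).deriv
      ext x
      simp only [slExpr, hderiv, hderiv2, Pi.sub_apply]
      ring
    have hm := toLp_mem_slGraph hq ht (by simp [boundaryLayer, h0]) (by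
      rw [hderiv, Pi.sub_apply, (hasDerivAt_boundaryLayer h _ 0).deriv]
      simp [h0])
    rw [← MemLp.toLp_sub, ← MemLp.toLp_sub]
    convert hm using 3
    exact hexpr.symm
  choose x hx1 hx2 using fun n => exists_domain_of_mem_slGraph (hd n)
  simp only at hx1 hx2
  have hint1 : ∀ n : ℕ, Integrable (boundaryLayer η (n + 1)) halfLine := fun n =>
    (hr n).continuous.integrable_of_hasCompactSupport (hr n).2
  have hint2 : ∀ n : ℕ, Integrable (slExpr q (boundaryLayer η (n + 1))) halfLine := fun n =>
    ((hr n).continuous_slExpr hq).integrable_of_hasCompactSupport (hr n).hasCompactSupport_slExpr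
  -- The form products of any two layers are small once the second index is large; this makes the
  -- approximating sequence Cauchy in the form norm.
  have key : ∀ m n : ℕ, ‖inner ℂ (((hr m).memLp_slExpr hq).toLp _) ((hr n).memLp.toLp _)‖ ≤
      C * (C / (n + 1)) := fun m n =>
    norm_inner_toLp_le _ _ (hint2 m) (hb _ (by simp)).2.2 (by positivity)
      (hb _ (by simp)).1
  have key2 : ∀ n : ℕ, ‖(hr n).memLp.toLp _‖ ^ 2 ≤ C * (C / (n + 1)) := by
    intro n
    have := norm_inner_toLp_le (hr n).memLp (hr n).memLp (hint1 n) (hb _ (by simp)).2.1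
      (show 0 ≤ C / ((n : ℝ) + 1) by positivity) (hb _ (by simp)).1
    rw [inner_self_eq_norm_sq_to_K] at this
    simpa using this
  have hlim : Tendsto (fun n : ℕ => C * (C / ((n : ℝ) + 1))) atTop (𝓝 0) := by
    have := (tendsto_one_div_add_atTop_nhds_zero_nat (𝕜 := ℝ)).const_mul (C * C)
    rw [mul_zero] at this
    refine this.congr fun n => by ring
  refine ⟨(mem_adjoint_graph_iff (dense_domain_slOperator hq) _ _).2 fun z =>
    inner_slExpr_toLp hq h (mem_slGraph_of_domain z), x, ?_, fun ε hε => ?_⟩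
  · simp only [hx1]
    have h1 : Tendsto (fun n => (hr n).memLp.toLp _) atTop (𝓝 0) := by
      rw [tendsto_zero_iff_norm_tendsto_zero]
      have h2 := squeeze_zero (fun n => sq_nonneg _) key2 hlim
      have h3 := h2.sqrt
      simpa [Real.sqrt_sq (norm_nonneg _)] using h3
    simpa using (tendsto_const_nhds (x := h.memLp.toLp _)).sub h1
  · have h1 := (Metric.tendsto_atTop.1 hlim) (ε / 4) (by positivity)
    obtain ⟨N, hN⟩ := h1
    refine ⟨N, fun m hm n hn => ?_⟩
    have em := (abs_lt.1 (by simpa only [Real.dist_eq, sub_zero] using hN m hm)).2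
    have en := (abs_lt.1 (by simpa only [Real.dist_eq, sub_zero] using hN n hn)).2
    have e1 : ((x m - x n : (slOperator q).domain) : L2) =
        (hr n).memLp.toLp _ - (hr m).memLp.toLp _ := by
      rw [Submodule.coe_sub, hx1, hx1]
      abel
    have e2 : slOperator q (x m - x n) =
        ((hr n).memLp_slExpr hq).toLp _ - ((hr m).memLp_slExpr hq).toLp _ := by
      rw [LinearPMap.map_sub, hx2, hx2]
      abel
    rw [e1, e2, inner_sub_left, inner_sub_right, inner_sub_right]
    have n1 := norm_sub_le
      (inner ℂ (((hr n).memLp_slExpr hq).toLp _) ((hr n).memLp.toLp _) -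
        inner ℂ (((hr n).memLp_slExpr hq).toLp _) ((hr m).memLp.toLp _))
      (inner ℂ (((hr m).memLp_slExpr hq).toLp _) ((hr n).memLp.toLp _) -
        inner ℂ (((hr m).memLp_slExpr hq).toLp _) ((hr m).memLp.toLp _))
    have n2 := norm_sub_le
      (inner ℂ (((hr n).memLp_slExpr hq).toLp _) ((hr n).memLp.toLp _))
      (inner ℂ (((hr n).memLp_slExpr hq).toLp _) ((hr m).memLp.toLp _))
    have n3 := norm_sub_le
      (inner ℂ (((hr m).memLp_slExpr hq).toLp _) ((hr n).memLp.toLp _))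
      (inner ℂ (((hr m).memLp_slExpr hq).toLp _) ((hr m).memLp.toLp _))
    linarith [key n n, key n m, key m n, key m m]

end SLInverse

/-! ### Testing the inverse against compactly supported solutions of `u'' = h` -/

section Representation

variable {q : ℝ → ℝ}

/-- A corrector, subtracted to bring a function with `u(0) = 0` into the minimal domain. -/
theorem exists_isTest_deriv_eq_one : ∃ η : ℝ → ℂ, IsTest η ∧ η 0 = 0 ∧ deriv η 0 = 1 := by
  let χ : ContDiffBump (0 : ℝ) := ⟨1, 2, one_pos, one_lt_two⟩
  have hχ : ContDiff ℝ (⊤ : ℕ∞) χ := χ.contDiff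
  have hd : HasDerivAt (fun x : ℝ => ((x * χ x : ℝ) : ℂ)) 1 0 := by
    have h1 : HasDerivAt (fun x : ℝ => x * χ x) (1 * χ 0 + 0 * deriv χ 0) 0 :=
      (hasDerivAt_id 0).mul ((hχ.differentiable (by simp) 0).hasDerivAt)
    have h2 : χ (0 : ℝ) = 1 := χ.one_of_mem_closedBall (by simp [χ])
    rw [h2] at h1
    simpa using h1.ofReal_comp
  refine ⟨fun x => ((x * χ x : ℝ) : ℂ), ⟨?_, ?_⟩, by simp, hd.deriv⟩
  · exact Complex.ofRealCLM.contDiff.comp (contDiff_id.mul hχ)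
  · exact (χ.hasCompactSupport.mul_left (f := fun x : ℝ => x)).comp_left
      (g := ((↑) : ℝ → ℂ)) Complex.ofReal_zero

theorem memLp_halfLine_of_continuousOn {f : ℝ → ℂ} {b : ℝ} (hf : ContinuousOn f (Ici 0))
    (hb : ∀ x, b < x → f x = 0) : MemLp f 2 halfLine := by
  obtain ⟨C, hC⟩ := (isCompact_Icc (a := (0 : ℝ)) (b := b)).exists_bound_of_continuousOn
    (hf.mono Icc_subset_Ici_self)
  have h1 : MemLp f 2 (halfLine.restrict (Icc 0 b)) := by
    have : IsFiniteMeasure (halfLine.restrict (Icc 0 b)) :=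
      ⟨by
        rw [Measure.restrict_apply_univ]
        exact isCompact_Icc.measure_lt_top⟩
    refine MemLp.of_bound ?_ C ((ae_restrict_iff' measurableSet_Icc).2 (Eventually.of_forall hC))
    have h2 : AEStronglyMeasurable f (volume.restrict (Icc 0 b)) :=
      (hf.mono Icc_subset_Ici_self).aestronglyMeasurable measurableSet_Icc
    exact h2.mono_measure (Measure.restrict_mono_measure Measure.restrict_le_self _)
  refine ((memLp_indicator_iff_restrict measurableSet_Icc).2 h1).ae_eq ?_
  filter_upwards [ae_restrict_mem measurableSet_Ioi] with x hx
  by_cases hxb : x ≤ b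
  · rw [indicator_of_mem (show x ∈ Icc 0 b from ⟨(mem_Ioi.1 hx).le, hxb⟩)]
  · rw [indicator_of_notMem fun h => hxb h.2, hb x (not_le.1 hxb)]

theorem SolvesSL.sub_const_mul {z z' u u' v v' : ℝ → ℂ} (h : SolvesSL q z u v)
    (h' : SolvesSL q z' u' v') (c : ℂ) :
    SolvesSL q (fun x => z x - c * z' x) (fun x => u x - c * u' x) (fun x => v x - c * v' x) := by
  have e : ∀ s, (q s : ℂ) * (u s - c * u' s) - (z s - c * z' s) =
      ((q s : ℂ) * u s - z s) - c * ((q s : ℂ) * u' s - z' s) := fun s => by ring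
  refine ⟨fun x hx => (h.deriv x hx).sub ((h'.deriv x hx).const_mul c), fun x hx => ?_,
    fun x hx => ?_⟩
  · simp only [e]
    exact (h.integrable x hx).sub ((h'.integrable x hx).const_mul c)
  · simp only [e]
    rw [intervalIntegral.integral_sub (h.integrable x hx) ((h'.integrable x hx).const_mul c),
      intervalIntegral.integral_const_mul, h.integral x hx, h'.integral x hx]
    ring

/-- The velocity of the solution of `u'' = h`, `u(0) = 0`, that comes to rest at `b`. -/
def restVelocity (h : ℝ → ℂ) (b x : ℝ) : ℂ := -(∫ s in (0 : ℝ)..b, h s) + ∫ s in (0 : ℝ)..x, h s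

/-- The solution of `u'' = h`, `u(0) = 0`, that comes to rest at `b`. -/
def restPosition (h : ℝ → ℂ) (b x : ℝ) : ℂ := ∫ s in (0 : ℝ)..x, restVelocity h b s

theorem continuous_restVelocity {h : ℝ → ℂ} (hh : Integrable h) (b : ℝ) :
    Continuous (restVelocity h b) :=
  continuous_const.add (intervalIntegral.continuous_primitive
    (fun _ _ => hh.intervalIntegrable) 0)

theorem hasDerivAt_restPosition {h : ℝ → ℂ} (hh : Integrable h) (b x : ℝ) :
    HasDerivAt (restPosition h b) (restVelocity h b x) x :=
  (continuous_restVelocity hh b).integral_hasStrictDerivAt 0 x |>.hasDerivAt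

/-- By parts, the value at `b` is `-∫ h(s) s ds` over `(0, b)`: orthogonality of `h` to the function
`s` is exactly the condition for coming to rest at position `0`. -/
theorem restPosition_self {h : ℝ → ℂ} (hh : Integrable h) {b : ℝ} (hb : 0 ≤ b)
    (hm : ∫ s in (0 : ℝ)..b, h s * s = 0) : restPosition h b b = 0 := by
  have h1 := integral_primitive_mul_add (g := fun _ => 1) hb intervalIntegrable_const
    (hh.intervalIntegrable (a := 0) (b := b))
  have h2 : Continuous fun x => ∫ s in (0 : ℝ)..x, h s :=
    intervalIntegral.continuous_primitive (fun _ _ => hh.intervalIntegrable) 0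
  simp only [mul_one, intervalIntegral.integral_const, sub_zero, Complex.real_smul, hm] at h1
  simp only [restPosition, restVelocity]
  rw [intervalIntegral.integral_add intervalIntegrable_const (h2.intervalIntegrable _ _)]
  simp only [intervalIntegral.integral_const, sub_zero, Complex.real_smul]
  linear_combination h1

theorem restVelocity_eq_zero {h : ℝ → ℂ} (hh : Integrable h) {b : ℝ}
    (hs : ∀ x, b < x → h x = 0) {x : ℝ} (hx : b ≤ x) : restVelocity h b x = 0 := by
  have h1 : ∫ s in b..x, h s = 0 := by
    rw [intervalIntegral.integral_of_le hx]
    exact setIntegral_eq_zero_of_forall_eq_zero fun s hs' => hs s hs'.1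
  have h2 := intervalIntegral.integral_add_adjacent_intervals
    (hh.intervalIntegrable (a := 0) (b := b)) (hh.intervalIntegrable (a := b) (b := x))
  rw [restVelocity, ← h2, h1]
  ring

theorem restPosition_eq_zero {h : ℝ → ℂ} (hh : Integrable h) {b : ℝ} (hb : 0 ≤ b)
    (hs : ∀ x, b < x → h x = 0) (hm : ∫ s in (0 : ℝ)..b, h s * s = 0) {x : ℝ} (hx : b ≤ x) :
    restPosition h b x = 0 := by
  have hi : ∀ a c, IntervalIntegrable (restVelocity h b) volume a c := fun a c =>
    (continuous_restVelocity hh b).intervalIntegrable _ _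
  have h1 : ∫ s in b..x, restVelocity h b s = 0 := by
    rw [intervalIntegral.integral_of_le hx]
    exact setIntegral_eq_zero_of_forall_eq_zero fun s hs' =>
      restVelocity_eq_zero hh hs hs'.1.le
  have h2 := restPosition_self hh hb hm
  rw [restPosition] at h2 ⊢
  rw [← intervalIntegral.integral_add_adjacent_intervals (hi 0 b) (hi b x), h1, h2, add_zero]

theorem solvesSL_restPosition {h : ℝ → ℂ} (hh : Integrable h) (b : ℝ) :
    SolvesSL q (fun x => (q x : ℂ) * restPosition h b x - h x) (restPosition h b)
      (restVelocity h b) := by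
  have e : (fun s => (q s : ℂ) * restPosition h b s - ((q s : ℂ) * restPosition h b s - h s)) =
      h := by
    ext s
    ring
  refine ⟨fun x _ => (hasDerivAt_restPosition hh b x).hasDerivWithinAt, fun x _ => ?_,
    fun x _ => ?_⟩
  · rw [e]
    exact hh.intervalIntegrable
  · rw [e]
    simp [restVelocity]

theorem memLp_mul_of_continuousOn (hq : ContinuousOn q (Ici 0)) {u : ℝ → ℂ} {b : ℝ}
    (hu : ContinuousOn u (Ici 0)) (hb : ∀ x, b < x → u x = 0) :
    MemLp (fun x => (q x : ℂ) * u x) 2 halfLine :=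
  memLp_halfLine_of_continuousOn (b := b)
    ((Complex.continuous_ofReal.comp_continuousOn hq).mul hu) fun x hx => by rw [hb x hx, mul_zero]

/-- The function `u` has `u(0) = 0` but possibly `u'(0) = c ≠ 0`. Subtracting `c η` with `η(0) = 0`,
`η'(0) = 1` gives an element of the minimal domain, and `c η` itself is covered by
`slInverse_slExpr`. -/
theorem slInverse_restPosition (hq : ContinuousOn q (Ici 0))
    (hpos : IsPositiveDefinite (slOperator q)) {h : ℝ → ℂ} (hh : Integrable h)
    {b : ℝ} (hz : MemLp (fun x => (q x : ℂ) * restPosition h b x - h x) 2 halfLine)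
    (hu : MemLp (restPosition h b) 2 halfLine) :
    slInverse q (hz.toLp _) = hu.toLp _ := by
  obtain ⟨η, hη, h0, h1⟩ := exists_isTest_deriv_eq_one
  set c := restVelocity h b 0 with hc
  have hS := (solvesSL_restPosition (q := q) hh b).sub_const_mul (hη.solvesSL) c
  have hu' := hu.sub (hη.memLp.const_mul c)
  have hz' := hz.sub ((hη.memLp_slExpr hq).const_mul c)
  have hg := mem_slGraph hu' hz' hS (by simp [restPosition, h0]) (by simp [h1, hc])
  have h2 := slInverse_eq_of_mem_slGraph hq hpos hg
  have h3 := slInverse_slExpr hq hpos hη h0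
  have e1 : hu'.toLp _ = hu.toLp _ - c • hη.memLp.toLp _ := rfl
  have e2 : hz'.toLp _ = hz.toLp _ - c • (hη.memLp_slExpr hq).toLp _ := rfl
  simp only at h2
  rw [e1, e2, map_sub, map_smul, h3] at h2
  exact sub_left_injective h2

theorem conj_intervalIntegral (h : ℝ → ℂ) (a b : ℝ) :
    ∫ s in a..b, (starRingEnd ℂ) (h s) = (starRingEnd ℂ) (∫ s in a..b, h s) := by
  simp only [intervalIntegral, integral_conj, map_sub]

theorem restVelocity_conj (h : ℝ → ℂ) (b x : ℝ) :
    restVelocity (fun s => (starRingEnd ℂ) (h s)) b x = (starRingEnd ℂ) (restVelocity h b x) := by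
  simp only [restVelocity, conj_intervalIntegral, map_add, map_neg]

theorem restPosition_conj (h : ℝ → ℂ) (b x : ℝ) :
    restPosition (fun s => (starRingEnd ℂ) (h s)) b x = (starRingEnd ℂ) (restPosition h b x) := by
  simp only [restPosition, restVelocity_conj, conj_intervalIntegral]

/-- `∫ u g = ∫ h G` for `u'' = h`, `G'' = g`. -/
theorem integral_restPosition_mul {h g : ℝ → ℂ} (hh : Integrable h) {b : ℝ} (hb : 0 ≤ b)
    (hm : ∫ s in (0 : ℝ)..b, h s * s = 0) (hg : IntervalIntegrable g volume 0 b) :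
    ∫ x in (0 : ℝ)..b, restPosition h b x * g x =
      ∫ x in (0 : ℝ)..b, h x * ∫ t in (0 : ℝ)..x, ∫ s in (0 : ℝ)..t, g s := by
  have hG : ContinuousOn (fun t => ∫ s in (0 : ℝ)..t, g s) (uIcc 0 b) := by
    refine intervalIntegral.continuousOn_primitive_interval ?_
    rw [uIcc_of_le hb, integrableOn_Icc_iff_integrableOn_Ioc]
    exact (intervalIntegrable_iff_integrableOn_Ioc_of_le hb).1 hg
  have hGi := hG.intervalIntegrable (μ := volume)
  have hV := (continuous_restVelocity hh b).intervalIntegrable (μ := volume) 0 b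
  have h1 := integral_primitive_mul_add hb hg hV
  have h2 := integral_primitive_mul_add hb hGi (hh.intervalIntegrable (a := 0) (b := b))
  have h3 : ∫ s in (0 : ℝ)..b, restVelocity h b s = 0 := restPosition_self hh hb hm
  have h4 : Continuous fun x => ∫ s in (0 : ℝ)..x, h s :=
    intervalIntegral.continuous_primitive (fun _ _ => hh.intervalIntegrable) 0
  have i1 : IntervalIntegrable (fun x => (∫ s in (0 : ℝ)..x, h s) * ∫ s in (0 : ℝ)..x, g s)
    volume 0 b := (h4.continuousOn.mul hG).intervalIntegrable
  have h5 : ∫ x in (0 : ℝ)..b, restVelocity h b x * ∫ s in (0 : ℝ)..x, g s =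
      -(∫ s in (0 : ℝ)..b, h s) * (∫ x in (0 : ℝ)..b, ∫ s in (0 : ℝ)..x, g s) +
      ∫ x in (0 : ℝ)..b, (∫ s in (0 : ℝ)..x, h s) * ∫ s in (0 : ℝ)..x, g s := by
    simp only [restVelocity, add_mul]
    rw [intervalIntegral.integral_add (hGi.const_mul _) i1, intervalIntegral.integral_const_mul]
  rw [h3, zero_mul, h5] at h1
  simp only [restPosition]
  linear_combination h1 - h2

/-- Symmetry of `L⁻¹` is tested on the `u` at rest beyond `b` with `u''` conjugate to `k`. Moving
both derivatives from `u` to the double primitive of `q y - f`, `y = L⁻¹ f`, leaves this identity.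
No condition is put on `u'(0)`, so `k` is constrained only by orthogonality to `x` and not to `1`;
this is how the Dirichlet condition for `y` will appear. -/
theorem integral_mul_sub_eq_zero (hq : ContinuousOn q (Ici 0))
    (hpos : IsPositiveDefinite (slOperator q)) (f : L2) {b : ℝ} (hb : 0 ≤ b) {k : ℝ → ℂ}
    (hk : MemLp k 2 halfLine) (hs : ∀ x, x ∉ Ioc 0 b → k x = 0)
    (hm : ∫ s in (0 : ℝ)..b, k s * s = 0) :
    ∫ x in (0 : ℝ)..b, k x * (slInverse q f x -
      ∫ t in (0 : ℝ)..x, ∫ s in (0 : ℝ)..t, ((q s : ℂ) * slInverse q f s - f s)) = 0 := by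
  have hki : Integrable k := by
    have h1 := (intervalIntegrable_iff_integrableOn_Ioc_of_le hb).1
      (hk.intervalIntegrable_of_halfLine hb)
    exact (integrableOn_iff_integrable_of_support_subset fun x hx => by
      by_contra h
      exact hx (hs x h)).1 h1
  -- The conjugate compensates for the inner product being conjugate-linear in its first argument.
  set h : ℝ → ℂ := fun s => (starRingEnd ℂ) (k s) with hh
  have hhi : Integrable h := Complex.conjCLE.toContinuousLinearMap.integrable_comp hki
  have hhL : MemLp h 2 halfLine := hk.star
  have hs' : ∀ x, b < x → h x = 0 := fun x hx => by
    rw [hh]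
    simp [hs x fun h => not_le.2 hx h.2]
  have hm' : ∫ s in (0 : ℝ)..b, h s * s = 0 := by
    have : ∀ s : ℝ, h s * s = (starRingEnd ℂ) (k s * s) := fun s => by simp [hh]
    simp only [this, conj_intervalIntegral, hm, map_zero]
  have hc : Continuous (restPosition h b) :=
    continuous_iff_continuousAt.2 fun x => (hasDerivAt_restPosition hhi b x).continuousAt
  have hz0 : ∀ x, b < x → restPosition h b x = 0 := fun x hx =>
    restPosition_eq_zero hhi hb hs' hm' hx.le
  have hu : MemLp (restPosition h b) 2 halfLine :=
    memLp_halfLine_of_continuousOn hc.continuousOn hz0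
  have hz : MemLp (fun x => (q x : ℂ) * restPosition h b x - h x) 2 halfLine :=
    (memLp_mul_of_continuousOn hq hc.continuousOn hz0).sub hhL
  have h1 := slInverse_restPosition hq hpos hhi hz hu
  have h2 := inner_slInverse_left hq hpos (hz.toLp _) f
  rw [h1, inner_toLp_left, inner_toLp_left,
    setIntegral_Ioi_eq_intervalIntegral hb (Eventually.of_forall fun x hx => by simp [hz0 x hx]),
    setIntegral_Ioi_eq_intervalIntegral hb
      (Eventually.of_forall fun x hx => by simp [hz0 x hx, hs' x hx])] at h2
  set y := slInverse q f
  set g : ℝ → ℂ := fun s => (q s : ℂ) * y s - f s with hg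
  have hqi : ContinuousOn (fun x => (q x : ℂ)) (uIcc 0 b) := by
    rw [uIcc_of_le hb]
    exact Complex.continuous_ofReal.comp_continuousOn (hq.mono Icc_subset_Ici_self)
  have hyi : IntervalIntegrable y volume 0 b := (Lp.memLp y).intervalIntegrable_of_halfLine hb
  have hfi : IntervalIntegrable f volume 0 b := (Lp.memLp f).intervalIntegrable_of_halfLine hb
  have hgi : IntervalIntegrable g volume 0 b := (hyi.continuousOn_mul hqi).sub hfi
  have hck : Continuous (restPosition k b) :=
    continuous_iff_continuousAt.2 fun x => (hasDerivAt_restPosition hki b x).continuousAt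
  have h3 := integral_restPosition_mul hki hb hm hgi
  have hpos_eq : ∀ x, (starRingEnd ℂ) (restPosition h b x) = restPosition k b x := fun x => by
    rw [hh, restPosition_conj, RCLike.conj_conj]
  have hh_eq : ∀ x, (starRingEnd ℂ) (h x) = k x := fun x => by
    rw [hh]
    exact RCLike.conj_conj _
  simp only [map_sub, map_mul, hpos_eq, hh_eq, Complex.conj_ofReal] at h2
  have hG : ContinuousOn (fun t => ∫ s in (0 : ℝ)..t, g s) (uIcc 0 b) := by
    refine intervalIntegral.continuousOn_primitive_interval ?_
    rw [uIcc_of_le hb, integrableOn_Icc_iff_integrableOn_Ioc]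
    exact (intervalIntegrable_iff_integrableOn_Ioc_of_le hb).1 hgi
  have hGG : ContinuousOn (fun x => ∫ t in (0 : ℝ)..x, ∫ s in (0 : ℝ)..t, g s) (uIcc 0 b) := by
    refine intervalIntegral.continuousOn_primitive_interval ?_
    rw [uIcc_of_le hb] at hG ⊢
    exact hG.integrableOn_Icc
  have hky : IntervalIntegrable (fun x => k x * y x) volume 0 b := by
    rw [intervalIntegrable_iff_integrableOn_Ioc_of_le hb]
    have : Integrable (fun x => k x * y x) halfLine := hk.integrable_mul (Lp.memLp y)
    exact this.mono_measure (Measure.restrict_mono Ioc_subset_Ioi_self le_rfl)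
  have hkG := (hki.intervalIntegrable (a := 0) (b := b)).mul_continuousOn hGG
  have i1 : IntervalIntegrable (fun x => restPosition k b x * f x) volume 0 b :=
    hfi.continuousOn_mul hck.continuousOn
  have i2 : IntervalIntegrable (fun x => restPosition k b x * ((q x : ℂ) * y x)) volume 0 b :=
    (hyi.continuousOn_mul hqi).continuousOn_mul hck.continuousOn
  have h4 : ∫ x in (0 : ℝ)..b, ((q x : ℂ) * restPosition k b x - k x) * y x =
      (∫ x in (0 : ℝ)..b, restPosition k b x * ((q x : ℂ) * y x)) -
        ∫ x in (0 : ℝ)..b, k x * y x := by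
    rw [← intervalIntegral.integral_sub i2 hky]
    refine intervalIntegral.integral_congr fun x _ => ?_
    ring
  have h5 : ∫ x in (0 : ℝ)..b, restPosition k b x * g x =
      (∫ x in (0 : ℝ)..b, restPosition k b x * ((q x : ℂ) * y x)) -
        ∫ x in (0 : ℝ)..b, restPosition k b x * f x := by
    rw [← intervalIntegral.integral_sub i2 i1]
    refine intervalIntegral.integral_congr fun x _ => ?_
    simp only [hg]
    ring
  simp only [mul_sub]
  rw [intervalIntegral.integral_sub hky hkG]
  linear_combination h4 + h3 - h5 + h2

end Representation

/-! ### Regularity and Dirichlet condition for the range of `L⁻¹` -/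

section Representation

variable {q : ℝ → ℝ}

/-- A function on `(0, b)` that is orthogonal to all functions orthogonal to `x` is a multiple
of `x`. -/
theorem exists_eq_mul_of_orthogonal {Y : ℝ → ℂ} {b : ℝ} (hb : 0 < b)
    (hY : MemLp Y 2 (volume.restrict (Ioc 0 b)))
    (h : ∀ k : ℝ → ℂ, MemLp k 2 halfLine → (∀ x, x ∉ Ioc 0 b → k x = 0) →
      ∫ s in (0 : ℝ)..b, k s * s = 0 → ∫ x in (0 : ℝ)..b, k x * Y x = 0) :
    ∃ β : ℂ, ∀ᵐ x ∂(volume.restrict (Ioc 0 b)), Y x = β * x := by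
  -- The coefficient of the orthogonal projection of `Y` onto `x`; `b³ / 3` is the integral of `x²`.
  set β : ℂ := (∫ x in (0 : ℝ)..b, Y x * x) / (b ^ 3 / 3 : ℝ) with hβ
  have hX : MemLp (fun x : ℝ => (x : ℂ)) 2 (volume.restrict (Ioc 0 b)) := by
    refine MemLp.of_bound (Complex.continuous_ofReal.aestronglyMeasurable) b ?_
    filter_upwards [ae_restrict_mem measurableSet_Ioc] with x hx
    rw [Complex.norm_real, Real.norm_eq_abs, abs_of_pos hx.1]
    exact hx.2
  have hD : MemLp (fun x => (starRingEnd ℂ) (Y x - β * x)) 2 (volume.restrict (Ioc 0 b)) :=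
    (hY.sub (hX.const_mul β)).star
  -- The conjugated residual is itself an admissible `k`, and testing with it gives the squared norm
  -- of the residual.
  set k : ℝ → ℂ := (Ioc 0 b).indicator fun x => (starRingEnd ℂ) (Y x - β * x) with hk
  have hkL : MemLp k 2 halfLine := by
    rw [hk, memLp_indicator_iff_restrict measurableSet_Ioc, Measure.restrict_restrict
      measurableSet_Ioc, inter_eq_left.2 Ioc_subset_Ioi_self]
    exact hD
  have hkeq : ∀ x ∈ Ioc 0 b, k x = (starRingEnd ℂ) (Y x - β * x) := fun x hx =>
    indicator_of_mem hx _
  have iYX : Integrable (fun x => Y x * x) (volume.restrict (Ioc 0 b)) := hY.integrable_mul hX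
  have iXX : Integrable (fun x : ℝ => (x : ℂ) * x) (volume.restrict (Ioc 0 b)) :=
    hX.integrable_mul hX
  have hXX : ∫ x in Ioc 0 b, (x : ℂ) * x = (b ^ 3 / 3 : ℝ) := by
    have : ∀ x : ℝ, (x : ℂ) * x = ((x ^ 2 : ℝ) : ℂ) := fun x => by push_cast; ring
    simp only [this]
    rw [integral_complex_ofReal, ← intervalIntegral.integral_of_le hb.le, integral_pow]
    norm_num
  have hb3 : ((b ^ 3 / 3 : ℝ) : ℂ) ≠ 0 := by
    have : b ^ 3 / 3 ≠ 0 := by positivity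
    exact_mod_cast this
  have horth : ∫ x in Ioc 0 b, (Y x - β * x) * x = 0 := by
    have e : ∀ x : ℝ, (Y x - β * x) * x = Y x * x - β * ((x : ℂ) * x) := fun x => by ring
    simp only [e]
    rw [integral_sub iYX (iXX.const_mul β), integral_const_mul, hXX, hβ,
      intervalIntegral.integral_of_le hb.le, div_mul_cancel₀ _ hb3, sub_self]
  have hmom : ∫ s in (0 : ℝ)..b, k s * s = 0 := by
    rw [intervalIntegral.integral_of_le hb.le]
    have e : ∫ s in Ioc 0 b, k s * s =
        ∫ s in Ioc 0 b, (starRingEnd ℂ) ((Y s - β * s) * s) := by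
      refine setIntegral_congr_fun measurableSet_Ioc fun s hs => ?_
      simp only [hkeq s hs, map_mul, Complex.conj_ofReal]
    rw [e, integral_conj, horth, map_zero]
  have h1 := h k hkL (fun x hx => indicator_of_notMem hx _) hmom
  rw [intervalIntegral.integral_of_le hb.le] at h1 hmom
  have ikY : Integrable (fun x => k x * Y x) (volume.restrict (Ioc 0 b)) :=
    (hkL.mono_measure (Measure.restrict_mono Ioc_subset_Ioi_self le_rfl)).integrable_mul hY
  have ikX : Integrable (fun x : ℝ => k x * x) (volume.restrict (Ioc 0 b)) :=
    (hkL.mono_measure (Measure.restrict_mono Ioc_subset_Ioi_self le_rfl)).integrable_mul hX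
  have h2 : ∫ x in Ioc 0 b, k x * (Y x - β * x) = 0 := by
    have e : ∀ x : ℝ, k x * (Y x - β * x) = k x * Y x - β * (k x * x) := fun x => by ring
    simp only [e]
    rw [integral_sub ikY (ikX.const_mul β), integral_const_mul, h1, hmom, mul_zero, sub_zero]
  have h3 : ∫ x in Ioc 0 b, ‖Y x - β * x‖ ^ 2 = 0 := by
    have e : ∫ x in Ioc 0 b, k x * (Y x - β * x) =
        ∫ x in Ioc 0 b, ((‖Y x - β * x‖ ^ 2 : ℝ) : ℂ) := by
      refine setIntegral_congr_fun measurableSet_Ioc fun s hs => ?_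
      simp only [hkeq s hs]
      rw [mul_comm, Complex.mul_conj, Complex.normSq_eq_norm_sq]
    rw [e, integral_complex_ofReal] at h2
    exact_mod_cast h2
  refine ⟨β, ?_⟩
  have hi : Integrable (fun x => ‖Y x - β * x‖ ^ 2) (volume.restrict (Ioc 0 b)) :=
    (hY.sub (hX.const_mul β)).integrable_norm_pow two_ne_zero
  have h4 := (integral_eq_zero_iff_of_nonneg (fun x => by positivity) hi).1 h3
  filter_upwards [h4] with x hx
  have : ‖Y x - β * x‖ = 0 := by simpa using hx
  exact sub_eq_zero.1 (norm_eq_zero.1 this)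

theorem ae_halfLine_of_forall_nat {p : ℝ → Prop}
    (h : ∀ n : ℕ, ∀ᵐ x ∂(volume.restrict (Ioc (0 : ℝ) (n + 1))), p x) :
    ∀ᵐ x ∂halfLine, p x := by
  have h1 : ∀ n : ℕ, ∀ᵐ x : ℝ, x ∈ Ioc (0 : ℝ) (n + 1) → p x := fun n =>
    (ae_restrict_iff' measurableSet_Ioc).1 (h n)
  refine (ae_restrict_iff' measurableSet_Ioi).2 ?_
  filter_upwards [ae_all_iff.2 h1] with x hx hx0
  obtain ⟨n, hn⟩ := exists_nat_gt x
  exact hx n ⟨hx0, by linarith⟩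

/-- The range of `L⁻¹` consists of `H²_loc` functions with Dirichlet condition at `0`. -/
theorem exists_solvesSL_slInverse (hq : ContinuousOn q (Ici 0))
    (hpos : IsPositiveDefinite (slOperator q)) (f : L2) :
    ∃ u v : ℝ → ℂ, slInverse q f =ᵐ[halfLine] u ∧ SolvesSL q f u v ∧ u 0 = 0 := by
  set y := slInverse q f with hy
  set g : ℝ → ℂ := fun s => (q s : ℂ) * y s - f s with hg
  set G : ℝ → ℂ := fun x => ∫ t in (0 : ℝ)..x, ∫ s in (0 : ℝ)..t, g s with hGdef
  have hgi : ∀ b ≥ 0, IntervalIntegrable g volume 0 b := by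
    intro b hb
    have hqi : ContinuousOn (fun x => (q x : ℂ)) (uIcc 0 b) := by
      rw [uIcc_of_le hb]
      exact Complex.continuous_ofReal.comp_continuousOn (hq.mono Icc_subset_Ici_self)
    exact (((Lp.memLp y).intervalIntegrable_of_halfLine hb).continuousOn_mul hqi).sub
      ((Lp.memLp f).intervalIntegrable_of_halfLine hb)
  have hG1 : ContinuousOn (fun t => ∫ s in (0 : ℝ)..t, g s) (Ici 0) :=
    continuousOn_primitive_of_integrable hgi
  have hG1i : ∀ b ≥ 0, IntervalIntegrable (fun t => ∫ s in (0 : ℝ)..t, g s) volume 0 b :=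
    fun b hb => (hG1.mono (by rw [uIcc_of_le hb]; exact Icc_subset_Ici_self)).intervalIntegrable
  have hG : ContinuousOn G (Ici 0) := continuousOn_primitive_of_integrable hG1i
  have hloc : ∀ n : ℕ, ∃ β : ℂ, ∀ᵐ x ∂(volume.restrict (Ioc (0 : ℝ) (n + 1))),
      y x - G x = β * x := by
    intro n
    have hn : (0 : ℝ) < n + 1 := by positivity
    refine exists_eq_mul_of_orthogonal (Y := fun x => y x - G x) hn (MemLp.sub ?_ ?_)
      fun k hk hs hm => ?_
    · exact (Lp.memLp y).mono_measure (Measure.restrict_mono Ioc_subset_Ioi_self le_rfl)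
    · obtain ⟨C, hC⟩ := (isCompact_Icc (a := (0 : ℝ)) (b := n + 1)).exists_bound_of_continuousOn
        (hG.mono Icc_subset_Ici_self)
      refine MemLp.of_bound ((hG.mono ?_).aestronglyMeasurable measurableSet_Ioc) C
        ((ae_restrict_iff' measurableSet_Ioc).2
          (Eventually.of_forall fun x hx => hC x (Ioc_subset_Icc_self hx)))
      exact Ioc_subset_Icc_self.trans Icc_subset_Ici_self
    · exact integral_mul_sub_eq_zero hq hpos f hn.le hk hs hm
  choose β hβ using hloc
  -- All the intervals `(0, n + 1]` contain `(0, 1]`, where the slopes can be compared.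
  have hβ0 : ∀ n, β n = β 0 := by
    intro n
    have h1 : ∀ᵐ x ∂(volume.restrict (Ioc (0 : ℝ) 1)), y x - G x = β n * x :=
      ae_mono (Measure.restrict_mono (Ioc_subset_Ioc_right (by simp)) le_rfl) (hβ n)
    have h2 : ∀ᵐ x ∂(volume.restrict (Ioc (0 : ℝ) 1)), y x - G x = β 0 * x := by
      simpa using hβ 0
    have hne : NeBot (ae (volume.restrict (Ioc (0 : ℝ) 1))) := by
      rw [ae_neBot]
      intro h0
      have := congrArg (fun μ : Measure ℝ => μ univ) h0
      simp at this
    obtain ⟨x, hx1, hx2, hx⟩ :=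
      (h1.and (h2.and (ae_restrict_mem measurableSet_Ioc))).exists
    have hx0 : (x : ℂ) ≠ 0 := by exact_mod_cast hx.1.ne'
    exact mul_right_cancel₀ hx0 (hx1.symm.trans hx2)
  have hae : ∀ᵐ x ∂halfLine, y x = β 0 * x + G x := by
    refine ae_halfLine_of_forall_nat fun n => ?_
    filter_upwards [hβ n] with x hx
    rw [← hβ0 n, ← hx]
    ring
  have hcongr : ∀ x : ℝ, 0 ≤ x → ∀ᵐ s, s ∈ uIoc (0 : ℝ) x →
      g s = (q s : ℂ) * (β 0 * s + G s) - f s := by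
    intro x hx
    filter_upwards [(ae_restrict_iff' measurableSet_Ioi).1 hae] with s hs hsx
    rw [uIoc_of_le hx] at hsx
    rw [← hs hsx.1]
  -- There is no constant term and `G(0) = 0`, hence the Dirichlet condition.
  refine ⟨fun x => β 0 * x + G x, fun x => β 0 + ∫ s in (0 : ℝ)..x, g s, hae,
    ⟨fun x hx => ?_, fun x hx => ?_, fun x hx => ?_⟩, by simp [hGdef]⟩
  · have h1 : HasDerivAt (fun x : ℝ => β 0 * (x : ℂ)) (β 0) x := by
      simpa using (hasDerivAt_id x).ofReal_comp.const_mul (β 0)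
    have h2 : HasDerivWithinAt G (∫ s in (0 : ℝ)..x, g s) (Ici 0) x := by
      rcases eq_or_lt_of_le hx with h0 | h0
      · subst h0
        refine intervalIntegral.integral_hasDerivWithinAt_right (by simp) ?_
          ((hG1 0 self_mem_Ici).mono Ioi_subset_Ici_self)
        exact hG1.stronglyMeasurableAtFilter_nhdsWithin measurableSet_Ici 0 |>.filter_mono
          (nhdsWithin_mono _ Ioi_subset_Ici_self)
      · refine HasDerivAt.hasDerivWithinAt ?_
        exact intervalIntegral.integral_hasDerivAt_right (hG1i x hx)
          ((hG1.mono Ioi_subset_Ici_self).stronglyMeasurableAtFilter isOpen_Ioi _ h0)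
          (hG1.continuousAt (Ici_mem_nhds h0))
    exact h1.hasDerivWithinAt.add h2
  · exact (hgi x hx).congr_ae ((ae_restrict_iff' measurableSet_uIoc).2 (hcongr x hx))
  · rw [← intervalIntegral.integral_congr_ae (hcongr x hx)]
    simp

end Representation

/-! ### Vectors representing point values and derivatives of `L⁻¹ f` -/

section Evaluation

variable {q : ℝ → ℝ}

theorem SolvesSL.snd_zero_unique {z z' u v u' v' : ℝ → ℂ} (h : SolvesSL q z u v)
    (h' : SolvesSL q z' u' v') (he : u =ᵐ[halfLine] u') : v 0 = v' 0 := by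
  have h1 : EqOn u u' (Ioi 0) := Measure.eqOn_open_of_ae_eq he isOpen_Ioi
    (h.continuousOn_fst.mono Ioi_subset_Ici_self) (h'.continuousOn_fst.mono Ioi_subset_Ici_self)
  have h2 : EqOn u u' (Ici 0) := by
    have h3 := EqOn.of_subset_closure h1 h.continuousOn_fst h'.continuousOn_fst
      Ioi_subset_Ici_self (by rw [closure_Ioi])
    exact h3
  have h3 := (h.deriv 0 le_rfl).congr (fun x hx => (h2 hx).symm) (h2 self_mem_Ici).symm
  exact (uniqueDiffWithinAt_Ici (0 : ℝ)).eq_deriv _ h3 (h'.deriv 0 le_rfl)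

/-- Weak limits of bounded functionals on a Hilbert space are given by vectors. -/
theorem exists_inner_eq_of_tendsto {H : Type*} [NormedAddCommGroup H] [InnerProductSpace ℂ H]
    [CompleteSpace H] {g : ℕ → H} {φ : H → ℂ}
    (h : ∀ f, Tendsto (fun n => inner ℂ (g n) f) atTop (𝓝 (φ f))) :
    ∃ δ : H, ∀ f, inner ℂ δ f = φ f := by
  let T := continuousLinearMapOfTendsto (fun n => innerSL ℂ (g n)) (tendsto_pi_nhds.2 h)
  exact ⟨(InnerProductSpace.toDual ℂ H).symm T, fun f => InnerProductSpace.toDual_symm_apply⟩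

theorem HasDerivWithinAt.tendsto_slope_one_div {f : ℝ → ℂ} {f' : ℂ} {a : ℝ}
    (h : HasDerivWithinAt f f' (Ici a) a) :
    Tendsto (fun n : ℕ => ((n : ℂ) + 1) * (f (a + 1 / ((n : ℝ) + 1)) - f a)) atTop (𝓝 f') := by
  have h1 := (hasDerivWithinAt_iff_tendsto_slope' (lt_irrefl a)).1
    (h.mono Ioi_subset_Ici_self)
  have h2 : Tendsto (fun n : ℕ => a + 1 / ((n : ℝ) + 1)) atTop (𝓝[Ioi a] a) := by
    refine tendsto_nhdsWithin_iff.2 ⟨?_, Eventually.of_forall fun n => ?_⟩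
    · simpa using tendsto_const_nhds.add (tendsto_one_div_add_atTop_nhds_zero_nat (𝕜 := ℝ))
    · have : 0 < 1 / ((n : ℝ) + 1) := by positivity
      exact lt_add_of_pos_right _ this
  refine (h1.comp h2).congr fun n => ?_
  simp only [Function.comp, slope, vsub_eq_sub, add_sub_cancel_left, one_div, inv_inv]
  rw [Complex.real_smul]
  push_cast
  ring

theorem inner_indicator_toLp {g : ℝ → ℂ} {a b : ℝ} (ha : 0 ≤ a) (hab : a ≤ b)
    (hg : MemLp ((Ioc a b).indicator g) 2 halfLine) (f : L2) :
    inner ℂ (hg.toLp _) f = ∫ x in a..b, (starRingEnd ℂ) (g x) * f x := by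
  rw [inner_toLp_left, intervalIntegral.integral_of_le hab]
  have h1 : ∀ x, (starRingEnd ℂ) ((Ioc a b).indicator g x) * f x =
      (Ioc a b).indicator (fun x => (starRingEnd ℂ) (g x) * f x) x := by
    intro x
    by_cases hx : x ∈ Ioc a b <;> simp [hx]
  simp only [h1]
  rw [integral_indicator measurableSet_Ioc, Measure.restrict_restrict measurableSet_Ioc,
    inter_eq_left.2 (show Ioc a b ⊆ Ioi 0 from fun x hx => ha.trans_lt hx.1)]

theorem memLp_indicator_Ioc {g : ℝ → ℂ} (hg : ContinuousOn g (Ici 0)) {a b : ℝ} (ha : 0 ≤ a) :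
    MemLp ((Ioc a b).indicator g) 2 halfLine := by
  rw [memLp_indicator_iff_restrict measurableSet_Ioc, Measure.restrict_restrict measurableSet_Ioc,
    inter_eq_left.2 (show Ioc a b ⊆ Ioi 0 from fun x hx => ha.trans_lt hx.1)]
  obtain ⟨C, hC⟩ := (isCompact_Icc (a := (0 : ℝ)) (b := b)).exists_bound_of_continuousOn
    (hg.mono Icc_subset_Ici_self)
  exact MemLp.of_bound ((hg.mono fun x hx => ha.trans hx.1.le).aestronglyMeasurable
    measurableSet_Ioc) C ((ae_restrict_iff' measurableSet_Ioc).2 (Eventually.of_forall fun x hx =>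
      hC x ⟨ha.trans hx.1.le, hx.2⟩))

/-- Two truncations differ only between `|x₀|` and `|x|`, so their squared distance is at most `C²
|x - x₀|`. -/
theorem continuous_toLp_indicator {g : ℝ → ℂ} (hg : ContinuousOn g (Ici 0)) :
    Continuous fun x : ℝ => (memLp_indicator_Ioc hg (b := |x|) le_rfl).toLp _ := by
  refine continuous_iff_continuousAt.2 fun x₀ => ?_
  obtain ⟨C, hC⟩ := (isCompact_Icc (a := (0 : ℝ)) (b := |x₀| + 1)).exists_bound_of_continuousOn
    (hg.mono Icc_subset_Ici_self)
  have key : ∀ x : ℝ, |x| ≤ |x₀| + 1 →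
      ‖(memLp_indicator_Ioc hg (b := |x|) le_rfl).toLp _ -
        (memLp_indicator_Ioc hg (b := |x₀|) le_rfl).toLp _‖ ^ 2 ≤ C ^ 2 * |x - x₀| := by
    intro x hx
    rw [← MemLp.toLp_sub]
    have h1 := inner_toLp_toLp ((memLp_indicator_Ioc hg (b := |x|) le_rfl).sub
      (memLp_indicator_Ioc hg (b := |x₀|) le_rfl)) ((memLp_indicator_Ioc hg (b := |x|) le_rfl).sub
      (memLp_indicator_Ioc hg (b := |x₀|) le_rfl))
    rw [inner_self_eq_norm_sq_to_K] at h1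
    set N := ‖((memLp_indicator_Ioc hg (b := |x|) le_rfl).sub
      (memLp_indicator_Ioc hg (b := |x₀|) le_rfl)).toLp _‖ with hN
    have h2 : N ^ 2 = ‖((N : ℂ)) ^ 2‖ := by
      rw [norm_pow, Complex.norm_real, norm_norm]
    rw [h2]
    have h3 : ((N : ℂ)) ^ 2 = _ := h1
    rw [h3]
    have hfin : volume (uIoc |x₀| |x|) ≠ ⊤ := by
      rw [uIoc]
      exact measure_Ioc_lt_top.ne
    have hint : Integrable ((uIoc |x₀| |x|).indicator fun _ => C ^ 2) halfLine :=
      (integrable_indicator_iff measurableSet_uIoc).2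
        (integrableOn_const (ne_top_of_le_ne_top hfin (Measure.restrict_apply_le _ _)))
    refine (norm_integral_le_of_norm_le hint ?_).trans ?_
    · filter_upwards [ae_restrict_mem measurableSet_Ioi] with s hs
      rw [norm_mul, RCLike.norm_conj, ← sq, Pi.sub_apply]
      have hs0 : 0 < s := hs
      by_cases hsm : s ∈ uIoc |x₀| |x|
      · rw [indicator_of_mem hsm]
        have hsb : s ∈ Icc 0 (|x₀| + 1) := by
          rw [mem_uIoc] at hsm
          refine ⟨hs0.le, ?_⟩
          rcases hsm with h | h <;> linarith [h.2]
        gcongr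
        by_cases h1 : s ≤ |x| <;> by_cases h2 : s ≤ |x₀|
        · simp [indicator, h1, h2, (norm_nonneg _).trans (hC s hsb)]
        · simpa [indicator, h1, h2, hs0] using hC s hsb
        · simpa [indicator, h1, h2, hs0] using hC s hsb
        · simp [indicator, h1, h2, (norm_nonneg _).trans (hC s hsb)]
      · rw [indicator_of_notMem hsm]
        rw [mem_uIoc] at hsm
        push Not at hsm
        by_cases h1 : s ≤ |x| <;> by_cases h2 : s ≤ |x₀|
        · simp [indicator, h1, h2]
        · exact absurd (hsm.1 (not_le.1 h2)) (not_lt.2 h1)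
        · exact absurd (hsm.2 (not_le.1 h1)) (not_lt.2 h2)
        · simp [indicator, h1, h2]
    · rw [integral_indicator measurableSet_uIoc, Measure.restrict_restrict measurableSet_uIoc,
        setIntegral_const, smul_eq_mul, mul_comm]
      gcongr
      have h4 : volume.real (uIoc |x₀| |x|) = |(|x| - |x₀|)| := by
        rw [uIoc, Real.volume_real_Ioc_of_le (by simp), max_sub_min_eq_abs]
      refine (measureReal_mono inter_subset_left hfin).trans ?_
      rw [h4]
      exact abs_abs_sub_abs_le_abs_sub x x₀
  rw [ContinuousAt, tendsto_iff_norm_sub_tendsto_zero]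
  have hlim : Tendsto (fun x => √(C ^ 2 * |x - x₀|)) (𝓝 x₀) (𝓝 0) := by
    have : Continuous fun x => √(C ^ 2 * |x - x₀|) := by fun_prop
    simpa using this.tendsto x₀
  refine squeeze_zero' (Eventually.of_forall fun _ => norm_nonneg _) ?_ hlim
  filter_upwards [(continuous_abs.tendsto x₀).eventually (Iic_mem_nhds (lt_add_one |x₀|))]
    with x hx
  exact Real.le_sqrt_of_sq_le (key x hx)

/-- The vector representing the functional `f ↦ (L⁻¹ f)'(0)`. -/
theorem exists_inner_eq_deriv_zero (hq : ContinuousOn q (Ici 0))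
    (hpos : IsPositiveDefinite (slOperator q)) :
    ∃ δ : L2, ∀ (f : L2) (u v : ℝ → ℂ), slInverse q f =ᵐ[halfLine] u → SolvesSL q f u v →
      inner ℂ δ f = v 0 := by
  choose u v hu hs h0 using exists_solvesSL_slInverse hq hpos
  -- Point values are limits of averages over `(x, x + 1/(n+1)]`, and below the derivative at `0` is
  -- a limit of difference quotients. Each limit of bounded functionals is again represented by a
  -- vector.
  have hev : ∀ x : ℝ, 0 ≤ x → ∃ δ : L2, ∀ f, inner ℂ δ f = u f x := by
    intro x hx
    have hm : ∀ n : ℕ, MemLp ((Ioc x (x + 1 / ((n : ℝ) + 1))).indicator fun _ => (1 : ℂ)) 2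
      halfLine := fun n => memLp_indicator_Ioc continuousOn_const hx
    refine exists_inner_eq_of_tendsto
      (g := fun n => slInverse q (((n : ℂ) + 1) • (hm n).toLp _)) fun f => ?_
    have hcont : ContinuousOn (u f) (Ici x) := (hs f).continuousOn_fst.mono (Ici_subset_Ici.2 hx)
    have hd : HasDerivWithinAt (fun b => ∫ s in x..b, u f s) (u f x) (Ici x) x := by
      refine intervalIntegral.integral_hasDerivWithinAt_right (by simp) ?_
        ((hcont x self_mem_Ici).mono Ioi_subset_Ici_self)
      exact hcont.stronglyMeasurableAtFilter_nhdsWithin measurableSet_Ici x |>.filter_mono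
        (nhdsWithin_mono _ Ioi_subset_Ici_self)
    refine (HasDerivWithinAt.tendsto_slope_one_div hd).congr fun n => ?_
    rw [inner_slInverse_left hq hpos, inner_smul_left, inner_indicator_toLp hx
      (le_add_of_nonneg_right (by positivity)), intervalIntegral.integral_same, sub_zero]
    congr 1
    · simp
    · refine intervalIntegral.integral_congr_ae ?_
      filter_upwards [(ae_restrict_iff' measurableSet_Ioi).1 (hu f)] with s hs' hsx
      rw [uIoc_of_le (le_add_of_nonneg_right (by positivity))] at hsx
      rw [hs' (hx.trans_lt hsx.1), map_one, one_mul]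
  choose! e he using hev
  obtain ⟨δ, hδ⟩ := exists_inner_eq_of_tendsto
    (g := fun n : ℕ => ((n : ℂ) + 1) • (e (0 + 1 / ((n : ℝ) + 1)) - e 0))
    (φ := fun f => v f 0) fun f => by
      refine (HasDerivWithinAt.tendsto_slope_one_div ((hs f).deriv 0 le_rfl)).congr fun n => ?_
      rw [inner_smul_left, inner_sub_left, he _ (by positivity), he 0 le_rfl]
      simp
  refine ⟨δ, fun f u' v' hu' hs' => ?_⟩
  rw [hδ]
  exact (hs f).snd_zero_unique hs' ((hu f).symm.trans hu')

/-- Pointwise evaluation of the elements of the range of `L⁻¹`, extended oddly to the line. -/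
theorem exists_evaluation (hq : ContinuousOn q (Ici 0))
    (hpos : IsPositiveDefinite (slOperator q)) :
    ∃ e d : ℝ → L2, (∀ x, HasDerivAt e (d x) x) ∧
      (∀ x, HasDerivAt (fun x => slInverse q (d x))
        ((q |x| : ℂ) • slInverse q (e x) - e x) x) ∧
      (∀ f : L2, slInverse q f =ᵐ[halfLine] fun x => inner ℂ (e x) f) ∧
      (∀ x, e (-x) = -e x) ∧ d 0 ∈ defectSpace (slOperator q) := by
  obtain ⟨δ, hδ⟩ := exists_inner_eq_deriv_zero hq hpos
  choose u v hu hs h0 using exists_solvesSL_slInverse hq hpos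
  have hqc : ContinuousOn (fun x => (q x : ℂ)) (Ici 0) :=
    Complex.continuous_ofReal.comp_continuousOn hq
  have hone : ContinuousOn (fun _ : ℝ => (1 : ℂ)) (Ici 0) := continuousOn_const
  -- This is `u'(x) = u'(0) + ∫₀ˣ (q u - f)` with `u = L⁻¹ f`, read as a functional of `f`. The
  -- absolute value makes `d` even, as the derivative of an odd extension must be.
  set d : ℝ → L2 := fun x => δ +
    slInverse q ((memLp_indicator_Ioc hqc (b := |x|) le_rfl).toLp _) -
    (memLp_indicator_Ioc hone (b := |x|) le_rfl).toLp _ with hd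
  have hdcont : Continuous d :=
    (continuous_const.add ((slInverse q).continuous.comp (continuous_toLp_indicator hqc))).sub
      (continuous_toLp_indicator hone)
  have hdv : ∀ x f, inner ℂ (d x) f = v f |x| := by
    intro x f
    have hx := abs_nonneg x
    have hqi : IntervalIntegrable (fun s => (q s : ℂ) * slInverse q f s) volume 0 |x| := by
      refine ((Lp.memLp _).intervalIntegrable_of_halfLine hx).continuousOn_mul (hqc.mono ?_)
      rw [uIcc_of_le hx]
      exact Icc_subset_Ici_self
    rw [hd, inner_sub_left, inner_add_left, hδ f _ _ (hu f) (hs f), inner_slInverse_left hq hpos,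
      inner_indicator_toLp le_rfl hx, inner_indicator_toLp le_rfl hx, (hs f).integral |x| hx]
    simp only [Complex.conj_ofReal, map_one, one_mul]
    rw [add_sub_assoc, ← intervalIntegral.integral_sub hqi
      ((Lp.memLp f).intervalIntegrable_of_halfLine hx)]
    congr 1
    refine intervalIntegral.integral_congr_ae ?_
    filter_upwards [(ae_restrict_iff' measurableSet_Ioi).1 (hu f)] with s hs' hsx
    rw [uIoc_of_le hx] at hsx
    rw [hs' hsx.1]
  set e : ℝ → L2 := fun x => ∫ s in (0 : ℝ)..x, d s with he
  have hed : ∀ x, HasDerivAt e (d x) x := fun x => (hdcont.integral_hasStrictDerivAt 0 x).hasDerivAt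
  have hecont : Continuous e := continuous_iff_continuousAt.2 fun x => (hed x).continuousAt
  have inner_int : ∀ (F : ℝ → L2), Continuous F → ∀ x f,
      inner ℂ (∫ s in (0 : ℝ)..x, F s) f = ∫ s in (0 : ℝ)..x, inner ℂ (F s) f := by
    intro F hF x f
    have h1 := (innerSL ℂ f).intervalIntegral_comp_comm (hF.intervalIntegrable (μ := volume) 0 x)
    simp only [innerSL_apply_apply] at h1
    rw [← inner_conj_symm, ← h1, ← conj_intervalIntegral]
    simp only [inner_conj_symm]
  have heu : ∀ x ≥ 0, ∀ f, inner ℂ (e x) f = u f x := by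
    intro x hx f
    rw [he, inner_int d hdcont, (hs f).fst_eq hx, h0, zero_add]
    refine intervalIntegral.integral_congr fun s hs' => ?_
    rw [uIcc_of_le hx] at hs'
    simp only [hdv, abs_of_nonneg hs'.1]
  have hdneg : ∀ x, d (-x) = d x := fun x => by simp only [hd, abs_neg]
  have heneg : ∀ x, e (-x) = -e x := by
    intro x
    have h1 := intervalIntegral.integral_comp_neg (f := d) (a := 0) (b := x)
    simp only [hdneg, neg_zero] at h1
    simp only [he]
    rw [h1, intervalIntegral.integral_symm]
  set F : ℝ → L2 := fun x => (q |x| : ℂ) • slInverse q (e x) - e x with hF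
  have hFcont : Continuous F :=
    ((Complex.continuous_ofReal.comp (continuous_comp_abs hq)).smul
      ((slInverse q).continuous.comp hecont)).sub hecont
  have hae : ∀ f : L2, slInverse q f =ᵐ[halfLine] fun x => inner ℂ (e x) f := by
    intro f
    filter_upwards [hu f, ae_restrict_mem measurableSet_Ioi] with x hx hx0
    rw [heu x (mem_Ioi.1 hx0).le, hx]
  -- `d` contains an indicator function of a variable interval, so differentiability in `L₂` is
  -- sought only after applying `L⁻¹`. The formula is checked against every `f`, where it is the
  -- differential equation for `L⁻¹ (L⁻¹ f)`.
  have hform : ∀ x ≥ 0, slInverse q (d x) = slInverse q (d 0) + ∫ s in (0 : ℝ)..x, F s := by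
    intro x hx
    refine ext_inner_right ℂ fun f => ?_
    rw [inner_add_left, inner_int F hFcont, inner_slInverse_left hq hpos,
      inner_slInverse_left hq hpos, hdv, hdv, abs_zero, abs_of_nonneg hx, (hs _).integral x hx]
    congr 1
    refine intervalIntegral.integral_congr_ae ?_
    filter_upwards [(ae_restrict_iff' measurableSet_Ioi).1 (hae f)] with s hs' hsx
    rw [uIoc_of_le hx] at hsx
    rw [hF, inner_sub_left, inner_smul_left, inner_slInverse_left hq hpos, heu s hsx.1.le,
      hs' hsx.1, Complex.conj_ofReal, abs_of_pos hsx.1]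
  have hform' : ∀ x, slInverse q (d x) = slInverse q (d 0) + ∫ s in (0 : ℝ)..x, F s := by
    intro x
    rcases le_total 0 x with hx | hx
    · exact hform x hx
    · have h1 := hform (-x) (neg_nonneg.2 hx)
      rw [hdneg] at h1
      rw [h1]
      have h2 := intervalIntegral.integral_comp_neg (f := F) (a := 0) (b := x)
      have h3 : ∀ s, F (-s) = -F s := fun s => by
        simp only [hF, abs_neg, heneg, map_neg, smul_neg]
        abel
      simp only [h3, neg_zero] at h2
      rw [intervalIntegral.integral_neg, intervalIntegral.integral_symm 0 (-x)] at h2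
      rw [← neg_inj.1 h2]
  refine ⟨e, d, hed, fun x => ?_, hae, heneg, ?_⟩
  · have h1 : (fun x => slInverse q (d x)) =
        fun x => slInverse q (d 0) + ∫ s in (0 : ℝ)..x, F s := funext hform'
    rw [h1]
    exact (hFcont.integral_hasStrictDerivAt 0 x).hasDerivAt.const_add _
  -- For `z` in the domain of `L₀` the pairing of `d 0` with `L₀ z` is the derivative at `0` of `L⁻¹
  -- L₀ z = z`, which is zero.
  · refine (mem_adjoint_graph_iff (dense_domain_slOperator hq) _ _).2 fun x => ?_
    rw [inner_zero_left, hdv, abs_zero]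
    have hx := mem_slGraph_of_domain x
    obtain ⟨u', v', hu', hs', -, hv'⟩ := id hx
    have h1 := slInverse_eq_of_mem_slGraph hq hpos hx
    simp only at h1 hu' hs'
    rw [← hδ _ _ _ (hu _) (hs _), hδ _ u' v' (h1 ▸ hu') hs', hv']

end Evaluation

/-! ### Uniqueness in a characteristic cone -/

section Cone

/-- One integration in the Picard iteration below; the exponent and the factorial advance together.
-/
theorem norm_le_pow_of_deriv_le {f : ℝ → ℂ} {f' : ℝ → ℂ} {s K : ℝ} (n : ℕ) (hs : 0 ≤ s)
    (hf : ∀ σ, HasDerivAt f (f' σ) σ) (h0 : f 0 = 0)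
    (hb : ∀ σ, 0 ≤ σ → σ ≤ s → ‖f' σ‖ ≤ K * σ ^ n / n.factorial) :
    ‖f s‖ ≤ K * s ^ (n + 1) / (n + 1).factorial := by
  refine image_norm_le_of_norm_deriv_right_le_deriv_boundary (a := 0) (b := s) (f := f) (f' := f')
    (B := fun σ => K * σ ^ (n + 1) / (n + 1).factorial) (B' := fun σ => K * σ ^ n / n.factorial)
    (fun σ _ => (hf σ).continuousAt.continuousWithinAt) (fun σ _ => (hf σ).hasDerivWithinAt)
    (by simp [h0]) (fun σ => ?_) (fun σ hσ => hb σ hσ.1 hσ.2.le) ⟨hs, le_rfl⟩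
  have h1 := ((hasDerivAt_pow (n + 1) σ).const_mul K).div_const ((n + 1).factorial : ℝ)
  refine h1.congr_deriv ?_
  have h2 : (n.factorial : ℝ) ≠ 0 := by exact_mod_cast n.factorial_ne_zero
  have h3 : (n : ℝ) + 1 ≠ 0 := by positivity
  rw [Nat.factorial_succ]
  push_cast
  field_simp

/-- Uniqueness for the Cauchy problem of the one-dimensional wave equation with a potential, in a
characteristic cone: `p = u_s + u_y` and `m = u_s - u_y` propagate along characteristics. -/
theorem eq_zero_of_cone {u p m F : ℝ → ℝ → ℂ} {S T y₀ A C : ℝ} (hA : 0 ≤ A)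
    (hu : ∀ s y, HasDerivAt (fun σ => u σ y) ((p s y + m s y) / 2) s)
    (hp : ∀ s c, HasDerivAt (fun σ => p σ (c - σ)) (F s (c - s)) s)
    (hm : ∀ s c, HasDerivAt (fun σ => m σ (c + σ)) (F s (c + s)) s)
    (hF : ∀ s y, 0 ≤ s → s ≤ S → |y - y₀| + s < T → ‖F s y‖ ≤ A * ‖u s y‖)
    (hC : ∀ s y, 0 ≤ s → s ≤ S → |y - y₀| + s < T → ‖u s y‖ ≤ C)
    (h0 : ∀ y, |y - y₀| < T → u 0 y = 0 ∧ p 0 y = 0 ∧ m 0 y = 0) {s y : ℝ} (hs : 0 ≤ s)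
    (hsS : s ≤ S) (hy : |y - y₀| + s < T) : u s y = 0 := by
  -- Each round bounds `F` by `A ‖u‖`, integrates along both characteristics to bound `p` and `m`,
  -- and integrates `(p + m)/2` to bound `u`, gaining `A s²` and two steps of the factorial.
  -- Characteristics and vertical segments followed back to `s = 0` stay in the cone.
  have key : ∀ n : ℕ, ∀ s y, 0 ≤ s → s ≤ S → |y - y₀| + s < T →
      ‖u s y‖ ≤ C * A ^ n * s ^ (2 * n) / (2 * n).factorial := by
    intro n
    induction n with
    | zero => simpa using hC
    | succ n ih =>
      intro s y hs hsS hy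
      have bF : ∀ s y, 0 ≤ s → s ≤ S → |y - y₀| + s < T →
          ‖F s y‖ ≤ C * A ^ (n + 1) * s ^ (2 * n) / (2 * n).factorial := by
        intro s y hs hsS hy
        refine (hF s y hs hsS hy).trans ?_
        refine (mul_le_mul_of_nonneg_left (ih s y hs hsS hy) hA).trans (le_of_eq ?_)
        ring
      have bp : ∀ s y, 0 ≤ s → s ≤ S → |y - y₀| + s < T →
          ‖p s y‖ ≤ C * A ^ (n + 1) * s ^ (2 * n + 1) / (2 * n + 1).factorial := by
        intro s y hs hsS hy
        have h1 := norm_le_pow_of_deriv_le (2 * n) hs (fun σ => hp σ (y + s))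
          ((h0 _ ?_).2.1) fun σ h1 h2 => bF σ _ h1 (h2.trans hsS) ?_
        · simpa using h1
        · have := abs_add_le (y - y₀) s
          rw [abs_of_nonneg hs] at this
          calc |y + s - 0 - y₀| = |y - y₀ + s| := by ring_nf
            _ ≤ _ := this
            _ < T := hy
        · have := abs_add_le (y - y₀) (s - σ)
          rw [abs_of_nonneg (sub_nonneg.2 h2)] at this
          have e : y + s - σ - y₀ = y - y₀ + (s - σ) := by ring
          rw [e]
          linarith
      have bm : ∀ s y, 0 ≤ s → s ≤ S → |y - y₀| + s < T →
          ‖m s y‖ ≤ C * A ^ (n + 1) * s ^ (2 * n + 1) / (2 * n + 1).factorial := by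
        intro s y hs hsS hy
        have h1 := norm_le_pow_of_deriv_le (2 * n) hs (fun σ => hm σ (y - s))
          ((h0 _ ?_).2.2) fun σ h1 h2 => bF σ _ h1 (h2.trans hsS) ?_
        · simpa using h1
        · have := abs_sub (y - y₀) s
          rw [abs_of_nonneg hs] at this
          calc |y - s + 0 - y₀| = |y - y₀ - s| := by ring_nf
            _ ≤ _ := this
            _ < T := hy
        · have := abs_sub (y - y₀) (s - σ)
          rw [abs_of_nonneg (sub_nonneg.2 h2)] at this
          have e : y - s + σ - y₀ = y - y₀ - (s - σ) := by ring
          rw [e]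
          linarith
      have hy' : |y - y₀| < T := by linarith
      have h1 := norm_le_pow_of_deriv_le (2 * n + 1) hs (fun σ => hu σ y) ((h0 y hy').1)
        fun σ h1 h2 => (?_ : _ ≤ C * A ^ (n + 1) * σ ^ (2 * n + 1) / (2 * n + 1).factorial)
      · exact h1
      · have e1 := bp σ y h1 (h2.trans hsS) (by linarith)
        have e2 := bm σ y h1 (h2.trans hsS) (by linarith)
        rw [norm_div, Complex.norm_ofNat]
        linarith [norm_add_le (p σ y) (m σ y)]
  -- The bound equals `C (√A s)^{2n} / (2n)!`.
  have hlim : Tendsto (fun n : ℕ => C * ((√A * s) ^ (2 * n) / (2 * n).factorial)) atTop (𝓝 0) := by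
    have h1 := (FloorSemiring.tendsto_pow_div_factorial_atTop (√A * s)).comp
      (tendsto_id.const_mul_atTop' (show 0 < 2 by norm_num))
    have h2 := h1.const_mul C
    rw [mul_zero] at h2
    exact h2
  have hle : ‖u s y‖ ≤ 0 := by
    refine ge_of_tendsto' hlim fun n => (key n s y hs hsS hy).trans (le_of_eq ?_)
    rw [mul_pow, pow_mul (√A), Real.sq_sqrt hA]
    ring
  exact norm_le_zero_iff.1 hle

end Cone

/-! ### The subspaces `L₂(E)` as a Boolean algebra -/

section SubspaceOn

theorem mem_subspaceOn {E : Set ℝ} {y : L2} :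
    y ∈ subspaceOn E ↔ ∀ᵐ x ∂halfLine, x ∉ E → y x = 0 := Iff.rfl

theorem subspaceOn_mono {E F : Set ℝ} (h : ∀ᵐ x ∂halfLine, x ∈ E → x ∈ F) :
    subspaceOn E ≤ subspaceOn F := by
  intro y hy
  filter_upwards [h, mem_subspaceOn.1 hy] with x h1 h2 hx
  exact h2 fun h => hx (h1 h)

theorem subspaceOn_congr {E F : Set ℝ} (h : ∀ᵐ x ∂halfLine, x ∈ E ↔ x ∈ F) :
    subspaceOn E = subspaceOn F :=
  le_antisymm (subspaceOn_mono (h.mono fun _ h => h.1)) (subspaceOn_mono (h.mono fun _ h => h.2))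

/-- The product of an `L₂` function and the indicator function of a measurable set. -/
def restrictTo {E : Set ℝ} (hE : MeasurableSet E) (y : L2) : L2 :=
  ((Lp.memLp y).indicator hE).toLp _

theorem coeFn_restrictTo {E : Set ℝ} (hE : MeasurableSet E) (y : L2) :
    restrictTo hE y =ᵐ[halfLine] E.indicator y :=
  MemLp.coeFn_toLp _

theorem restrictTo_mem {E : Set ℝ} (hE : MeasurableSet E) (y : L2) :
    restrictTo hE y ∈ subspaceOn E := by
  refine mem_subspaceOn.2 ?_
  filter_upwards [coeFn_restrictTo hE y] with x hx hxE
  rw [hx, indicator_of_notMem hxE]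

theorem sub_restrictTo_mem {E : Set ℝ} (hE : MeasurableSet E) (y : L2) :
    y - restrictTo hE y ∈ subspaceOn Eᶜ := by
  refine mem_subspaceOn.2 ?_
  filter_upwards [coeFn_restrictTo hE y, Lp.coeFn_sub y (restrictTo hE y)] with x hx hx2 hxE
  rw [hx2, Pi.sub_apply, hx, indicator_of_mem (notMem_compl_iff.1 hxE), sub_self]

theorem inner_eq_zero_of_mem_compl {E : Set ℝ} {f g : L2} (hf : f ∈ subspaceOn E)
    (hg : g ∈ subspaceOn Eᶜ) : inner ℂ f g = 0 := by
  rw [L2_inner_eq]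
  refine integral_eq_zero_of_ae ?_
  filter_upwards [mem_subspaceOn.1 hf, mem_subspaceOn.1 hg] with x h1 h2
  by_cases hx : x ∈ E
  · simp [h2 fun h => h hx]
  · simp [h1 hx]

theorem proj_subspaceOn {E : Set ℝ} (hE : MeasurableSet E) (y : L2) :
    proj (subspaceOn E) y = restrictTo hE y := by
  refine Submodule.eq_starProjection_of_mem_of_inner_eq_zero (restrictTo_mem hE y) fun w hw => ?_
  rw [← inner_conj_symm, inner_eq_zero_of_mem_compl hw (sub_restrictTo_mem hE y), map_zero]

theorem orthogonal_subspaceOn {E : Set ℝ} (hE : MeasurableSet E) :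
    (subspaceOn E)ᗮ = subspaceOn Eᶜ := by
  refine le_antisymm (fun y hy => ?_) fun y hy => ?_
  · have h1 : inner ℂ (restrictTo hE y) y = 0 := hy _ (restrictTo_mem hE y)
    have h2 := inner_eq_zero_of_mem_compl (restrictTo_mem hE y) (sub_restrictTo_mem hE y)
    rw [inner_sub_right, h1, zero_sub, neg_eq_zero, inner_self_eq_zero] at h2
    have h3 := sub_restrictTo_mem hE y
    rwa [h2, sub_zero] at h3
  · exact fun w hw => inner_eq_zero_of_mem_compl hw hy

theorem inf_subspaceOn (E F : Set ℝ) : subspaceOn E ⊓ subspaceOn F = subspaceOn (E ∩ F) := by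
  refine le_antisymm (fun y hy => ?_) (le_inf (subspaceOn_mono (Eventually.of_forall fun x h => h.1))
    (subspaceOn_mono (Eventually.of_forall fun x h => h.2)))
  refine mem_subspaceOn.2 ?_
  filter_upwards [mem_subspaceOn.1 hy.1, mem_subspaceOn.1 hy.2] with x h1 h2 hx
  by_cases h : x ∈ E
  · exact h2 fun h' => hx ⟨h, h'⟩
  · exact h1 h

/-- De Morgan through orthogonal complements, which avoids the closure of a sum. -/
theorem sup_subspaceOn {E F : Set ℝ} (hE : MeasurableSet E) (hF : MeasurableSet F) :
    subspaceOn E ⊔ subspaceOn F = subspaceOn (E ∪ F) := by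
  have h1 := ClosedSubmodule.sup_orthogonal (subspaceOn Eᶜ) (subspaceOn Fᶜ)
  rwa [inf_subspaceOn, orthogonal_subspaceOn hE.compl, orthogonal_subspaceOn hF.compl,
    orthogonal_subspaceOn (hE.compl.inter hF.compl), compl_inter, compl_compl, compl_compl] at h1

end SubspaceOn

/-! ### Closed subspaces, integrals and time averages -/

section ClosedSubmodule

variable {H : Type*} [NormedAddCommGroup H] [InnerProductSpace ℂ H] [CompleteSpace H]

theorem mem_of_forall_inner_orthogonal {K : ClosedSubmodule ℂ H} {x : H}
    (h : ∀ y ∈ Kᗮ, inner ℂ y x = 0) : x ∈ K := by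
  have h1 : x ∈ Kᗮᗮ := h
  rwa [ClosedSubmodule.orthogonal_orthogonal_eq] at h1

theorem intervalIntegral_mem (K : ClosedSubmodule ℂ H) {f : ℝ → H} {a b : ℝ}
    (h : ∀ s ∈ uIoc a b, f s ∈ K) : ∫ s in a..b, f s ∈ K := by
  by_cases hi : IntervalIntegrable f volume a b
  · refine mem_of_forall_inner_orthogonal fun y hy => ?_
    have h1 := (innerSL ℂ y).intervalIntegral_comp_comm hi
    simp only [innerSL_apply_apply] at h1
    rw [← h1]
    refine intervalIntegral.integral_zero_ae (Eventually.of_forall fun s hs => ?_)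
    rw [← inner_conj_symm, hy _ (h s hs), map_zero]
  -- Without integrability the integral is `0` by convention, and still lies in the subspace.
  · rw [intervalIntegral.integral_undef hi]
    exact K.zero_mem

theorem le_of_forall_orthogonal_mem {K M : ClosedSubmodule ℂ H} (h : ∀ y ∈ Mᗮ, y ∈ Kᗮ) :
    K ≤ M := by
  have h1 : Kᗮᗮ ≤ Mᗮᗮ := ClosedSubmodule.orthogonal_le h
  rwa [ClosedSubmodule.orthogonal_orthogonal_eq, ClosedSubmodule.orthogonal_orthogonal_eq] at h1

/-- If a wave stays in a closed subspace for `|s| < T`, then so do its time averages, for a shorter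
time. -/
theorem sineOperator_pow_mem {R : H →L[ℂ] H} (hR : R.IsPositive) {K : ClosedSubmodule ℂ H} {f : H}
    {T h : ℝ} (hh : 0 ≤ h) (n : ℕ) (hf : ∀ s, |s| < T → sineOperator R s f ∈ K) (s : ℝ)
    (hs : |s| < T - n * h) : sineOperator R s ((sineOperator R h ^ n) f) ∈ K := by
  induction n generalizing s with
  | zero =>
    refine hf s ?_
    simpa using hs
  | succ n ih =>
    rw [pow_succ']
    have h1 := sineOperator_sineOperator_apply hR s h ((sineOperator R h ^ n) f)
    change sineOperator R s (sineOperator R h ((sineOperator R h ^ n) f)) ∈ K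
    rw [h1]
    refine K.smul_mem ((2⁻¹ : ℝ) : ℂ) (intervalIntegral_mem K fun σ hσ => ih σ ?_)
    rw [uIoc_of_le (by linarith)] at hσ
    push_cast at hs
    have h2 : |σ| ≤ |s| + h := by
      rw [abs_le]
      constructor <;> linarith [neg_abs_le s, le_abs_self s, hσ.1, hσ.2]
    linarith

end ClosedSubmodule

/-! ### The wave field and its vanishing in cones -/

/-- Representing vectors of the functionals `f ↦ (L⁻¹ f)(x)` and `f ↦ (L⁻¹ f)'(x)`, extended to
`x < 0` by odd reflection of `L⁻¹ f`. -/
structure IsEvaluation (q : ℝ → ℝ) (e d : ℝ → L2) : Prop where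
  hasDerivAt : ∀ x, HasDerivAt e (d x) x
  hasDerivAt_slInverse : ∀ x, HasDerivAt (fun x => slInverse q (d x))
    ((q |x| : ℂ) • slInverse q (e x) - e x) x
  ae_eq : ∀ f, slInverse q f =ᵐ[halfLine] fun x => inner ℂ (e x) f
  neg : ∀ x, e (-x) = -e x

variable {q : ℝ → ℝ} {e d : ℝ → L2}

section Field

/-- The value at `(x, t)` of the wave `L^{-1/2} sin(t L^{1/2}) L⁻³ g`. -/
def waveField (q : ℝ → ℝ) (e : ℝ → L2) (g : L2) (x t : ℝ) : ℂ :=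
  inner ℂ (slInverse q (e x)) (slInverse q (sineOperator (slInverse q) t g))

/-- The time derivative of `waveField`. -/
def waveFieldTime (q : ℝ → ℝ) (e : ℝ → L2) (g : L2) (x t : ℝ) : ℂ :=
  inner ℂ (slInverse q (e x)) (cosineOperator (slInverse q) t g)

/-- The field is a product of a function of `x` and a function of `t`, so it can be differentiated
along any straight line. The affine parameters cover both axes and both characteristics. -/
theorem hasDerivAt_inner_affine {H : Type*} [NormedAddCommGroup H] [InnerProductSpace ℂ H]
    {f k : ℝ → H} {f' k' : H} {a α b β σ : ℝ} (hf : HasDerivAt f f' (a + α * σ))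
    (hk : HasDerivAt k k' (b + β * σ)) :
    HasDerivAt (fun σ => inner ℂ (f (a + α * σ)) (k (b + β * σ)))
      (α * inner ℂ f' (k (b + β * σ)) + β * inner ℂ (f (a + α * σ)) k') σ := by
  have h1 : HasDerivAt (fun σ : ℝ => a + α * σ) α σ := by
    simpa using ((hasDerivAt_id σ).const_mul α).const_add a
  have h2 : HasDerivAt (fun σ : ℝ => b + β * σ) β σ := by
    simpa using ((hasDerivAt_id σ).const_mul β).const_add b
  refine ((hf.scomp σ h1).inner ℂ (hk.scomp σ h2)).congr_deriv ?_
  rw [← Complex.coe_smul, ← Complex.coe_smul, inner_smul_left, inner_smul_right,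
    Complex.conj_ofReal]
  exact add_comm _ _

theorem hasDerivAt_slInverse_comp {f : ℝ → L2} {f' : L2} {x : ℝ} (h : HasDerivAt f f' x) :
    HasDerivAt (fun x => slInverse q (f x)) (slInverse q f') x :=
  ((slInverse q).restrictScalars ℝ).hasFDerivAt.comp_hasDerivAt _ h

theorem IsEvaluation.hasDerivAt_waveField (he : IsEvaluation q e d)
    (hR : (slInverse q).IsPositive) (g : L2) (a α b β σ : ℝ) :
    HasDerivAt (fun σ => waveField q e g (a + α * σ) (b + β * σ))
      (α * waveField q d g (a + α * σ) (b + β * σ) +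
        β * waveFieldTime q e g (a + α * σ) (b + β * σ)) σ :=
  hasDerivAt_inner_affine (hasDerivAt_slInverse_comp (he.hasDerivAt _))
    (hasDerivAt_operator_apply (hasDerivAt_mul_sineOperator hR _) g)

/-- With `ψ = (e(x), L⁻¹ S(t) g)` this reads `w_xx = q w - ψ`, and the next lemma reads `w_tt = -ψ`.
Along the characteristics `ψ` and the mixed derivatives cancel, and only `q w` remains. -/
theorem IsEvaluation.hasDerivAt_waveField_space (he : IsEvaluation q e d)
    (hR : (slInverse q).IsPositive) (g : L2) (a α b β σ : ℝ) :
    HasDerivAt (fun σ => waveField q d g (a + α * σ) (b + β * σ))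
      (α * (q |a + α * σ| * waveField q e g (a + α * σ) (b + β * σ) - inner ℂ (e (a + α * σ))
          (slInverse q (sineOperator (slInverse q) (b + β * σ) g))) +
        β * waveFieldTime q d g (a + α * σ) (b + β * σ)) σ := by
  refine (hasDerivAt_inner_affine (he.hasDerivAt_slInverse (a + α * σ))
    (hasDerivAt_operator_apply (hasDerivAt_mul_sineOperator hR _) g)).congr_deriv ?_
  rw [inner_sub_left, inner_smul_left, Complex.conj_ofReal]
  rfl

theorem IsEvaluation.hasDerivAt_waveFieldTime (he : IsEvaluation q e d)
    (hR : (slInverse q).IsPositive) (g : L2) (a α b β σ : ℝ) :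
    HasDerivAt (fun σ => waveFieldTime q e g (a + α * σ) (b + β * σ))
      (α * waveFieldTime q d g (a + α * σ) (b + β * σ) - β * inner ℂ (e (a + α * σ))
          (slInverse q (sineOperator (slInverse q) (b + β * σ) g))) σ := by
  refine (hasDerivAt_inner_affine (hasDerivAt_slInverse_comp (he.hasDerivAt (a + α * σ)))
    (hasDerivAt_operator_apply (hasDerivAt_cosineOperator hR _) g)).congr_deriv ?_
  have h4 : inner ℂ (slInverse q (e (a + α * σ))) (sineOperator (slInverse q) (b + β * σ) g) =
      inner ℂ (e (a + α * σ)) (slInverse q (sineOperator (slInverse q) (b + β * σ) g)) :=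
    hR.isSymmetric _ _
  rw [neg_apply, inner_neg_right, h4, mul_neg, ← sub_eq_add_neg]
  rfl

theorem IsEvaluation.continuous_waveField (he : IsEvaluation q e d)
    (hR : (slInverse q).IsPositive) (g : L2) :
    Continuous fun z : ℝ × ℝ => waveField q e g z.1 z.2 := by
  have h1 : Continuous e := continuous_iff_continuousAt.2 fun x => (he.hasDerivAt x).continuousAt
  exact (((slInverse q).continuous.comp (h1.comp continuous_fst))).inner
    ((slInverse q).continuous.comp ((continuous_sineOperator_apply hR g).comp continuous_snd))

theorem IsEvaluation.exists_waveField_bound (he : IsEvaluation q e d)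
    (hR : (slInverse q).IsPositive) (g : L2) (a b : ℝ) :
    ∃ C, ∀ x t, |x| ≤ a → |t| ≤ b → ‖waveField q e g x t‖ ≤ C := by
  obtain ⟨C, hC⟩ := ((isCompact_Icc (a := -a) (b := a)).prod
    (isCompact_Icc (a := -b) (b := b))).exists_bound_of_continuousOn
    (he.continuous_waveField hR g).continuousOn
  exact ⟨C, fun x t hx ht => hC (x, t) ⟨abs_le.1 hx, abs_le.1 ht⟩⟩

theorem exists_potential_bound (hq : ContinuousOn q (Ici 0)) (a : ℝ) :
    ∃ A ≥ 0, ∀ x, |x| ≤ a → |q (|x|)| ≤ A := by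
  obtain ⟨A, hA⟩ := (isCompact_Icc (a := -a) (b := a)).exists_bound_of_continuousOn
    (continuous_comp_abs hq).continuousOn
  exact ⟨|A|, abs_nonneg _, fun x hx => (hA x (abs_le.1 hx)).trans (le_abs_self _)⟩

/-- If a wave and its derivative vanish at `x₀` for `|t| < T`, then the wave vanishes for
`|x - x₀| + |t| < T`. -/
theorem IsEvaluation.waveField_eq_zero_of_lateral (he : IsEvaluation q e d)
    (hR : (slInverse q).IsPositive) (hq : ContinuousOn q (Ici 0)) (g : L2)
    {x₀ T : ℝ}
    (h : ∀ t, |t| < T → waveField q e g x₀ t = 0 ∧ waveField q d g x₀ t = 0) {x t : ℝ}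
    (hxt : |x - x₀| + |t| < T) : waveField q e g x t = 0 := by
  -- The sign `ε` selects the side of `x₀`; the distance `s` from `x₀` is the evolution variable.
  obtain ⟨ε, s, hε, hs, hx⟩ : ∃ ε s : ℝ, ε * ε = 1 ∧ 0 ≤ s ∧ x = x₀ + ε * s := by
    rcases le_total x₀ x with h0 | h0
    · exact ⟨1, x - x₀, by norm_num, by linarith, by ring⟩
    · exact ⟨-1, x₀ - x, by norm_num, by linarith, by ring⟩
  have hεa : |ε| = 1 := by
    have : |ε| * |ε| = 1 := by rw [← abs_mul, hε, abs_one]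
    nlinarith [abs_nonneg ε]
  have hsx : |x - x₀| = s := by rw [hx, add_sub_cancel_left, abs_mul, hεa, one_mul, abs_of_nonneg hs]
  obtain ⟨A, hA, hqA⟩ := exists_potential_bound hq (|x₀| + s)
  obtain ⟨C, hC⟩ := he.exists_waveField_bound hR g (|x₀| + s) T
  have hb : ∀ s', 0 ≤ s' → s' ≤ s → |x₀ + ε * s'| ≤ |x₀| + s := fun s' h0 h1 => by
    have := abs_add_le x₀ (ε * s')
    rw [abs_mul, hεa, one_mul, abs_of_nonneg h0] at this
    linarith
  have hεc : (ε : ℂ) * ε = 1 := by exact_mod_cast hε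
  -- Differentiating `w(x₀, t) = 0` along the segment supplies the remaining part of the Cauchy
  -- data.
  have hwt : ∀ t, |t| < T → waveFieldTime q e g x₀ t = 0 := by
    intro t ht
    have h1 := he.hasDerivAt_waveField hR g x₀ 0 0 1 t
    simp only [zero_mul, add_zero, one_mul, zero_add, Complex.ofReal_zero, Complex.ofReal_one] at h1
    have h2 : (fun σ => waveField q e g x₀ σ) =ᶠ[𝓝 t] fun _ => 0 := by
      filter_upwards [(isOpen_lt continuous_abs continuous_const).mem_nhds ht] with σ hσ
      exact (h σ hσ).1
    exact h1.unique ((hasDerivAt_const t (0 : ℂ)).congr_of_eventuallyEq h2)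
  rw [hx]
  -- The cone lemma with the roles of space and time exchanged: `t` is the transverse variable,
  -- centred at `0`.
  refine eq_zero_of_cone (u := fun s y => waveField q e g (x₀ + ε * s) y)
    (p := fun s y => ε * waveField q d g (x₀ + ε * s) y + waveFieldTime q e g (x₀ + ε * s) y)
    (m := fun s y => ε * waveField q d g (x₀ + ε * s) y - waveFieldTime q e g (x₀ + ε * s) y)
    (F := fun s y => q |x₀ + ε * s| * waveField q e g (x₀ + ε * s) y)
    (S := s) (T := T) (y₀ := 0) (A := A) (C := C) hA (fun s y => ?_) (fun s c => ?_) (fun s c => ?_)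
    (fun s' y h0 h1 h2 => ?_) (fun s' y h0 h1 h2 => ?_) (fun y hy => ?_) hs le_rfl ?_
  · have h1 := he.hasDerivAt_waveField hR g x₀ ε y 0 s
    simp only [zero_mul, add_zero, Complex.ofReal_zero] at h1
    refine h1.congr_deriv ?_
    ring
  · have h1 := ((he.hasDerivAt_waveField_space hR g x₀ ε c (-1) s).const_mul (ε : ℂ)).add
      (he.hasDerivAt_waveFieldTime hR g x₀ ε c (-1) s)
    simp only [neg_mul, one_mul, ← sub_eq_add_neg] at h1
    refine h1.congr_deriv ?_
    push_cast
    linear_combination (q |x₀ + ε * s| * waveField q e g (x₀ + ε * s) (c - s) -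
      inner ℂ (e (x₀ + ε * s)) (slInverse q (sineOperator (slInverse q) (c - s) g))) * hεc
  · have h1 := ((he.hasDerivAt_waveField_space hR g x₀ ε c 1 s).const_mul (ε : ℂ)).sub
      (he.hasDerivAt_waveFieldTime hR g x₀ ε c 1 s)
    simp only [one_mul] at h1
    refine h1.congr_deriv ?_
    push_cast
    linear_combination (q |x₀ + ε * s| * waveField q e g (x₀ + ε * s) (c + s) -
      inner ℂ (e (x₀ + ε * s)) (slInverse q (sineOperator (slInverse q) (c + s) g))) * hεc
  · rw [norm_mul, Complex.norm_real]
    exact mul_le_mul_of_nonneg_right (hqA _ (hb s' h0 h1)) (norm_nonneg _)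
  · refine hC _ _ (hb s' h0 h1) ?_
    rw [sub_zero] at h2
    linarith
  · rw [sub_zero] at hy
    simp [h y hy, hwt y hy]
  · rw [sub_zero, ← hsx, add_comm]
    exact hxt

/-- Finite speed of propagation. -/
theorem IsEvaluation.waveField_eq_zero_of_initial (he : IsEvaluation q e d)
    (hR : (slInverse q).IsPositive) (hq : ContinuousOn q (Ici 0)) (g : L2)
    {x₀ T : ℝ}
    (h : ∀ x, |x - x₀| < T → waveFieldTime q e g x 0 = 0) {x t : ℝ} (ht : 0 ≤ t)
    (hxt : |x - x₀| + t < T) : waveField q e g x t = 0 := by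
  obtain ⟨A, hA, hqA⟩ := exists_potential_bound hq (|x₀| + T)
  obtain ⟨C, hC⟩ := he.exists_waveField_bound hR g (|x₀| + T) t
  have hb : ∀ y s', 0 ≤ s' → |y - x₀| + s' < T → |y| ≤ |x₀| + T := fun y s' h0 h1 => by
    have := abs_add_le (y - x₀) x₀
    rw [sub_add_cancel] at this
    linarith
  -- Since `S(0) = 0`, both `w` and `w_x` vanish at `t = 0`, so the time derivative is the only
  -- initial datum.
  have hw0 : ∀ (f : ℝ → L2) (y : ℝ), waveField q f g y 0 = 0 := by
    intro f y
    simp [waveField, sineOperator_zero]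
  refine eq_zero_of_cone (u := fun s y => waveField q e g y s)
    (p := fun s y => waveFieldTime q e g y s + waveField q d g y s)
    (m := fun s y => waveFieldTime q e g y s - waveField q d g y s)
    (F := fun s y => -(q |y| * waveField q e g y s))
    (S := t) (T := T) (y₀ := x₀) (A := A) (C := C) hA (fun s y => ?_) (fun s c => ?_) (fun s c => ?_)
    (fun s' y h0 h1 h2 => ?_) (fun s' y h0 h1 h2 => ?_) (fun y hy => ?_) ht le_rfl hxt
  · have h1 := he.hasDerivAt_waveField hR g y 0 0 1 s
    simp only [zero_mul, add_zero, Complex.ofReal_zero, zero_add, one_mul, Complex.ofReal_one] at h1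
    refine h1.congr_deriv ?_
    ring
  · have h1 := (he.hasDerivAt_waveFieldTime hR g c (-1) 0 1 s).add
      (he.hasDerivAt_waveField_space hR g c (-1) 0 1 s)
    simp only [neg_mul, one_mul, ← sub_eq_add_neg, zero_add] at h1
    refine h1.congr_deriv ?_
    push_cast
    ring
  · have h1 := (he.hasDerivAt_waveFieldTime hR g c 1 0 1 s).sub
      (he.hasDerivAt_waveField_space hR g c 1 0 1 s)
    simp only [one_mul, zero_add] at h1
    refine h1.congr_deriv ?_
    push_cast
    ring
  · rw [norm_neg, norm_mul, Complex.norm_real]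
    exact mul_le_mul_of_nonneg_right (hqA _ (hb y s' h0 h2)) (norm_nonneg _)
  · refine hC _ _ (hb y s' h0 h2) ?_
    rwa [abs_of_nonneg h0]
  · simp [hw0, h y hy]

/-- `waveField` is the continuous representative of the wave. -/
theorem waveField_eq (hR : (slInverse q).IsPositive) (g : L2) (x t : ℝ) :
    waveField q e g x t = inner ℂ (e x)
      (slInverse q (sineOperator (slInverse q) t (slInverse q g))) := by
  rw [sineOperator_apply_comm hR]
  exact hR.isSymmetric _ _

/-- Each of the three factors `L⁻¹` has its use: one allows evaluation at a point, one falls on `e`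
and makes its derivative `d` differentiable, one makes the sine operator twice differentiable in
time. -/
theorem IsEvaluation.ae_eq_waveField (he : IsEvaluation q e d)
    (hR : (slInverse q).IsPositive) (g : L2) (t : ℝ) :
    sineOperator (slInverse q) t (slInverse q (slInverse q (slInverse q g))) =ᵐ[halfLine]
      fun x => waveField q e g x t := by
  have h1 := he.ae_eq (slInverse q (sineOperator (slInverse q) t (slInverse q g)))
  simp only [waveField_eq hR]
  rw [sineOperator_apply_comm hR, sineOperator_apply_comm hR _ (slInverse q g)]
  exact h1

end Field

variable {q : ℝ → ℝ} {e d : ℝ → L2}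

/-! ### Unique continuation and finite speed of propagation in `L₂` -/

section Locality

theorem mem_subspaceOn_compl_ball {f : L2} {x₀ T : ℝ}
    (h : ∀ T' < T, f ∈ subspaceOn (Metric.ball x₀ T')ᶜ) : f ∈ subspaceOn (Metric.ball x₀ T)ᶜ := by
  have h1 : ∀ᵐ x ∂halfLine, ∀ n : ℕ, x ∉ (Metric.ball x₀ (T - 1 / ((n : ℝ) + 1)))ᶜ → f x = 0 :=
    ae_all_iff.2 fun n => mem_subspaceOn.1 (h _ (by
      have : (0 : ℝ) < 1 / ((n : ℝ) + 1) := by positivity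
      linarith))
  refine mem_subspaceOn.2 ?_
  filter_upwards [h1] with x hx hxT
  rw [notMem_compl_iff, Metric.mem_ball] at hxT
  obtain ⟨n, hn⟩ := exists_nat_one_div_lt (sub_pos.2 hxT)
  refine hx n ?_
  rw [notMem_compl_iff, Metric.mem_ball]
  linarith

theorem mem_subspaceOn_congr {E : Set ℝ} {f : L2} {w : ℝ → ℂ} (hf : f =ᵐ[halfLine] w) :
    f ∈ subspaceOn E ↔ ∀ᵐ x ∂halfLine, x ∉ E → w x = 0 := by
  rw [mem_subspaceOn]
  refine eventually_congr ?_
  filter_upwards [hf] with x hx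
  rw [hx]

/-- If the time averages of a wave vanish at `x₀` together with their derivatives for `|t| < T`,
then the wave vanishes in the cone over `x₀`. -/
theorem IsEvaluation.mem_compl_ball_of_lateral (he : IsEvaluation q e d)
    (hR : (slInverse q).IsPositive) (hd : DenseRange (slInverse q)) (hq : ContinuousOn q (Ici 0))
    {f : L2} {x₀ T : ℝ} (hf : ∀ h > 0, ∀ g, (sineOperator (slInverse q) h ^ 7) f =
        slInverse q (slInverse q (slInverse q g)) → ∀ s, |s| < T - 7 * h →
      waveField q e g x₀ s = 0 ∧ waveField q d g x₀ s = 0) :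
    f ∈ subspaceOn (Metric.ball x₀ T)ᶜ := by
  -- Seven factors `S(h)` turn `f` into `L⁻³ g`; the eighth evaluates the resulting field at time
  -- `h`. The cone shrinks by `7 h` and by `h` accordingly.
  have key : ∀ h > 0, (sineOperator (slInverse q) h ^ 8) f ∈
      subspaceOn (Metric.ball x₀ (T - 8 * h))ᶜ := by
    intro h hh
    obtain ⟨G, hG⟩ := exists_sineOperator_pow_seven_eq hR h
    have hG' : (sineOperator (slInverse q) h ^ 7) f =
        slInverse q (slInverse q (slInverse q (G f))) := by
      rw [hG]
      rfl
    have h8 : (sineOperator (slInverse q) h ^ 8) f =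
        sineOperator (slInverse q) h (slInverse q (slInverse q (slInverse q (G f)))) := by
      rw [← hG', pow_succ']
      rfl
    rw [h8, mem_subspaceOn_congr (he.ae_eq_waveField hR (G f) h)]
    refine Eventually.of_forall fun x hxb => ?_
    refine he.waveField_eq_zero_of_lateral hR hq (G f) (hf h hh _ hG') ?_
    rw [notMem_compl_iff, Metric.mem_ball, Real.dist_eq] at hxb
    rw [abs_of_pos hh]
    linarith
  -- The normalized eighth powers converge to `f` as `h → 0`, and `L₂` of a set is closed.
  refine mem_subspaceOn_compl_ball fun T' hT' => ?_
  refine (subspaceOn (Metric.ball x₀ T')ᶜ).isClosed'.mem_of_tendsto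
    (tendsto_averageOperator_pow hR hd f 8) ?_
  have h1 : ∀ᶠ h : ℝ in 𝓝[>] 0, h < (T - T') / 8 :=
    nhdsWithin_le_nhds (Iio_mem_nhds (by linarith))
  filter_upwards [h1, self_mem_nhdsWithin] with h hh1 hh0
  rw [averageOperator_pow_apply]
  refine Submodule.smul_of_tower_mem _ _ ?_
  refine subspaceOn_mono (Eventually.of_forall fun x hx => ?_) (key h hh0)
  exact compl_subset_compl.2 (Metric.ball_subset_ball (by linarith)) hx

/-- If a wave vanishes for `|t| < T` on a set that has positive measure near `x₀`, then it
vanishes in the cone over `x₀`. -/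
theorem IsEvaluation.mem_compl_ball_of_sine_mem (he : IsEvaluation q e d)
    (hR : (slInverse q).IsPositive) (hd : DenseRange (slInverse q)) (hq : ContinuousOn q (Ici 0))
    {E : Set ℝ} {f : L2} {x₀ T : ℝ} (hx : ∀ ε > 0, halfLine (E ∩ Metric.ball x₀ ε) ≠ 0)
    (hf : ∀ s, |s| < T → sineOperator (slInverse q) s f ∈ subspaceOn Eᶜ) :
    f ∈ subspaceOn (Metric.ball x₀ T)ᶜ := by
  refine he.mem_compl_ball_of_lateral hR hd hq fun h hh g hg s hs => ?_
  -- Vanishing almost everywhere on `E`, which has positive measure in every ball about `x₀`,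
  -- produces zeros of the field accumulating at `x₀`.
  have hz : ∃ᶠ x in 𝓝[≠] x₀, waveField q e g x s = 0 := by
    have h1 := sineOperator_pow_mem hR hh.le 7 hf s (by exact_mod_cast hs)
    rw [hg, mem_subspaceOn_congr (he.ae_eq_waveField hR g s)] at h1
    intro hev
    rw [eventually_nhdsWithin_iff, Metric.eventually_nhds_iff_ball] at hev
    obtain ⟨ε, hε, hev⟩ := hev
    refine hx ε hε ?_
    have hx₀ : ∀ᵐ x ∂halfLine, x ≠ x₀ := by
      refine ae_restrict_of_ae ?_
      simp [ae_iff]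
    refine measure_mono_null (fun x hxm => ?_) (ae_iff.1 (h1.and hx₀))
    intro hcon
    exact hev x hxm.2 hcon.2 (hcon.1 fun h => h hxm.1)
  have h1 := he.hasDerivAt_waveField hR g 0 1 s 0 x₀
  simp only [zero_mul, add_zero, Complex.ofReal_zero, zero_add, one_mul,
    Complex.ofReal_one] at h1
  -- At an accumulation point of zeros a differentiable function vanishes together with its
  -- derivative.
  refine ⟨?_, ?_⟩
  · by_contra hne
    have h2 := h1.continuousAt.eventually_ne hne
    exact hz (h2.filter_mono nhdsWithin_le_nhds)
  · by_contra hne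
    exact hz (h1.eventually_ne hne)

theorem tsupport_slExpr_subset (q : ℝ → ℝ) (η : ℝ → ℂ) : tsupport (slExpr q η) ⊆ tsupport η := by
  intro x hx
  by_contra h
  have h1 := notMem_tsupport_iff_eventuallyEq.1 h
  refine (notMem_tsupport_iff_eventuallyEq.2 ?_) hx
  have h2 : deriv (deriv η) =ᶠ[𝓝 x] deriv (deriv 0) := h1.deriv.deriv
  filter_upwards [h1, h2] with y hy hy2
  rw [slExpr, hy, hy2]
  have h3 : deriv (0 : ℝ → ℂ) = 0 := by
    ext y
    exact deriv_const y _
  simp [h3]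

/-- The even extension of `q` may fail to be smooth at `0`; the support of `η` keeps away from that
point. This permits iterating the expression. -/
theorem IsTest.slExpr {η : ℝ → ℂ} (hη : IsTest η) (hq : ContDiffOn ℝ (⊤ : ℕ∞) q (Ici 0))
    (hs : tsupport η ⊆ Ioi 0) : IsTest (slExpr q η) := by
  refine ⟨ContDiff.sub (contDiff_iff_contDiffAt.2 fun x => ?_) hη.derivative.derivative.1,
    hη.hasCompactSupport_slExpr⟩
  by_cases hx : x ∈ tsupport η
  · have hx0 : 0 < x := hs hx
    have h1 : ContDiffAt ℝ (⊤ : ℕ∞) (fun x => (q |x| : ℂ)) x := by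
      refine Complex.ofRealCLM.contDiff.contDiffAt.comp x ?_
      refine (hq.contDiffAt (Ici_mem_nhds hx0)).congr_of_eventuallyEq ?_
      filter_upwards [Ioi_mem_nhds hx0] with y hy
      rw [abs_of_pos hy]
    exact h1.mul hη.1.contDiffAt
  · refine (contDiffAt_const (c := (0 : ℂ))).congr_of_eventuallyEq ?_
    filter_upwards [notMem_tsupport_iff_eventuallyEq.1 hx] with y hy
    rw [hy, Pi.zero_apply, mul_zero]

theorem IsEvaluation.apply_zero (he : IsEvaluation q e d) : e 0 = 0 := by
  have := he.neg 0
  rw [neg_zero, eq_neg_iff_add_eq_zero, ← two_smul ℂ, smul_eq_zero] at this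
  exact this.resolve_left two_ne_zero

theorem IsEvaluation.inner_slExpr (he : IsEvaluation q e d) (hq : ContinuousOn q (Ici 0))
    (hpos : IsPositiveDefinite (slOperator q)) {η : ℝ → ℂ} (hη : IsTest η)
    (h0 : η 0 = 0) {x : ℝ} (hx : 0 < x) :
    inner ℂ (e x) ((hη.memLp_slExpr hq).toLp _) = η x := by
  have h1 := (he.ae_eq ((hη.memLp_slExpr hq).toLp _)).symm
  rw [slInverse_slExpr hq hpos hη h0] at h1
  have hc : Continuous e := continuous_iff_continuousAt.2 fun x => (he.hasDerivAt x).continuousAt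
  exact Measure.eqOn_open_of_ae_eq (h1.trans hη.memLp.coeFn_toLp) isOpen_Ioi
    (hc.inner continuous_const).continuousOn hη.continuous.continuousOn hx

/-- Applying `-d²/dx² + q` three times gives `η = L⁻³ g`, so the wave has a field, with the odd
extension of `η` as initial velocity; the cone lemma applies. -/
theorem IsEvaluation.sine_toLp_mem (he : IsEvaluation q e d)
    (hq : ContDiffOn ℝ (⊤ : ℕ∞) q (Ici 0)) (hpos : IsPositiveDefinite (slOperator q))
    {x₀ T t : ℝ} (hx₀ : 0 ≤ x₀) (ht : 0 ≤ t) {η : ℝ → ℂ} (hη : IsTest η) (hs : tsupport η ⊆ Ioi 0)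
    (hηT : ∀ x ∈ Metric.ball x₀ T, η x = 0) :
    sineOperator (slInverse q) t (hη.memLp.toLp _) ∈ subspaceOn (Metric.ball x₀ (T - t))ᶜ := by
  have hR := isPositive_slInverse hq.continuousOn hpos
  have hη1 := hη.slExpr hq hs
  have hs1 := (tsupport_slExpr_subset q η).trans hs
  have hη2 := hη1.slExpr hq hs1
  have hs2 := (tsupport_slExpr_subset q _).trans hs1
  have e0 := slInverse_slExpr hq.continuousOn hpos hη (IsTest.eq_zero_of_tsupport_subset hs).1
  have e1 := slInverse_slExpr hq.continuousOn hpos hη1 (IsTest.eq_zero_of_tsupport_subset hs1).1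
  have e2 := slInverse_slExpr hq.continuousOn hpos hη2 (IsTest.eq_zero_of_tsupport_subset hs2).1
  set g := (hη2.memLp_slExpr hq.continuousOn).toLp _ with hg
  have hinit : ∀ x, waveFieldTime q e g x 0 =
      inner ℂ (e x) ((hη.memLp_slExpr hq.continuousOn).toLp _) := by
    intro x
    have h1 : inner ℂ (slInverse q (e x)) (slInverse q g) =
        inner ℂ (e x) (slInverse q (slInverse q g)) := hR.isSymmetric _ _
    rw [waveFieldTime, cosineOperator_zero hR, h1, e2, e1]
  have hzero : ∀ x, |x - x₀| < T → waveFieldTime q e g x 0 = 0 := by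
    intro x hx
    rw [hinit]
    have h0 := (IsTest.eq_zero_of_tsupport_subset hs).1
    rcases lt_trichotomy x 0 with hx0 | hx0 | hx0
    -- For `x < 0 ≤ x₀` the reflected point is no farther from `x₀`, so the odd extension vanishes
    -- on the whole ball.
    · have h1 : e x = -e (-x) := by rw [he.neg, neg_neg]
      have h2 : η (-x) = 0 := by
        refine hηT _ ?_
        rw [Metric.mem_ball, Real.dist_eq]
        refine lt_of_le_of_lt ?_ hx
        rw [abs_of_neg (show x - x₀ < 0 by linarith)]
        exact abs_le.2 ⟨by linarith, by linarith⟩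
      rw [h1, inner_neg_left, he.inner_slExpr hq.continuousOn hpos hη h0 (by linarith), h2, neg_zero]
    · rw [hx0, he.apply_zero, inner_zero_left]
    · rw [he.inner_slExpr hq.continuousOn hpos hη h0 hx0]
      exact hηT _ hx
  have e3 : hη.memLp.toLp _ = slInverse q (slInverse q (slInverse q g)) := by rw [e2, e1, e0]
  rw [e3, mem_subspaceOn_congr (he.ae_eq_waveField hR g t)]
  refine Eventually.of_forall fun x hx => ?_
  refine he.waveField_eq_zero_of_initial hR hq.continuousOn g hzero ht ?_
  rw [notMem_compl_iff, Metric.mem_ball, Real.dist_eq] at hx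
  linarith

/-- Finite speed of propagation in `L₂`. -/
theorem IsEvaluation.sine_mem_compl_ball (he : IsEvaluation q e d)
    (hq : ContDiffOn ℝ (⊤ : ℕ∞) q (Ici 0)) (hpos : IsPositiveDefinite (slOperator q))
    {x₀ T : ℝ} (hx₀ : 0 ≤ x₀) (t : ℝ) {f : L2} (hf : f ∈ subspaceOn (Metric.ball x₀ T)ᶜ) :
    sineOperator (slInverse q) t f ∈ subspaceOn (Metric.ball x₀ (T - |t|))ᶜ := by
  wlog ht : 0 ≤ t generalizing t
  · have h1 := this (-t) (by linarith)
    rw [sineOperator_neg, neg_apply, abs_neg] at h1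
    rw [← neg_neg (sineOperator (slInverse q) t f)]
    exact (subspaceOn _).neg_mem h1
  rw [abs_of_nonneg ht]
  -- Duality: `f` is arbitrary in `L₂`, so `S(t)` is moved to a `y` supported in the small ball, and
  -- `S(t) y` is tested against smooth functions supported outside the large one.
  refine mem_of_forall_inner_orthogonal fun y hy => ?_
  rw [← inner_sineOperator_left, ← inner_conj_symm]
  rw [orthogonal_subspaceOn Metric.isOpen_ball.measurableSet.compl] at hy
  have h1 := ae_eq_zero_of_inner_test_eq_zero
    (isOpen_Ioi.inter Metric.isClosed_closedBall.isOpen_compl :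
      IsOpen (Ioi (0 : ℝ) ∩ (Metric.closedBall x₀ T)ᶜ)) (sineOperator (slInverse q) t y)
    fun η hη hs => by
      rw [← inner_sineOperator_left]
      refine inner_eq_zero_of_mem_compl (he.sine_toLp_mem hq hpos hx₀ ht hη
        (hs.trans inter_subset_left) fun x hx => ?_) hy
      by_contra hne
      exact (hs (subset_tsupport _ hne)).2 (Metric.ball_subset_closedBall hx)
  rw [inner_eq_zero_of_mem_compl hf, map_zero]
  refine mem_subspaceOn.2 ?_
  -- The test functions only reach the complement of the closed ball; its boundary is a null set.
  have h2 : ∀ᵐ x : ℝ, x ≠ x₀ + T ∧ x ≠ x₀ - T := by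
    rw [ae_iff]
    refine measure_mono_null (t := {x₀ + T, x₀ - T}) (fun x hx => ?_)
      (Set.Finite.measure_zero (by simp) _)
    rw [Set.mem_ofPred_eq, not_and_or, not_not, not_not] at hx
    exact hx
  filter_upwards [h1, ae_restrict_of_ae h2, ae_restrict_mem measurableSet_Ioi] with x hx1 hx2 hx0 hx
  refine hx1 ⟨hx0, fun hcl => hx ?_⟩
  rw [compl_compl, Metric.mem_ball]
  refine lt_of_le_of_ne hcl fun heq => ?_
  rw [Real.dist_eq] at heq
  rcases abs_cases (x - x₀) with h | h
  · exact hx2.1 (by linarith)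
  · exact hx2.2 (by linarith)

end Locality

variable {q : ℝ → ℝ} {e d : ℝ → L2}

/-! ### The wave isotony as metric neighbourhood -/

section Isotony

/-- The points near which `E` has positive measure in the half-line. -/
def essSupport (E : Set ℝ) : Set ℝ := {x | ∀ ε > 0, halfLine (E ∩ Metric.ball x ε) ≠ 0}

theorem exists_mem_essSupport {E : Set ℝ} (h : halfLine E ≠ 0) : ∃ x ∈ E, x ∈ essSupport E := by
  obtain ⟨x, hx, hp⟩ := exists_mem_forall_mem_nhdsWithin_pos_measure h
  exact ⟨x, hx, fun ε hε => (hp _ (inter_mem_nhdsWithin E (Metric.ball_mem_nhds x hε))).ne'⟩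

theorem essSupport_mono {E F : Set ℝ} (h : E ⊆ F) : essSupport E ⊆ essSupport F :=
  fun _ hx ε hε h0 => hx ε hε (measure_mono_null (inter_subset_inter_left _ h) h0)

theorem inter_ball_null_of_notMem_thickening {E : Set ℝ} {x t : ℝ}
    (hx : x ∉ Metric.thickening t (essSupport E)) : halfLine (E ∩ Metric.ball x t) = 0 := by
  by_contra h
  obtain ⟨y, hy, hys⟩ := exists_mem_essSupport h
  refine hx (Metric.mem_thickening_iff.2 ⟨y, essSupport_mono inter_subset_left hys, ?_⟩)
  rw [dist_comm]
  exact hy.2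

/-- A locally null set is null, by the Lindelöf property. -/
theorem mem_subspaceOn_of_locally {N : Set ℝ} {f : L2}
    (h : ∀ x ∉ N, 0 < x → ∃ r > 0, f ∈ subspaceOn (Metric.ball x r)ᶜ) : f ∈ subspaceOn N := by
  rw [mem_subspaceOn, ae_iff, Measure.restrict_apply' measurableSet_Ioi]
  refine measure_null_of_locally_null _ fun x hx => ?_
  have hxN : x ∉ N := fun h => hx.1 fun h' => absurd h h'
  obtain ⟨r, hr, hf⟩ := h x hxN hx.2
  refine ⟨_, inter_mem_nhdsWithin _ (Metric.ball_mem_nhds x hr), ?_⟩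
  rw [mem_subspaceOn, ae_iff, Measure.restrict_apply' measurableSet_Ioi] at hf
  refine measure_mono_null (fun y hy => ?_) hf
  refine ⟨fun h0 => hy.1.1 fun _ => h0 fun hyc => hyc hy.2, hy.1.2⟩

theorem mem_subspaceOn_compl_of_null {E F : Set ℝ} {f : L2} (hf : f ∈ subspaceOn E)
    (h : halfLine (E ∩ F) = 0) : f ∈ subspaceOn Fᶜ := by
  refine mem_subspaceOn.2 ?_
  filter_upwards [mem_subspaceOn.1 hf, measure_eq_zero_iff_ae_notMem.1 h] with x h1 h2 h3
  exact h1 fun hE => h2 ⟨hE, notMem_compl_iff.1 h3⟩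

/-- About a point outside the neighbourhood the ball of radius `t` misses `E` up to a null set;
finite speed leaves the radius `t - |s|` free. -/
theorem IsEvaluation.sine_mem_thickening (he : IsEvaluation q e d)
    (hq : ContDiffOn ℝ (⊤ : ℕ∞) q (Ici 0)) (hpos : IsPositiveDefinite (slOperator q))
    {E : Set ℝ} {f : L2} (hf : f ∈ subspaceOn E) {s t : ℝ} (hs : |s| < t) :
    sineOperator (slInverse q) s f ∈ subspaceOn (Metric.thickening t (essSupport E)) :=
  mem_subspaceOn_of_locally fun _ hx hx0 => ⟨t - |s|, sub_pos.2 hs,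
    he.sine_mem_compl_ball hq hpos hx0.le s
      (mem_subspaceOn_compl_of_null hf (inter_ball_null_of_notMem_thickening hx))⟩

theorem _root_.Continuous.memLp_restrict_Ioc {F : Type*} [NormedAddCommGroup F]
    [SecondCountableTopologyEither ℝ F] {g : ℝ → F} (hg : Continuous g) (b : ℝ) :
    MemLp g 2 (volume.restrict (Ioc 0 b)) := by
  obtain ⟨C, hC⟩ := (isCompact_Icc (a := 0) (b := b)).exists_bound_of_continuousOn hg.continuousOn
  refine MemLp.of_bound hg.aestronglyMeasurable C ?_
  filter_upwards [ae_restrict_mem measurableSet_Ioc] with s hs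
  exact hC s (Ioc_subset_Icc_self hs)

/-- The wave isotony acts on the subspaces `L₂(E)` as the metric neighbourhood. -/
theorem IsEvaluation.waveIsotony_subspaceOn (he : IsEvaluation q e d)
    (hq : ContDiffOn ℝ (⊤ : ℕ∞) q (Ici 0)) (hpos : IsPositiveDefinite (slOperator q))
    {E : Set ℝ} (hE : MeasurableSet E) {t : ℝ≥0} (ht : 0 < t) :
    waveIsotony (slOperator q) t (subspaceOn E) =
      subspaceOn (Metric.thickening t (essSupport E)) := by
  have hR := isPositive_slInverse hq.continuousOn hpos
  rw [waveIsotony, if_neg ht.ne']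
  refine le_antisymm ?_ (le_of_forall_orthogonal_mem fun y hy => ?_)
  · refine Submodule.closure_le.2 (Submodule.span_le.2 ?_)
    rintro _ ⟨g, hg, -, rfl⟩
    refine intervalIntegral_mem _ fun s hs => he.sine_mem_thickening hq hpos (hg s) ?_
    rw [uIoc_of_le t.coe_nonneg] at hs
    rw [abs_of_nonneg (sub_nonneg.2 hs.2)]
    linarith [hs.1]
  · have hcS : Continuous fun s => sineOperator (slInverse q) (t - s) y :=
      (continuous_sineOperator_apply hR y).comp (continuous_const.sub continuous_id)
    -- For this source the pairing of `v^g(t)` with `y` is `∫ ‖g(s)‖² ds`, so orthogonality forces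
    -- `g = 0`.
    set g : ℝ → L2 := fun s => proj (subspaceOn E) (sineOperator (slInverse q) (t - s) y) with hg
    have hcg : Continuous g := (proj (subspaceOn E)).continuous.comp hcS
    have hgm : ∀ s, g s ∈ subspaceOn E := fun s => Submodule.starProjection_apply_mem _ _
    have h0 : inner ℂ (duhamel (slInverse q) g t) y = 0 :=
      hy _ (subset_closure (Submodule.subset_span
        ⟨g, hgm, fun b => hcg.memLp_restrict_Ioc b, rfl⟩))
    have hcSg : Continuous fun s => sineOperator (slInverse q) (t - s) (g s) :=
      ((continuous_sineOperator hR).comp (continuous_const.sub continuous_id)).clm_apply hcg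
    have h1 : ∫ s in (0 : ℝ)..t, ‖g s‖ ^ 2 = 0 := by
      have h2 := (innerSL ℂ y).intervalIntegral_comp_comm (hcSg.intervalIntegrable (μ := volume) 0 t)
      have h3 : ∀ s, inner ℂ y (sineOperator (slInverse q) (t - s) (g s)) = ((‖g s‖ ^ 2 : ℝ) : ℂ) := by
        intro s
        have h4 : inner ℂ (sineOperator (slInverse q) (t - s) y - g s) (g s) = 0 :=
          Submodule.starProjection_inner_eq_zero _ _ (hgm s)
        rw [inner_sub_left, sub_eq_zero] at h4
        rw [← inner_sineOperator_left, Complex.ofReal_pow, h4]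
        exact inner_self_eq_norm_sq_to_K _
      simp only [innerSL_apply_apply, h3, intervalIntegral.integral_ofReal] at h2
      have h4 : inner ℂ y (∫ s in (0 : ℝ)..t, sineOperator (slInverse q) (t - s) (g s)) = 0 := by
        rw [← inner_conj_symm]
        exact (congrArg _ h0).trans (map_zero _)
      rw [h4] at h2
      exact_mod_cast h2
    have hg0 : ∀ s ∈ Icc (0 : ℝ) t, g s = 0 := by
      intro s hs
      by_contra hne
      refine (intervalIntegral.integral_pos (f := fun s => ‖g s‖ ^ 2) (by exact_mod_cast ht)
        (hcg.norm.pow 2).continuousOn (fun _ _ => by positivity) ⟨s, hs, ?_⟩).ne' h1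
      have := norm_pos_iff.2 hne
      positivity
    -- The wave with data `y` vanishes on `E` throughout `|s| < t`; negative times follow by
    -- oddness.
    have hS : ∀ s : ℝ, |s| < t → sineOperator (slInverse q) s y ∈ subspaceOn Eᶜ := by
      have hS' : ∀ s : ℝ, 0 ≤ s → s < t → sineOperator (slInverse q) s y ∈ subspaceOn Eᶜ := by
        intro s hs hst
        have h2 := hg0 (t - s) ⟨by linarith, by linarith⟩
        simp only [hg, sub_sub_cancel] at h2
        rw [proj_subspaceOn hE] at h2
        have h3 := sub_restrictTo_mem hE (sineOperator (slInverse q) s y)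
        rwa [h2, sub_zero] at h3
      intro s hs
      rcases le_total 0 s with h | h
      · exact hS' s h (by rwa [abs_of_nonneg h] at hs)
      · have h2 := hS' (-s) (by linarith) (by rwa [abs_of_nonpos h] at hs)
        rw [sineOperator_neg, neg_apply] at h2
        rw [← neg_neg (sineOperator (slInverse q) s y)]
        exact (subspaceOn _).neg_mem h2
    rw [orthogonal_subspaceOn Metric.isOpen_thickening.measurableSet]
    -- Unique continuation from a point `z` of the essential support clears the ball of radius `t`
    -- about `z`, hence a ball about `x`.
    refine mem_subspaceOn_of_locally fun x hx _ => ?_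
    rw [notMem_compl_iff, Metric.mem_thickening_iff] at hx
    obtain ⟨z, hz, hxz⟩ := hx
    refine ⟨t - dist x z, sub_pos.2 hxz, ?_⟩
    refine subspaceOn_mono (Eventually.of_forall fun a ha => ?_) (he.mem_compl_ball_of_sine_mem hR
      (denseRange_slInverse hq.continuousOn hpos) hq.continuousOn hz hS)
    exact compl_subset_compl.2 (Metric.ball_subset_ball' (by linarith)) ha

end Isotony

variable {q : ℝ → ℝ} {e d : ℝ → L2}

/-! ### Boundary controls: upper bound and explicit controls -/

section Reachable

theorem inner_defectSpace_eq_zero (hq : ContinuousOn q (Ici 0)) {k : L2}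
    (hk : k ∈ defectSpace (slOperator q)) {p : L2 × L2} (hp : p ∈ slGraph q) :
    inner ℂ p.2 k = 0 := by
  obtain ⟨x, -, hx⟩ := exists_domain_of_mem_slGraph hp
  have h1 := (mem_adjoint_graph_iff (dense_domain_slOperator hq) k 0).1 hk x
  rw [inner_zero_left, hx] at h1
  rw [← inner_conj_symm, ← h1, map_zero]

/-- A function of the Friedrichs domain that vanishes near `0` also has zero derivative there, so it
belongs to the minimal domain. -/
theorem mem_slGraph_of_mem_compl_ball (hq : ContinuousOn q (Ici 0))
    (hpos : IsPositiveDefinite (slOperator q)) {f : L2} {r : ℝ} (hr : 0 < r)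
    (hf : slInverse q f ∈ subspaceOn (Metric.ball 0 r)ᶜ) : (slInverse q f, f) ∈ slGraph q := by
  obtain ⟨u, v, hu, hs, h0⟩ := exists_solvesSL_slInverse hq hpos f
  refine ⟨u, v, hu, hs, h0, ?_⟩
  rw [mem_subspaceOn_congr hu] at hf
  have h1 : ∀ᵐ x ∂(volume.restrict (Ioo 0 r)), u x = 0 := by
    rw [ae_restrict_iff' measurableSet_Ioi] at hf
    rw [ae_restrict_iff' measurableSet_Ioo]
    filter_upwards [hf] with x hx hxr
    refine hx hxr.1 ?_
    rw [notMem_compl_iff, Metric.mem_ball, Real.dist_eq, sub_zero, abs_of_pos hxr.1]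
    exact hxr.2
  have h2 : EqOn u (fun _ => 0) (Ioo 0 r) :=
    Measure.eqOn_open_of_ae_eq h1 isOpen_Ioo
      (hs.continuousOn_fst.mono fun x hx => hx.1.le) continuousOn_const
  have h3 : u =ᶠ[𝓝[Ici 0] 0] fun _ => 0 := by
    filter_upwards [inter_mem_nhdsWithin (Ici (0 : ℝ)) (Iio_mem_nhds hr)] with x hx
    rcases eq_or_lt_of_le (mem_Ici.1 hx.1) with h | h
    · rw [← h, h0]
    · exact h2 ⟨h, hx.2⟩
  exact (uniqueDiffOn_Ici (0 : ℝ) 0 (mem_Ici.2 le_rfl)).eq_deriv _ (hs.deriv 0 le_rfl)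
    ((hasDerivWithinAt_const (0 : ℝ) (Ici 0) (0 : ℂ)).congr_of_eventuallyEq h3 h0)

/-- Let `y` be the class of `η` and `z = L y`. Two integrations by parts in time move `h''` onto
`S(T - s) y`, whose second time derivative is `-S(T - s) z`. By finite speed `S(T - s) y` vanishes
near `0`, so `S(T - s) z` lies in the range of `L₀` and is orthogonal to `h(s)`. The boundary term
`(y, h(T))` cancels the term `-h(T)` of the wave. -/
theorem IsEvaluation.inner_toLp_wave (he : IsEvaluation q e d)
    (hq : ContDiffOn ℝ (⊤ : ℕ∞) q (Ici 0)) (hpos : IsPositiveDefinite (slOperator q))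
    {T : ℝ} (hT : 0 ≤ T) {h : ℝ → L2} (hh : IsControl (slOperator q) h) {η : ℝ → ℂ} (hη : IsTest η)
    (hs : tsupport η ⊆ Ioi T) : inner ℂ (hη.memLp.toLp _) (wave (slOperator q) h T) = 0 := by
  have hR := isPositive_slInverse hq.continuousOn hpos
  have hs0 : tsupport η ⊆ Ioi 0 := hs.trans (Ioi_subset_Ioi hT)
  have e0 := slInverse_slExpr hq.continuousOn hpos hη (IsTest.eq_zero_of_tsupport_subset hs0).1
  set y : L2 := hη.memLp.toLp _ with hy
  set z : L2 := (hη.memLp_slExpr hq.continuousOn).toLp _ with hz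
  obtain ⟨hh1, hh2, ε, hε, hh3⟩ := hh
  have hd1 : ∀ s, HasDerivAt h (deriv h s) s :=
    fun s => (hh1.differentiable (by simp) s).hasDerivAt
  have hh1' : ContDiff ℝ (⊤ : ℕ∞) (deriv h) := (contDiff_infty_iff_deriv.1 hh1).2
  have hd2 : ∀ s, HasDerivAt (deriv h) (iteratedDeriv 2 h s) s := fun s => by
    rw [iteratedDeriv_succ, iteratedDeriv_one]
    exact (hh1'.differentiable (by simp) s).hasDerivAt
  have hc2 : Continuous (iteratedDeriv 2 h) := by
    rw [iteratedDeriv_succ, iteratedDeriv_one]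
    exact (contDiff_infty_iff_deriv.1 hh1').2.continuous
  have hsub : ∀ s, HasDerivAt (fun s => T - s) (-1) s := fun s => by
    simpa using (hasDerivAt_id s).const_sub T
  have hφ : ∀ s, HasDerivAt (fun s => sineOperator (slInverse q) (T - s) y)
      (-cosineOperator (slInverse q) (T - s) z) s := by
    intro s
    have h1 := (hasDerivAt_operator_apply (hasDerivAt_mul_sineOperator hR (T - s)) z).scomp s
      (hsub s)
    simp only [neg_smul, one_smul] at h1
    refine h1.congr_of_eventuallyEq (Eventually.of_forall fun s => ?_)
    change sineOperator (slInverse q) (T - s) y = _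
    rw [← e0, sineOperator_apply_comm hR]
    rfl
  have hφ' : ∀ s, HasDerivAt (fun s => -cosineOperator (slInverse q) (T - s) z)
      (-sineOperator (slInverse q) (T - s) z) s := by
    intro s
    have h1 := ((hasDerivAt_operator_apply (hasDerivAt_cosineOperator hR (T - s)) z).scomp s
      (hsub s)).neg
    simp only [neg_smul, one_smul, neg_apply, neg_neg] at h1
    exact h1
  have hort : ∀ s, inner ℂ (sineOperator (slInverse q) (T - s) z) (h s) = 0 ∨ s ∉ uIcc 0 T := by
    intro s
    by_cases hsT : s ∈ uIcc 0 T
    · left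
      rw [uIcc_of_le hT] at hsT
      -- At `s = 0` finite speed leaves no gap near the origin, but the control itself vanishes.
      rcases eq_or_lt_of_le hsT.1 with h0 | h0
      · rw [← h0, hh3 0 hε, inner_zero_right]
      · have h1 : slInverse q (sineOperator (slInverse q) (T - s) z) ∈
            subspaceOn (Metric.ball 0 s)ᶜ := by
          rw [← sineOperator_apply_comm hR, e0]
          have h2 := he.sine_toLp_mem hq hpos (x₀ := 0) (T := T) (t := T - s) le_rfl
            (sub_nonneg.2 hsT.2) hη hs0 fun x hx => by
              by_contra hne
              have h3 := hs (subset_tsupport _ hne)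
              rw [Metric.mem_ball, Real.dist_eq, sub_zero] at hx
              exact absurd ((le_abs_self x).trans_lt hx) (not_lt.2 (le_of_lt h3))
          rwa [sub_sub_cancel] at h2
        exact inner_defectSpace_eq_zero hq.continuousOn (hh2 s)
          (mem_slGraph_of_mem_compl_ball hq.continuousOn hpos h0 h1)
    · exact Or.inr hsT
  have hB : ∀ s ∈ uIcc 0 T, HasDerivAt (fun s => inner ℂ (sineOperator (slInverse q) (T - s) y)
      (deriv h s) - inner ℂ (-cosineOperator (slInverse q) (T - s) z) (h s))
      (inner ℂ (sineOperator (slInverse q) (T - s) y) (iteratedDeriv 2 h s)) s := by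
    intro s hsT
    refine (((hφ s).inner ℂ (hd2 s)).sub ((hφ' s).inner ℂ (hd1 s))).congr_deriv ?_
    rw [inner_neg_left (sineOperator _ _ z), (hort s).resolve_right (not_not.2 hsT)]
    ring
  have hcont : Continuous fun s => sineOperator (slInverse q) (T - s) (iteratedDeriv 2 h s) :=
    ((continuous_sineOperator hR).comp (continuous_const.sub continuous_id)).clm_apply hc2
  have hint := intervalIntegral.integral_eq_sub_of_hasDerivAt hB (Continuous.intervalIntegrable
    (((continuous_sineOperator_apply hR y).comp (continuous_const.sub continuous_id)).inner hc2) _ _)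
  have h2 := (innerSL ℂ y).intervalIntegral_comp_comm (hcont.intervalIntegrable (μ := volume) 0 T)
  simp only [innerSL_apply_apply, ← inner_sineOperator_left] at h2
  rw [hint, sub_self, sineOperator_zero, cosineOperator_zero hR, e0, hh3 0 hε] at h2
  have h3 : deriv h 0 = 0 := by
    have h4 : h =ᶠ[𝓝 0] fun _ => 0 := eventually_of_mem (Iio_mem_nhds hε) hh3
    rw [h4.deriv_eq, deriv_const]
  rw [wave, inner_add_right, inner_neg_right]
  rw [h3] at h2
  simp only [zero_apply, inner_zero_left, inner_zero_right, inner_neg_left, sub_neg_eq_add,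
    zero_add, sub_zero] at h2
  rw [duhamel, neg_add_eq_zero]
  exact h2

theorem IsEvaluation.reachableSubspace_le (he : IsEvaluation q e d)
    (hq : ContDiffOn ℝ (⊤ : ℕ∞) q (Ici 0)) (hpos : IsPositiveDefinite (slOperator q)) (T : ℝ≥0) :
    reachableSubspace (slOperator q) T ≤ subspaceOn (Iio (T : ℝ)) := by
  refine Submodule.closure_le.2 (Submodule.span_le.2 ?_)
  rintro _ ⟨h, hh, rfl⟩
  have h1 := ae_eq_zero_of_inner_test_eq_zero isOpen_Ioi (wave (slOperator q) h T)
    fun η hη hs => he.inner_toLp_wave hq hpos T.coe_nonneg hh hη hs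
  refine mem_subspaceOn.2 ?_
  have hx₀ : ∀ᵐ x ∂halfLine, x ≠ (T : ℝ) := by
    refine ae_restrict_of_ae ?_
    simp [ae_iff]
  filter_upwards [h1, hx₀] with x h1 h2 h3
  exact h1 (lt_of_le_of_ne (not_lt.1 h3) h2.symm)

/-- A control with prescribed second derivative. -/
theorem exists_control {k : L2} (hk : k ∈ defectSpace (slOperator q)) {γ : ℝ → ℝ} {T : ℝ}
    (hγ : ContDiff ℝ (⊤ : ℕ∞) γ) (hs : tsupport γ ⊆ Ioo 0 T) :
    ∃ h, IsControl (slOperator q) h ∧ h T = ((∫ s in (0 : ℝ)..T, (T - s) * γ s : ℝ) : ℂ) • k ∧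
      ∀ s, iteratedDeriv 2 h s = (γ s : ℂ) • k := by
  have hd1 : ∀ s, HasDerivAt (fun s => ∫ r in (0 : ℝ)..s, γ r) (γ s) s := fun s =>
    (hγ.continuous.integral_hasStrictDerivAt 0 s).hasDerivAt
  have hc1 : Continuous fun s => ∫ r in (0 : ℝ)..s, γ r :=
    continuous_iff_continuousAt.2 fun s => (hd1 s).continuousAt
  -- The control is `β k`, with `β` the double primitive of `γ` starting from zero.
  set β : ℝ → ℝ := fun s => ∫ r in (0 : ℝ)..s, ∫ u in (0 : ℝ)..r, γ u with hβ
  have hd2 : ∀ s, HasDerivAt β (∫ r in (0 : ℝ)..s, γ r) s := fun s =>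
    (hc1.integral_hasStrictDerivAt 0 s).hasDerivAt
  have hs1 : ContDiff ℝ (⊤ : ℕ∞) fun s => ∫ r in (0 : ℝ)..s, γ r := by
    refine contDiff_infty_iff_deriv.2 ⟨fun s => (hd1 s).differentiableAt, ?_⟩
    rw [deriv_eq hd1]
    exact hγ
  have hs2 : ContDiff ℝ (⊤ : ℕ∞) β := by
    refine contDiff_infty_iff_deriv.2 ⟨fun s => (hd2 s).differentiableAt, ?_⟩
    rw [deriv_eq hd2]
    exact hs1
  have hdh : ∀ s, HasDerivAt (fun s => β s • k) ((∫ r in (0 : ℝ)..s, γ r) • k) s :=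
    fun s => (hd2 s).smul_const k
  have hdh2 : ∀ s, HasDerivAt (fun s => (∫ r in (0 : ℝ)..s, γ r) • k) (γ s • k) s :=
    fun s => (hd1 s).smul_const k
  obtain ⟨ε, hε, hγε⟩ : ∃ ε > 0, ∀ s < ε, γ s = 0 := by
    have h1 : γ =ᶠ[𝓝 0] 0 := notMem_tsupport_iff_eventuallyEq.1 fun h => lt_irrefl _ (hs h).1
    obtain ⟨ε, hε, h2⟩ := Metric.eventually_nhds_iff_ball.1 h1
    refine ⟨ε, hε, fun s hsε => ?_⟩
    rcases le_or_gt s 0 with h | h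
    · by_contra hne
      exact absurd (hs (subset_tsupport _ hne)).1 (not_lt.2 h)
    · refine h2 s ?_
      rw [Metric.mem_ball, Real.dist_eq, sub_zero, abs_of_pos h]
      exact hsε
  have hz1 : ∀ s < ε, ∫ r in (0 : ℝ)..s, γ r = 0 := fun s hs =>
    intervalIntegral.integral_zero_ae (Eventually.of_forall fun r hr =>
      hγε r (hr.2.trans_lt (max_lt hε hs)))
  have hz2 : ∀ s < ε, β s = 0 := fun s hs =>
    intervalIntegral.integral_zero_ae (Eventually.of_forall fun r hr =>
      hz1 r (hr.2.trans_lt (max_lt hε hs)))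
  refine ⟨fun s => β s • k, ⟨(ContinuousLinearMap.toSpanSingleton ℝ k).contDiff.comp hs2, fun t => ?_, ε, hε, fun t ht => ?_⟩, ?_, ?_⟩
  · have h1 := (slOperator q).adjoint.graph.smul_mem ((β t : ℝ) : ℂ) hk
    rw [Prod.smul_mk, smul_zero, Complex.coe_smul] at h1
    exact h1
  · simp only [hz2 t ht, zero_smul]
  -- Cauchy's formula for the repeated integral `β(T)`.
  · have h1 : ∀ s ∈ uIcc 0 T, HasDerivAt (fun s => (T - s) * (∫ r in (0 : ℝ)..s, γ r) + β s)
        ((T - s) * γ s) s := by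
      intro s _
      have h2 : HasDerivAt (fun s => T - s) (-1) s := by
        simpa using (hasDerivAt_id s).const_sub T
      refine ((h2.mul (hd1 s)).add (hd2 s)).congr_deriv ?_
      ring
    have h2 := intervalIntegral.integral_eq_sub_of_hasDerivAt h1
      (((continuous_const.sub continuous_id).mul hγ.continuous).intervalIntegrable _ _)
    rw [h2]
    have h3 : β T • k = ((β T : ℝ) : ℂ) • k := (Complex.coe_smul _ _).symm
    simp [hz2 0 hε, h3]
  · intro s
    rw [iteratedDeriv_succ, iteratedDeriv_one, deriv_eq hdh]
    exact (hdh2 s).deriv.trans (Complex.coe_smul _ _).symm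

end Reachable

variable {q : ℝ → ℝ} {e d : ℝ → L2}

/-! ### Density of waves in `L₂(0, T)` -/

section Controllability

/-- For controls with `h'' = γ k` the orthogonality of `f` says that `γ` annihilates `(S(T - s) f,
k) - (T - s) (f, k)`. As `γ` is arbitrary in `(0, T)`, this function of `s` is zero, and oddness
covers negative times. -/
theorem inner_sineOperator_eq_of_orthogonal (hq : ContinuousOn q (Ici 0))
    (hpos : IsPositiveDefinite (slOperator q)) {T : ℝ≥0} {f k : L2}
    (hk : k ∈ defectSpace (slOperator q)) (hf : f ∈ (reachableSubspace (slOperator q) T)ᗮ) {t : ℝ}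
    (ht : |t| < T) : inner ℂ (sineOperator (slInverse q) t f) k = t * inner ℂ f k := by
  have hR := isPositive_slInverse hq hpos
  set F : ℝ → ℂ := fun s => inner ℂ (sineOperator (slInverse q) (T - s) f) k -
    ((T - s : ℝ) : ℂ) * inner ℂ f k with hF
  have hcS : Continuous fun s : ℝ => inner ℂ (sineOperator (slInverse q) (T - s) f) k :=
    ((continuous_sineOperator_apply hR f).comp (continuous_const.sub continuous_id)).inner
      continuous_const
  have hcT : Continuous fun s : ℝ => ((T - s : ℝ) : ℂ) * inner ℂ f k :=
    (Complex.continuous_ofReal.comp (continuous_const.sub continuous_id)).mul continuous_const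
  have hcF : Continuous F := hcS.sub hcT
  have h1 : ∀ᵐ s : ℝ, s ∈ Ioo (0 : ℝ) T → F s = 0 := by
    refine isOpen_Ioo.ae_eq_zero_of_integral_contDiff_smul_eq_zero
      (hcF.locallyIntegrable.locallyIntegrableOn _) fun γ hγ _ hs => ?_
    obtain ⟨h, hh, hT, h2⟩ := exists_control hk hγ hs
    have h3 : inner ℂ f (wave (slOperator q) h T) = 0 := by
      rw [← inner_conj_symm, hf _ (subset_closure (Submodule.subset_span ⟨h, hh, rfl⟩)), map_zero]
    have hcont : Continuous fun s : ℝ => sineOperator (slInverse q) (T - s) (iteratedDeriv 2 h s) := by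
      simp only [h2]
      exact ((continuous_sineOperator hR).comp (continuous_const.sub continuous_id)).clm_apply
        ((Complex.continuous_ofReal.comp hγ.continuous).smul continuous_const)
    have h4 := (innerSL ℂ f).intervalIntegral_comp_comm (hcont.intervalIntegrable (μ := volume) 0 T)
    simp only [innerSL_apply_apply, ← inner_sineOperator_left, h2,
      inner_smul_right] at h4
    rw [wave, inner_add_right, inner_neg_right, hT, inner_smul_right,
      ← intervalIntegral.integral_ofReal, ← intervalIntegral.integral_mul_const] at h3
    have h5 : inner ℂ f (duhamel (slInverse q) (iteratedDeriv 2 h) T) =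
        ∫ s in (0 : ℝ)..T, (γ s : ℂ) * inner ℂ (sineOperator (slInverse q) (T - s) f) k := by
      rw [duhamel]
      simp only [h2]
      exact h4.symm
    rw [neg_add_eq_zero] at h3
    replace h3 := sub_eq_zero.2 (h3.trans h5).symm
    rw [← intervalIntegral.integral_sub] at h3
    · rw [← intervalIntegral.integral_eq_integral_of_support_subset (a := 0) (b := T), ← h3]
      · refine intervalIntegral.integral_congr fun s _ => ?_
        simp only [hF, Complex.real_smul]
        push_cast
        ring
      · intro s hsupp
        have h6 : γ s ≠ 0 := fun h0 => hsupp (by simp [h0])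
        exact Ioo_subset_Ioc_self (hs (subset_tsupport _ h6))
    · exact ((Complex.continuous_ofReal.comp hγ.continuous).mul hcS).intervalIntegrable _ _
    · refine Continuous.intervalIntegrable ?_ _ _
      exact (Complex.continuous_ofReal.comp
        ((continuous_const.sub continuous_id).mul hγ.continuous)).mul continuous_const
  have h2 : EqOn F (fun _ => 0) (Ioo 0 T) :=
    Measure.eqOn_open_of_ae_eq ((ae_restrict_iff' measurableSet_Ioo).2 h1) isOpen_Ioo
      hcF.continuousOn continuousOn_const
  have h3 : ∀ t : ℝ, 0 < t → t < T →
      inner ℂ (sineOperator (slInverse q) t f) k = t * inner ℂ f k := by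
    intro t ht0 htT
    have h4 := h2 (x := T - t) ⟨by linarith, by linarith⟩
    simp only [hF, sub_sub_cancel] at h4
    exact sub_eq_zero.1 h4
  rcases lt_trichotomy t 0 with h | h | h
  · have h4 := h3 (-t) (by linarith) (by rwa [abs_of_neg h] at ht)
    rw [sineOperator_neg, neg_apply, inner_neg_left] at h4
    push_cast at h4
    linear_combination -h4
  · simp [h, sineOperator_zero]
  · exact h3 t h (by rwa [abs_of_pos h] at ht)

/-- Averaging over a window symmetric about `s` preserves linear functions of time; each factor
`S(h)` contributes `h`. -/
theorem inner_sineOperator_pow_eq {H : Type*} [NormedAddCommGroup H] [InnerProductSpace ℂ H]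
    [CompleteSpace H] {R : H →L[ℂ] H} (hR : R.IsPositive) {f k : H} {T h : ℝ} {c : ℂ} (hh : 0 ≤ h)
    (n : ℕ) (hf : ∀ s : ℝ, |s| < T → inner ℂ k (sineOperator R s f) = s * c) (s : ℝ)
    (hs : |s| < T - n * h) :
    inner ℂ k (sineOperator R s ((sineOperator R h ^ n) f)) = s * (h ^ n * c) := by
  induction n generalizing s with
  | zero =>
    have := hf s (by simpa using hs)
    simpa using this
  | succ n ih =>
    rw [pow_succ']
    change inner ℂ k (sineOperator R s (sineOperator R h ((sineOperator R h ^ n) f))) = _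
    rw [sineOperator_sineOperator_apply hR, ← Complex.coe_smul, inner_smul_right]
    have h1 := (innerSL ℂ k).intervalIntegral_comp_comm
      ((continuous_sineOperator_apply hR ((sineOperator R h ^ n) f)).intervalIntegrable
        (μ := volume) (s - h) (s + h))
    simp only [innerSL_apply_apply] at h1
    rw [← h1]
    have h2 : ∫ σ in (s - h)..(s + h), inner ℂ k (sineOperator R σ ((sineOperator R h ^ n) f)) =
        ∫ σ in (s - h)..(s + h), (σ : ℂ) * (h ^ n * c) := by
      refine intervalIntegral.integral_congr fun σ hσ => ih σ ?_
      rw [uIcc_of_le (by linarith)] at hσ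
      push_cast at hs
      have h2 : |σ| ≤ |s| + h := by
        rw [abs_le]
        constructor <;> linarith [neg_abs_le s, le_abs_self s, hσ.1, hσ.2]
      linarith
    rw [h2, intervalIntegral.integral_mul_const, intervalIntegral.integral_ofReal, integral_id]
    push_cast
    ring

/-- The second derivative of a linear function of time vanishes. -/
theorem inner_sineOperator_eq_zero_of_linear {H : Type*} [NormedAddCommGroup H]
    [InnerProductSpace ℂ H] [CompleteSpace H] {R : H →L[ℂ] H} (hR : R.IsPositive) {g k : H} {T : ℝ}
    {c : ℂ} (h : ∀ s : ℝ, |s| < T → inner ℂ k (R (sineOperator R s g)) = s * c) {s : ℝ}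
    (hs : |s| < T) : inner ℂ k (sineOperator R s g) = 0 := by
  have hev : ∀ {s : ℝ}, |s| < T → ∀ᶠ σ in 𝓝 s, |σ| < T := fun hs =>
    (isOpen_lt continuous_abs continuous_const).mem_nhds hs
  have hC : ∀ s : ℝ, |s| < T → inner ℂ k (cosineOperator R s g) = c := by
    intro s hs
    have h1 := (hasDerivAt_const s k).inner ℂ
      (hasDerivAt_operator_apply (hasDerivAt_mul_sineOperator hR s) g)
    have h2 : HasDerivAt (fun s : ℝ => (s : ℂ) * c) (1 * c) s :=
      (Complex.ofRealCLM.hasDerivAt (x := s)).mul_const c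
    have h3 := h1.unique (h2.congr_of_eventuallyEq ((hev hs).mono fun σ hσ => h σ hσ))
    simpa using h3
  have h1 := (hasDerivAt_const s k).inner ℂ
    (hasDerivAt_operator_apply (hasDerivAt_cosineOperator hR s) g)
  have h3 := h1.unique ((hasDerivAt_const s c).congr_of_eventuallyEq
    ((hev hs).mono fun σ hσ => hC σ hσ))
  simpa using h3

/-- The reachable subspaces consist of all functions that are supported in an interval. -/
theorem IsEvaluation.reachableSubspace_eq (he : IsEvaluation q e d)
    (hq : ContDiffOn ℝ (⊤ : ℕ∞) q (Ici 0)) (hpos : IsPositiveDefinite (slOperator q))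
    (hk : d 0 ∈ defectSpace (slOperator q)) (T : ℝ≥0) :
    reachableSubspace (slOperator q) T = subspaceOn (Iio (T : ℝ)) := by
  have hR := isPositive_slInverse hq.continuousOn hpos
  refine le_antisymm (he.reachableSubspace_le hq hpos T) (le_of_forall_orthogonal_mem fun f hf => ?_)
  rw [orthogonal_subspaceOn measurableSet_Iio]
  have hsym : ∀ x y : L2, inner ℂ (slInverse q x) y = inner ℂ x (slInverse q y) :=
    fun x y => hR.isSymmetric x y
  have h1 : f ∈ subspaceOn (Metric.ball (0 : ℝ) T)ᶜ := by
    refine he.mem_compl_ball_of_lateral hR (denseRange_slInverse hq.continuousOn hpos)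
      hq.continuousOn fun h hh g hg s hs => ⟨?_, ?_⟩
    -- The Dirichlet condition at `0` makes the first half of the Cauchy data vanish for every wave.
    · rw [waveField, he.apply_zero, map_zero, inner_zero_left]
    · rw [waveField, hsym, ← sineOperator_apply_comm hR, ← sineOperator_apply_comm hR]
      have h2 : ∀ s : ℝ, |s| < T →
          inner ℂ (d 0) (sineOperator (slInverse q) s f) = s * inner ℂ (d 0) f := by
        intro s hs
        rw [← inner_conj_symm, inner_sineOperator_eq_of_orthogonal hq.continuousOn hpos hk hf hs,
          map_mul, Complex.conj_ofReal, inner_conj_symm]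
      -- The pairing with `d 0` is linear in time for the smoothed wave `S(s) L⁻³ g`. Its second
      -- time derivative removes one `L⁻¹` and leaves the normal derivative of the field at `0`,
      -- which is therefore zero.
      refine inner_sineOperator_eq_zero_of_linear hR (T := T - 7 * h) (c := h ^ 7 * inner ℂ (d 0) f)
        (fun s hs => ?_) hs
      have h3 := inner_sineOperator_pow_eq hR hh.le 7 h2 s (by exact_mod_cast hs)
      rwa [hg, sineOperator_apply_comm hR] at h3
  refine mem_subspaceOn.2 ?_
  filter_upwards [mem_subspaceOn.1 h1, ae_restrict_mem measurableSet_Ioi] with x hx hx0 hxT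
  refine hx ?_
  rw [notMem_compl_iff, Metric.mem_ball, Real.dist_eq, sub_zero, abs_of_pos hx0]
  exact notMem_compl_iff.1 hxT

end Controllability

variable {q : ℝ → ℝ}

/-! ### Limits of the subspaces `L₂(E)` and the point atoms -/

section SubspaceOnLimits

theorem L2_norm_sq (f : L2) : ‖f‖ ^ 2 = ∫ x in Ioi (0 : ℝ), ‖f x‖ ^ 2 := by
  have h1 : ((‖f‖ ^ 2 : ℝ) : ℂ) = ((∫ x in Ioi (0 : ℝ), ‖f x‖ ^ 2 : ℝ) : ℂ) := by
    rw [← integral_complex_ofReal, Complex.ofReal_pow]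
    refine (inner_self_eq_norm_sq_to_K (𝕜 := ℂ) f).symm.trans ((L2_inner_eq f f).trans ?_)
    refine integral_congr_ae (Eventually.of_forall fun x => ?_)
    simp only
    rw [mul_comm, Complex.mul_conj, Complex.normSq_eq_norm_sq]
  exact_mod_cast h1

theorem integrable_norm_sq (f : L2) : Integrable (fun x => ‖f x‖ ^ 2) halfLine := by
  have := (Lp.memLp f).integrable_norm_pow (by norm_num)
  simpa using this

theorem tendsto_L2_of_dominated {F : ℕ → L2} {f g : L2} (hb : ∀ n, ∀ᵐ x ∂halfLine, ‖F n x - f x‖ ≤ ‖g x‖)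
    (hl : ∀ᵐ x ∂halfLine, Tendsto (fun n => F n x) atTop (𝓝 (f x))) :
    Tendsto F atTop (𝓝 f) := by
  have h1 : Tendsto (fun n => ‖F n - f‖ ^ 2) atTop (𝓝 0) := by
    have h2 : ∀ n, ‖F n - f‖ ^ 2 = ∫ x in Ioi (0 : ℝ), ‖F n x - f x‖ ^ 2 := by
      intro n
      rw [L2_norm_sq]
      refine integral_congr_ae ?_
      filter_upwards [Lp.coeFn_sub (F n) f] with x hx
      rw [hx, Pi.sub_apply]
    simp only [h2]
    suffices h : Tendsto (fun n => ∫ x in Ioi (0 : ℝ), ‖F n x - f x‖ ^ 2) atTop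
        (𝓝 (∫ _ in Ioi (0 : ℝ), (0 : ℝ))) by simpa using h
    refine tendsto_integral_of_dominated_convergence (fun x => ‖g x‖ ^ 2) (fun n => ?_)
      (integrable_norm_sq g) (fun n => ?_) ?_
    · exact (((Lp.aestronglyMeasurable (F n)).sub (Lp.aestronglyMeasurable f)).norm).pow 2
    · filter_upwards [hb n] with x hx
      rw [norm_pow, norm_norm]
      gcongr
    · filter_upwards [hl] with x hx
      have h3 := ((hx.sub_const (f x)).norm).pow 2
      simpa using h3
  rw [tendsto_iff_norm_sub_tendsto_zero]
  have h3 := h1.sqrt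
  simpa [Real.sqrt_sq] using h3

theorem tendsto_proj_subspaceOn {E : ℕ → Set ℝ} {F : Set ℝ} (hE : ∀ n, MeasurableSet (E n))
    (hF : MeasurableSet F) (h : ∀ᵐ x ∂halfLine, ∀ᶠ n in atTop, (x ∈ E n ↔ x ∈ F)) (y : L2) :
    Tendsto (fun n => proj (subspaceOn (E n)) y) atTop (𝓝 (proj (subspaceOn F) y)) := by
  simp only [proj_subspaceOn hF, fun n => proj_subspaceOn (hE n)]
  refine tendsto_L2_of_dominated (g := y) (fun n => ?_) ?_
  · filter_upwards [coeFn_restrictTo hF y, coeFn_restrictTo (hE n) y] with x h1 h2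
    rw [h1, h2]
    by_cases hx1 : x ∈ E n <;> by_cases hx2 : x ∈ F <;> simp [hx1, hx2]
  · filter_upwards [coeFn_restrictTo hF y, ae_all_iff.2 fun n => coeFn_restrictTo (hE n) y, h]
      with x h1 h2 h3
    refine tendsto_const_nhds.congr' ?_
    filter_upwards [h3] with n hn
    rw [h1, h2]
    by_cases hx : x ∈ F
    · rw [indicator_of_mem hx, indicator_of_mem (hn.2 hx)]
    · rw [indicator_of_notMem hx, indicator_of_notMem fun h => hx (hn.1 h)]

/-- The indicator of a subset of `E \ F` of finite positive measure would violate the inclusion. -/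
theorem null_diff_of_subspaceOn_le {E F : Set ℝ} (hE : MeasurableSet E) (hF : MeasurableSet F)
    (h : subspaceOn E ≤ subspaceOn F) : halfLine (E \ F) = 0 := by
  by_contra hne
  obtain ⟨s, hs, hsE, hs0, hst⟩ := Measure.exists_subset_measure_lt_top (hE.diff hF)
    (pos_iff_ne_zero.2 hne)
  have h1 : indicatorConstLp 2 hs hst.ne (1 : ℂ) ∈ subspaceOn E := by
    refine mem_subspaceOn.2 ?_
    filter_upwards [indicatorConstLp_coeFn (p := 2) (hs := hs) (hμs := hst.ne) (c := (1 : ℂ))]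
      with x hx hxE
    rw [hx, indicator_of_notMem fun h => hxE (hsE h).1]
  have h2 := mem_subspaceOn.1 (h h1)
  refine hs0.ne' (measure_eq_zero_iff_ae_notMem.2 ?_)
  filter_upwards [h2, indicatorConstLp_coeFn (p := 2) (hs := hs) (hμs := hst.ne) (c := (1 : ℂ))]
    with x h3 h4 hxs
  rw [h4, indicator_of_mem hxs] at h3
  exact one_ne_zero (h3 (hsE hxs).2)

theorem proj_eq_self_iff {H : Type*} [NormedAddCommGroup H] [InnerProductSpace ℂ H]
    [CompleteSpace H] {A : ClosedSubmodule ℂ H} {y : H} : proj A y = y ↔ y ∈ A :=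
  Submodule.starProjection_eq_self_iff

theorem halfLine_ball_ne_zero {x t : ℝ} (hx : 0 ≤ x) (ht : 0 < t) :
    halfLine (Metric.ball x t) ≠ 0 := by
  intro h
  have h1 : Ioo x (x + t) ⊆ Metric.ball x t ∩ Ioi 0 := fun s hs =>
    ⟨by rw [Metric.mem_ball, Real.dist_eq, abs_of_pos (sub_pos.2 hs.1)]; linarith [hs.2],
      hx.trans_lt hs.1⟩
  rw [Measure.restrict_apply' measurableSet_Ioi] at h
  have h2 := measure_mono_null h1 h
  rw [Real.volume_Ioo, add_sub_cancel_left, ENNReal.ofReal_eq_zero] at h2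
  linarith

theorem pointAtom_eq (x t : ℝ≥0) : pointAtom x t = subspaceOn (Metric.ball (x : ℝ) t) := by
  refine subspaceOn_congr ?_
  filter_upwards [ae_restrict_mem measurableSet_Ioi] with s hs
  exact ⟨fun h => h.2, fun h => ⟨le_of_lt hs, h⟩⟩

theorem pointAtom_ne_bot (x : ℝ≥0) : pointAtom x ≠ ⊥ := by
  intro h
  have h1 : subspaceOn (Metric.ball (x : ℝ) 1) ≤ subspaceOn ∅ := by
    have h2 := pointAtom_eq x 1
    rw [NNReal.coe_one] at h2
    rw [← h2, h]
    exact bot_le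
  have h2 := null_diff_of_subspaceOn_le Metric.isOpen_ball.measurableSet MeasurableSet.empty h1
  rw [sdiff_empty] at h2
  exact halfLine_ball_ne_zero x.coe_nonneg one_pos h2

/-- Balls of radius half the distance of the centres are disjoint. -/
theorem pointAtom_injective : Function.Injective pointAtom := by
  intro x x' h
  by_contra hne
  have hd : 0 < dist (x : ℝ) x' / 2 := half_pos (dist_pos.2 fun h => hne (NNReal.coe_injective h))
  lift dist (x : ℝ) x' / 2 to ℝ≥0 using hd.le with r hr
  have h1 := congrFun h r
  rw [pointAtom_eq, pointAtom_eq] at h1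
  have h2 := null_diff_of_subspaceOn_le Metric.isOpen_ball.measurableSet
    Metric.isOpen_ball.measurableSet h1.le
  have h3 : Metric.ball (x : ℝ) r ⊆ Metric.ball (x : ℝ) r \ Metric.ball (x' : ℝ) r := by
    intro s hs
    refine ⟨hs, fun hs' => ?_⟩
    have h3 := dist_triangle_left (x : ℝ) x' s
    have h4 : dist s x < r := hs
    have h5 : dist s x' < r := hs'
    linarith
  exact halfLine_ball_ne_zero x.coe_nonneg hd (measure_mono_null h3 h2)

end SubspaceOnLimits

variable {q : ℝ → ℝ}

/-! ### The lattice, its closure and the atoms -/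

section Spectrum

theorem exists_isEvaluation (hq : ContinuousOn q (Ici 0))
    (hpos : IsPositiveDefinite (slOperator q)) :
    ∃ e d, IsEvaluation q e d ∧ d 0 ∈ defectSpace (slOperator q) := by
  obtain ⟨e, d, h1, h2, h3, h4, h5⟩ := exists_evaluation hq hpos
  exact ⟨e, d, ⟨h1, h2, h3, h4⟩, h5⟩

theorem waveIsotony_subspaceOn (hq : ContDiffOn ℝ (⊤ : ℕ∞) q (Ici 0))
    (hpos : IsPositiveDefinite (slOperator q)) {E : Set ℝ} (hE : MeasurableSet E) {t : ℝ≥0}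
    (ht : 0 < t) : waveIsotony (slOperator q) t (subspaceOn E) =
      subspaceOn (Metric.thickening t (essSupport E)) := by
  obtain ⟨e, d, he, -⟩ := exists_isEvaluation hq.continuousOn hpos
  exact he.waveIsotony_subspaceOn hq hpos hE ht

theorem waveIsotony_zero {H : Type*} [NormedAddCommGroup H] [InnerProductSpace ℂ H]
    [CompleteSpace H] (L₀ : H →ₗ.[ℂ] H) (A : ClosedSubmodule ℂ H) : waveIsotony L₀ 0 A = A :=
  if_pos rfl

theorem reachableSubspace_eq (hq : ContDiffOn ℝ (⊤ : ℕ∞) q (Ici 0))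
    (hpos : IsPositiveDefinite (slOperator q)) (T : ℝ≥0) :
    reachableSubspace (slOperator q) T = subspaceOn (Iio (T : ℝ)) := by
  obtain ⟨e, d, he, hd⟩ := exists_isEvaluation hq.continuousOn hpos
  exact he.reachableSubspace_eq hq hpos hd T

/-- All generators are of this form, and each lattice operation, as well as the isotony, acts
through an operation on measurable sets. -/
theorem MemWaveLattice.exists_eq_subspaceOn (hq : ContDiffOn ℝ (⊤ : ℕ∞) q (Ici 0))
    (hpos : IsPositiveDefinite (slOperator q)) {A : ClosedSubmodule ℂ L2}
    (h : MemWaveLattice (slOperator q) A) : ∃ E, MeasurableSet E ∧ A = subspaceOn E := by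
  induction h with
  | reachable T => exact ⟨_, measurableSet_Iio, reachableSubspace_eq hq hpos T⟩
  | sup _ _ h1 h2 =>
    obtain ⟨E, hE, rfl⟩ := h1
    obtain ⟨F, hF, rfl⟩ := h2
    exact ⟨_, hE.union hF, sup_subspaceOn hE hF⟩
  | inf _ _ h1 h2 =>
    obtain ⟨E, hE, rfl⟩ := h1
    obtain ⟨F, hF, rfl⟩ := h2
    exact ⟨_, hE.inter hF, inf_subspaceOn E F⟩
  | orthogonal _ h1 =>
    obtain ⟨E, hE, rfl⟩ := h1
    exact ⟨_, hE.compl, orthogonal_subspaceOn hE⟩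
  | isotony t _ h1 =>
    obtain ⟨E, hE, rfl⟩ := h1
    rcases eq_or_lt_of_le (show 0 ≤ t from zero_le) with rfl | ht
    · exact ⟨E, hE, waveIsotony_zero _ _⟩
    · exact ⟨_, Metric.isOpen_thickening.measurableSet, waveIsotony_subspaceOn hq hpos hE ht⟩

theorem essSupport_nonneg {E : Set ℝ} {x : ℝ} (hx : x ∈ essSupport E) : 0 ≤ x := by
  by_contra! h
  refine hx (-x) (by linarith) ?_
  rw [Measure.restrict_apply' measurableSet_Ioi]
  have h1 : E ∩ Metric.ball x (-x) ∩ Ioi 0 = ∅ := by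
    ext s
    simp only [mem_inter_iff, Metric.mem_ball, mem_Ioi, mem_empty_iff_false, iff_false, Real.dist_eq]
    rintro ⟨⟨-, h1⟩, h2⟩
    linarith [le_abs_self (s - x)]
  rw [h1, measure_empty]

theorem essSupport_subset_closure (E : Set ℝ) : essSupport E ⊆ closure E := by
  intro x hx
  refine Metric.mem_closure_iff.2 fun ε hε => ?_
  obtain ⟨y, hy, hyx⟩ := nonempty_of_measure_ne_zero (hx ε hε)
  exact ⟨y, hy, by rw [dist_comm]; exact hyx⟩

theorem mem_essSupport_Ico {a b x : ℝ} (hx : 0 ≤ x) (ha : a ≤ x) (hb : x < b) :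
    x ∈ essSupport (Ico a b) := by
  intro ε hε h
  have h1 : Ioo x (min b (x + ε)) ⊆ Ico a b ∩ Metric.ball x ε ∩ Ioi 0 := fun s hs => by
    obtain ⟨h1, h2⟩ := hs
    rw [lt_min_iff] at h2
    refine ⟨⟨⟨ha.trans h1.le, h2.1⟩, ?_⟩, hx.trans_lt h1⟩
    rw [Metric.mem_ball, Real.dist_eq, abs_of_pos (sub_pos.2 h1)]
    linarith [h2.2]
  rw [Measure.restrict_apply' measurableSet_Ioi] at h
  have h2 := measure_mono_null h1 h
  rw [Real.volume_Ioo, ENNReal.ofReal_eq_zero, sub_nonpos] at h2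
  exact absurd h2 (not_le.2 (lt_min hb (by linarith)))

/-- Intervals shrinking to `x` are differences of two reachable intervals. Their `t`-neighbourhoods
converge to the `t`-ball off the null set `|s - x| = t`; at `t = 0` the intervals themselves shrink
to a null set, matching the empty ball. -/
theorem pointAtom_mem_waveFunctions (hq : ContDiffOn ℝ (⊤ : ℕ∞) q (Ici 0))
    (hpos : IsPositiveDefinite (slOperator q)) (x : ℝ≥0) :
    pointAtom x ∈ waveFunctions (slOperator q) := by
  set r : ℕ → ℝ≥0 := fun n => 1 / ((n : ℝ≥0) + 1) with hr
  have hr0 : ∀ n, (0 : ℝ) < r n := fun n => by simp only [hr]; positivity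
  have hrt : Tendsto (fun n => (r n : ℝ)) atTop (𝓝 0) := by
    have := tendsto_one_div_add_atTop_nhds_zero_nat (𝕜 := ℝ)
    refine this.congr fun n => ?_
    simp [hr]
  -- The subtraction is truncated at `0`, so that the left endpoint is an admissible time even for
  -- `x` near `0`.
  set E : ℕ → Set ℝ := fun n => Ico ((x - r n : ℝ≥0) : ℝ) ((x + r n : ℝ≥0) : ℝ) with hE
  have hA : ∀ n, MemWaveLattice (slOperator q) (subspaceOn (E n)) := by
    intro n
    have h1 := (MemWaveLattice.reachable (L₀ := slOperator q) (x + r n)).inf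
      (MemWaveLattice.reachable (x - r n)).orthogonal
    rw [reachableSubspace_eq hq hpos, reachableSubspace_eq hq hpos,
      orthogonal_subspaceOn measurableSet_Iio, inf_subspaceOn, compl_Iio, inter_comm,
      Ici_inter_Iio] at h1
    exact h1
  have hxE : ∀ n, (x : ℝ) ∈ essSupport (E n) := fun n =>
    mem_essSupport_Ico x.coe_nonneg (NNReal.coe_le_coe.2 tsub_le_self) (by
      rw [NNReal.coe_add]
      linarith [hr0 n])
  have hEr : ∀ n, E n ⊆ Metric.closedBall (x : ℝ) (r n) := by
    intro n s hs
    have h1 : (x : ℝ) - r n ≤ ((x - r n : ℝ≥0) : ℝ) := by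
      rw [NNReal.coe_sub_def]
      exact le_max_left _ _
    obtain ⟨h2, h3⟩ := hs
    rw [NNReal.coe_add] at h3
    rw [Metric.mem_closedBall, Real.dist_eq, abs_le]
    constructor <;> linarith
  refine ⟨fun n => subspaceOn (E n), hA, fun t y => ?_⟩
  rw [pointAtom_eq]
  have hae : ∀ᵐ s : ℝ ∂halfLine, dist s x ≠ t := by
    refine ae_restrict_of_ae ?_
    rw [ae_iff]
    refine measure_mono_null (t := {(x : ℝ) + t, (x : ℝ) - t}) (fun s hs => ?_)
      (Set.Finite.measure_zero (by simp) _)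
    rw [Set.mem_ofPred_eq, not_not, Real.dist_eq] at hs
    rcases abs_cases (s - x) with h | h
    · left; linarith
    · right; rw [mem_singleton_iff]; linarith
  rcases eq_or_lt_of_le (show 0 ≤ t from zero_le) with rfl | ht
  · simp only [waveIsotony_zero]
    refine tendsto_proj_subspaceOn (fun n => measurableSet_Ico) Metric.isOpen_ball.measurableSet ?_ y
    filter_upwards [hae] with s hs
    have hs0 : 0 < dist s x := lt_of_le_of_ne dist_nonneg hs.symm
    filter_upwards [hrt.eventually (gt_mem_nhds hs0)] with n hn
    simp only [NNReal.coe_zero, Metric.ball_zero, mem_empty_iff_false, iff_false]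
    intro h
    exact absurd (hEr n h) (not_le.2 hn)
  · simp only [waveIsotony_subspaceOn hq hpos measurableSet_Ico ht, hE]
    refine tendsto_proj_subspaceOn (fun n => Metric.isOpen_thickening.measurableSet)
      Metric.isOpen_ball.measurableSet ?_ y
    filter_upwards [hae] with s hs
    rcases lt_or_gt_of_ne hs with h | h
    · refine Eventually.of_forall fun n => ⟨fun _ => h, fun _ => ?_⟩
      exact Metric.mem_thickening_iff.2 ⟨x, hxE n, h⟩
    · filter_upwards [hrt.eventually (gt_mem_nhds (sub_pos.2 h))] with n hn
      refine ⟨fun hth => ?_, fun hb => absurd hb (not_lt.2 h.le)⟩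
      obtain ⟨z, hz, hsz⟩ := Metric.mem_thickening_iff.1 hth
      have hz2 : z ∈ Metric.closedBall (x : ℝ) (r n) :=
        closure_minimal (hEr n) Metric.isClosed_closedBall (essSupport_subset_closure _ hz)
      rw [Metric.mem_closedBall] at hz2
      exfalso
      linarith [dist_triangle s z x]

theorem measure_ne_zero_of_proj_ne_zero {E F : Set ℝ} {y : L2}
    (h : proj (subspaceOn F) (proj (subspaceOn E) y) ≠ 0) : halfLine (E ∩ F) ≠ 0 := by
  intro h0
  refine h ((Submodule.starProjection_apply_eq_zero_iff _).2 fun w hw => ?_)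
  have h1 : proj (subspaceOn E) y ∈ subspaceOn E := Submodule.starProjection_apply_mem _ _
  exact inner_eq_zero_of_mem_compl hw (mem_subspaceOn_compl_of_null h1 h0)

/-- Every non-zero element of the closure contains a point atom. -/
theorem exists_pointAtom_le (hq : ContDiffOn ℝ (⊤ : ℕ∞) q (Ici 0))
    (hpos : IsPositiveDefinite (slOperator q)) {ω : ℝ≥0 → ClosedSubmodule ℂ L2}
    (hω : ω ∈ waveFunctions (slOperator q)) (hne : ω ≠ ⊥) : ∃ x : ℝ≥0, pointAtom x ≤ ω := by
  obtain ⟨A, hA, hlim⟩ := hω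
  choose E hE hAE using fun n => (hA n).exists_eq_subspaceOn hq hpos
  simp only [hAE] at hlim
  obtain ⟨t₀, ht₀⟩ : ∃ t, ω t ≠ ⊥ := by
    by_contra! h
    exact hne (funext h)
  obtain ⟨y, hy, hy0⟩ : ∃ y ∈ ω t₀, y ≠ 0 := by
    by_contra! h
    refine ht₀ (eq_bot_iff.2 fun y hy => ?_)
    rw [h y hy]
    exact (⊥ : ClosedSubmodule ℂ L2).zero_mem
  -- A non-zero element has mass in some bounded interval; this keeps the points chosen below from
  -- escaping to infinity.
  obtain ⟨M, hM⟩ : ∃ M : ℕ, proj (subspaceOn (Iio (M : ℝ))) y ≠ 0 := by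
    by_contra! h
    have h1 := tendsto_proj_subspaceOn (E := fun M : ℕ => Iio (M : ℝ)) (F := univ)
      (fun _ => measurableSet_Iio) MeasurableSet.univ (Eventually.of_forall fun x => by
        obtain ⟨N, hN⟩ := exists_nat_gt x
        filter_upwards [eventually_ge_atTop N] with n hn
        simp only [mem_Iio, mem_univ, iff_true]
        exact hN.trans_le (Nat.cast_le.2 hn)) y
    simp only [h] at h1
    have h2 : y ∈ subspaceOn univ := mem_subspaceOn.2 (Eventually.of_forall fun x hx =>
      absurd (mem_univ x) hx)
    rw [proj_eq_self_iff.2 h2] at h1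
    exact hy0 (tendsto_nhds_unique h1 tendsto_const_nhds)
  -- By strong convergence the subspaces at time `t₀` eventually meet `(0, M)`, so some essential
  -- support point lies within `t₀` of that interval.
  have hev : ∀ᶠ n in atTop, ∃ x ∈ essSupport (E n), x ∈ Icc (0 : ℝ) (M + t₀) := by
    have h1 := ((proj (subspaceOn (Iio (M : ℝ)))).continuous.tendsto _).comp (hlim t₀ y)
    rw [proj_eq_self_iff.2 hy] at h1
    filter_upwards [h1.eventually_ne hM] with n hn
    rcases eq_or_lt_of_le (show 0 ≤ t₀ from zero_le) with h0 | h0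
    · simp only [← h0, Function.comp_apply, waveIsotony_zero] at hn
      obtain ⟨x, hx, hxs⟩ := exists_mem_essSupport (measure_ne_zero_of_proj_ne_zero hn)
      refine ⟨x, essSupport_mono inter_subset_left hxs, essSupport_nonneg hxs, ?_⟩
      linarith [t₀.coe_nonneg, mem_Iio.1 hx.2]
    · simp only [Function.comp_apply, waveIsotony_subspaceOn hq hpos (hE n) h0] at hn
      obtain ⟨z, hz1, hz2⟩ := nonempty_of_measure_ne_zero (measure_ne_zero_of_proj_ne_zero hn)
      obtain ⟨x, hx, hzx⟩ := Metric.mem_thickening_iff.1 hz1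
      refine ⟨x, hx, essSupport_nonneg hx, ?_⟩
      rw [Real.dist_eq] at hzx
      linarith [neg_abs_le (z - x), mem_Iio.1 hz2]
  obtain ⟨x, hx⟩ : ∃ x : ℕ → ℝ, ∀ᶠ n in atTop,
      x n ∈ essSupport (E n) ∧ x n ∈ Icc (0 : ℝ) (M + t₀) := by
    have h1 : ∀ n, ∃ x, (∃ x ∈ essSupport (E n), x ∈ Icc (0 : ℝ) (M + t₀)) →
        x ∈ essSupport (E n) ∧ x ∈ Icc (0 : ℝ) (M + t₀) := fun n => by
      by_cases h : ∃ x ∈ essSupport (E n), x ∈ Icc (0 : ℝ) (M + t₀)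
      · obtain ⟨x, hx⟩ := h
        exact ⟨x, fun _ => hx⟩
      · exact ⟨0, fun h' => absurd h' h⟩
    choose x hx using h1
    exact ⟨x, hev.mono fun n hn => hx n hn⟩
  obtain ⟨a, ha, φ, hφ, hxa⟩ := isCompact_Icc.tendsto_subseq' (hx.mono fun n h => h.2).frequently
  refine ⟨⟨a, ha.1⟩, fun t y hy => ?_⟩
  replace hy : y ∈ subspaceOn (Metric.ball a t) := (pointAtom_eq (⟨a, ha.1⟩ : ℝ≥0) t).le hy
  -- Along the subsequence `x (φ n) → a`, the ball of radius `t' < t` about `a` eventually lies in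
  -- the `t`-neighbourhood of the essential support. At `t = 0` the ball is empty.
  have hin : ∀ t' < (t : ℝ), proj (subspaceOn (Metric.ball a t')) y ∈ ω t := by
    intro t' ht'
    rcases eq_or_lt_of_le (show 0 ≤ t from zero_le) with h0 | h0
    · have h1 : Metric.ball a t' = ∅ := Metric.ball_eq_empty.2 (by
        rw [← h0] at ht'
        exact ht'.le)
      rw [h1, proj_subspaceOn MeasurableSet.empty]
      have h2 : restrictTo MeasurableSet.empty y = 0 := by
        rw [← proj_subspaceOn]
        by_contra hne
        have h3 := measure_ne_zero_of_proj_ne_zero (E := univ) (F := ∅) (y := y) (by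
          rwa [proj_eq_self_iff.2 (mem_subspaceOn.2 (Eventually.of_forall fun x hx =>
            absurd (mem_univ x) hx))])
        simp at h3
      rw [h2]
      exact (ω t).zero_mem
    · set y' := proj (subspaceOn (Metric.ball a t')) y with hy'
      have hy'm : y' ∈ subspaceOn (Metric.ball a t') := Submodule.starProjection_apply_mem _ _
      have h1 := (hlim t y').comp hφ.tendsto_atTop
      refine proj_eq_self_iff.1 (tendsto_nhds_unique h1 (tendsto_const_nhds.congr' ?_))
      filter_upwards [hφ.tendsto_atTop.eventually hx,
        hxa.eventually (Metric.ball_mem_nhds a (sub_pos.2 ht'))] with n hn hn2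
      rw [Function.comp_apply, waveIsotony_subspaceOn hq hpos (hE _) h0]
      refine (proj_eq_self_iff.2 (subspaceOn_mono (Eventually.of_forall fun s hs => ?_) hy'm)).symm
      refine Metric.mem_thickening_iff.2 ⟨_, hn.1, ?_⟩
      rw [Metric.mem_ball] at hs
      have h3 : dist (x (φ n)) a < t - t' := hn2
      linarith [dist_triangle_right s (x (φ n)) a]
  -- Let `t'` increase to `t`: the smaller balls exhaust the open ball, and `ω t` is closed.
  have hlim2 := tendsto_proj_subspaceOn (E := fun n : ℕ => Metric.ball a (t - 1 / ((n : ℝ) + 1)))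
    (F := Metric.ball a t) (fun n => Metric.isOpen_ball.measurableSet)
    Metric.isOpen_ball.measurableSet (Eventually.of_forall fun s => by
      by_cases hs : s ∈ Metric.ball a t
      · filter_upwards [(tendsto_one_div_add_atTop_nhds_zero_nat (𝕜 := ℝ)).eventually
          (gt_mem_nhds (sub_pos.2 (Metric.mem_ball.1 hs)))] with n hn
        refine ⟨fun _ => hs, fun _ => ?_⟩
        rw [Metric.mem_ball]
        linarith
      · refine Eventually.of_forall fun n => ⟨fun h => ?_, fun h => absurd h hs⟩
        refine Metric.ball_subset_ball ?_ h
        have : (0 : ℝ) < 1 / ((n : ℝ) + 1) := by positivity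
        linarith) y
  rw [proj_eq_self_iff.2 hy] at hlim2
  refine (ω t).isClosed'.mem_of_tendsto hlim2 (Eventually.of_forall fun n => hin _ ?_)
  have : (0 : ℝ) < 1 / ((n : ℝ) + 1) := by positivity
  linarith

/-- The atoms are exactly the functions `pointAtom x`. -/
theorem existsUnique_pointAtom_eq (hq : ContDiffOn ℝ (⊤ : ℕ∞) q (Ici 0))
    (hpos : IsPositiveDefinite (slOperator q)) {ω : ℝ≥0 → ClosedSubmodule ℂ L2}
    (hω : ω ∈ waveSpectrum (slOperator q)) : ∃ x : ℝ≥0, ∀ x', pointAtom x' = ω ↔ x' = x := by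
  obtain ⟨h1, h2, h3⟩ := hω
  obtain ⟨x, hx⟩ := exists_pointAtom_le hq hpos h1 h2
  have h4 := h3 _ (pointAtom_mem_waveFunctions hq hpos x) (pointAtom_ne_bot x) hx
  exact ⟨x, fun x' => ⟨fun h => pointAtom_injective (h.trans h4.symm), fun h => h ▸ h4⟩⟩

end Spectrum

/-! ### The eikonal as multiplication by the distance -/

section Eikonal

variable {x₀ : ℝ≥0}

/-- The product of `y` and the distance to `x₀`, cut off at distance `T`. -/
def truncMul (x₀ T : ℝ≥0) (y : L2) : L2 :=
  MemLp.toLp (fun x => (Metric.ball (x₀ : ℝ) T).indicator (fun x => ((dist x x₀ : ℝ) : ℂ) * y x) x)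
    ((Lp.memLp y).of_le_mul (c := T)
      (AEStronglyMeasurable.indicator ((Complex.continuous_ofReal.comp (continuous_id.dist
        continuous_const)).aestronglyMeasurable.mul (Lp.aestronglyMeasurable y))
          Metric.isOpen_ball.measurableSet)
      (Eventually.of_forall fun x => by
        by_cases hx : x ∈ Metric.ball (x₀ : ℝ) T
        · rw [indicator_of_mem hx, norm_mul, Complex.norm_real, Real.norm_of_nonneg dist_nonneg]
          exact mul_le_mul_of_nonneg_right (le_of_lt hx) (norm_nonneg _)
        · rw [indicator_of_notMem hx, norm_zero]
          positivity))

theorem coeFn_truncMul (x₀ T : ℝ≥0) (y : L2) : truncMul x₀ T y =ᵐ[halfLine]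
    (Metric.ball (x₀ : ℝ) T).indicator fun x => ((dist x x₀ : ℝ) : ℂ) * y x :=
  MemLp.coeFn_toLp _

/-- As a function of `t` the indicator of `ρ < t` jumps once. The sum therefore keeps at most one
`sᵢ`, from the subinterval containing `ρ`, and it differs from `ρ` by at most the mesh. The
estimates of the single terms telescope. -/
theorem abs_sum_sub_le {t s : ℕ → ℝ} {n : ℕ} {δ ρ : ℝ} (hδ : 0 ≤ δ) (h0 : t 0 ≤ ρ)
    (h : ∀ i < n, t i ≤ s i ∧ s i ≤ t (i + 1) ∧ t (i + 1) - t i ≤ δ) :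
    |∑ i ∈ Finset.range n, s i * ((Iio (t (i + 1))).indicator 1 ρ - (Iio (t i)).indicator 1 ρ) -
      ρ * (Iio (t n)).indicator 1 ρ| ≤ δ := by
  have h1 : ρ * (Iio (t n)).indicator 1 ρ = ∑ i ∈ Finset.range n,
      ρ * ((Iio (t (i + 1))).indicator 1 ρ - (Iio (t i)).indicator 1 ρ) := by
    rw [← Finset.mul_sum, Finset.sum_range_sub (fun i => (Iio (t i)).indicator (1 : ℝ → ℝ) ρ),
      indicator_of_notMem (s := Iio (t 0)) (not_lt.2 h0), sub_zero]
  rw [h1, ← Finset.sum_sub_distrib]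
  have h2 : ∀ i ∈ Finset.range n,
      |s i * ((Iio (t (i + 1))).indicator 1 ρ - (Iio (t i)).indicator 1 ρ) -
        ρ * ((Iio (t (i + 1))).indicator 1 ρ - (Iio (t i)).indicator 1 ρ)| ≤
      δ * ((Iio (t (i + 1))).indicator 1 ρ - (Iio (t i)).indicator 1 ρ) := by
    intro i hi
    obtain ⟨a, b, c⟩ := h i (Finset.mem_range.1 hi)
    by_cases h3 : ρ < t (i + 1) <;> by_cases h4 : ρ < t i
    · simp [h3, h4]
    · simp only [mem_Iio, h3, h4, indicator_of_mem, indicator_of_notMem, not_false_eq_true,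
        Pi.one_apply, sub_zero, mul_one]
      rw [abs_le]
      constructor <;> linarith
    · linarith
    · simp [h3, h4]
  refine (Finset.abs_sum_le_sum_abs _ _).trans ((Finset.sum_le_sum h2).trans ?_)
  rw [← Finset.mul_sum, Finset.sum_range_sub (fun i => (Iio (t i)).indicator (1 : ℝ → ℝ) ρ),
    indicator_of_notMem (s := Iio (t 0)) (not_lt.2 h0), sub_zero]
  refine mul_le_of_le_one_right hδ ?_
  exact indicator_le_self' (fun _ _ => zero_le_one) ρ

theorem coeFn_sum_stieltjes (t s : ℕ → ℝ≥0) (n : ℕ) (y : L2) :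
    ∀ᵐ x ∂halfLine, (∑ i ∈ Finset.range n, ((s i : ℝ) : ℂ) •
      (proj (pointAtom x₀ (t (i + 1))) y - proj (pointAtom x₀ (t i)) y) : L2) x =
      ((∑ i ∈ Finset.range n, (s i : ℝ) * ((Iio (t (i + 1) : ℝ)).indicator 1 (dist x x₀) -
        (Iio (t i : ℝ)).indicator 1 (dist x x₀)) : ℝ) : ℂ) * y x := by
  have hp : ∀ r : ℝ≥0, ∀ᵐ x ∂halfLine, proj (pointAtom x₀ r) y x =
      (((Iio (r : ℝ)).indicator 1 (dist x x₀) : ℝ) : ℂ) * y x := by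
    intro r
    rw [pointAtom_eq, proj_subspaceOn Metric.isOpen_ball.measurableSet]
    filter_upwards [coeFn_restrictTo (Metric.isOpen_ball (x := (x₀ : ℝ)) (ε := r)).measurableSet y]
      with x hx
    rw [hx]
    by_cases h : dist x x₀ < r
    · rw [indicator_of_mem (Metric.mem_ball.2 h), indicator_of_mem (mem_Iio.2 h)]
      simp
    · rw [indicator_of_notMem (fun h' => h (Metric.mem_ball.1 h')), indicator_of_notMem (s := Iio (r : ℝ)) h]
      simp
  induction n with
  | zero =>
    filter_upwards [Lp.coeFn_zero ℂ 2 halfLine] with x hx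
    simpa using hx
  | succ n ih =>
    simp only [Finset.sum_range_succ]
    filter_upwards [ih, Lp.coeFn_add (∑ i ∈ Finset.range n, ((s i : ℝ) : ℂ) •
      (proj (pointAtom x₀ (t (i + 1))) y - proj (pointAtom x₀ (t i)) y)) (((s n : ℝ) : ℂ) •
      (proj (pointAtom x₀ (t (n + 1))) y - proj (pointAtom x₀ (t n)) y)),
      Lp.coeFn_smul ((s n : ℝ) : ℂ)
        (proj (pointAtom x₀ (t (n + 1))) y - proj (pointAtom x₀ (t n)) y),
      Lp.coeFn_sub (proj (pointAtom x₀ (t (n + 1))) y) (proj (pointAtom x₀ (t n)) y),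
      hp (t (n + 1)), hp (t n)] with x h1 h2 h3 h4 h5 h6
    rw [h2, Pi.add_apply, h1, h3, Pi.smul_apply, h4, Pi.sub_apply, h5, h6, smul_eq_mul]
    push_cast
    ring

/-- The scalar estimate holds at almost every point with the same mesh, hence in norm with error at
most `δ ‖y‖`. -/
theorem isStieltjesIntegral_truncMul (x₀ T : ℝ≥0) (y : L2) :
    IsStieltjesIntegral (fun t => proj (pointAtom x₀ t) y) T (truncMul x₀ T y) := by
  intro ε hε
  have hy : 0 < ‖y‖ + 1 := by positivity
  refine ⟨ε / (‖y‖ + 1), by positivity, fun n t s h0 hn h => ?_⟩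
  have h1 : ε / (‖y‖ + 1) * ‖y‖ ≤ ε := by
    rw [div_mul_eq_mul_div, div_le_iff₀ hy]
    nlinarith
  refine le_trans (Lp.norm_le_mul_norm_of_ae_le_mul (c := ε / (‖y‖ + 1)) (g := y) ?_) h1
  filter_upwards [coeFn_sum_stieltjes (x₀ := x₀) t s n y, coeFn_truncMul x₀ T y,
    Lp.coeFn_sub (∑ i ∈ Finset.range n, ((s i : ℝ) : ℂ) •
      (proj (pointAtom x₀ (t (i + 1))) y - proj (pointAtom x₀ (t i)) y)) (truncMul x₀ T y)]
    with x h2 h3 h4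
  rw [h4, Pi.sub_apply, h2, h3]
  have h5 := abs_sum_sub_le (t := fun i => (t i : ℝ)) (s := fun i => (s i : ℝ)) (n := n)
    (δ := ε / (‖y‖ + 1)) (ρ := dist x x₀) (by positivity) (by simp [h0, dist_nonneg])
    fun i hi => by
      obtain ⟨a, b, c⟩ := h i hi
      exact ⟨by exact_mod_cast a, by exact_mod_cast b, c⟩
  have h6 : (Metric.ball (x₀ : ℝ) T).indicator (fun x => ((dist x x₀ : ℝ) : ℂ) * y x) x =
      ((dist x x₀ * (Iio (t n : ℝ)).indicator 1 (dist x x₀) : ℝ) : ℂ) * y x := by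
    rw [hn]
    by_cases h : dist x x₀ < T
    · rw [indicator_of_mem (Metric.mem_ball.2 h), indicator_of_mem (mem_Iio.2 h)]
      simp
    · rw [indicator_of_notMem (fun h' => h (Metric.mem_ball.1 h')), indicator_of_notMem (s := Iio (T : ℝ)) h]
      simp
  rw [h6, ← sub_mul, ← Complex.ofReal_sub, norm_mul, Complex.norm_real]
  exact mul_le_mul_of_nonneg_right h5 (norm_nonneg _)

/-- The integrals over `[0, T]` are the truncated products. If they converge, an almost everywhere
convergent subsequence identifies the limit, as the truncation is eventually inactive at each point.
Conversely, the truncated products are the projections of `z = |x - x₀| y` onto growing balls. -/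
theorem mem_eikonalGraph_iff {p : L2 × L2} : p ∈ eikonalGraph (pointAtom x₀) ↔
    ∀ᵐ x ∂halfLine, p.2 x = ((dist x x₀ : ℝ) : ℂ) * p.1 x := by
  constructor
  · rintro ⟨Z, hZ, hl⟩
    have h1 : ∀ T, Z T = truncMul x₀ T p.1 := fun T =>
      (hZ T).unique (isStieltjesIntegral_truncMul x₀ T p.1)
    have h2 : Tendsto (fun n : ℕ => Z n) atTop (𝓝 p.2) := hl.comp tendsto_natCast_atTop_atTop
    obtain ⟨ns, hns, h3⟩ := (tendstoInMeasure_of_tendsto_Lp h2).exists_seq_tendsto_ae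
    filter_upwards [h3, ae_all_iff.2 fun n : ℕ => coeFn_truncMul x₀ n p.1] with x h4 h5
    refine tendsto_nhds_unique h4 (tendsto_const_nhds.congr' ?_)
    obtain ⟨N, hN⟩ := exists_nat_gt (dist x x₀)
    filter_upwards [hns.tendsto_atTop.eventually (eventually_ge_atTop N)] with n hn
    rw [h1, h5, indicator_of_mem]
    rw [Metric.mem_ball, NNReal.coe_natCast]
    exact hN.trans_le (Nat.cast_le.2 hn)
  · intro h
    refine ⟨fun T => truncMul x₀ T p.1, fun T => isStieltjesIntegral_truncMul x₀ T p.1, ?_⟩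
    have h1 : ∀ T, truncMul x₀ T p.1 = proj (subspaceOn (Metric.ball (x₀ : ℝ) T)) p.2 := by
      intro T
      rw [proj_subspaceOn Metric.isOpen_ball.measurableSet]
      refine Lp.ext ?_
      filter_upwards [coeFn_truncMul x₀ T p.1,
        coeFn_restrictTo (Metric.isOpen_ball (x := (x₀ : ℝ)) (ε := T)).measurableSet p.2, h]
        with x h1 h2 h3
      rw [h1, h2]
      by_cases hx : x ∈ Metric.ball (x₀ : ℝ) T
      · rw [indicator_of_mem hx, indicator_of_mem hx, h3]
      · rw [indicator_of_notMem hx, indicator_of_notMem hx]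
    simp only [h1]
    refine tendsto_of_seq_tendsto fun u hu => ?_
    have h2 := tendsto_proj_subspaceOn (E := fun n => Metric.ball (x₀ : ℝ) (u n)) (F := univ)
      (fun n => Metric.isOpen_ball.measurableSet) MeasurableSet.univ (Eventually.of_forall fun x => by
        filter_upwards [hu.eventually (eventually_gt_atTop (⟨dist x x₀, dist_nonneg⟩ : ℝ≥0))]
          with n hn
        simp only [mem_univ, iff_true]
        exact hn) p.2
    rwa [proj_eq_self_iff.2 (mem_subspaceOn.2 (Eventually.of_forall fun x hx =>
      absurd (mem_univ x) hx))] at h2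

theorem eikonal_graph (ω : ℝ≥0 → ClosedSubmodule ℂ L2) : (eikonal ω).graph = eikonalGraph ω :=
  Submodule.toLinearPMap_graph_eq _ (eikonalGraph_functional ω)

theorem eikonal_pointAtom_ae (y : (eikonal (pointAtom x₀)).domain) :
    ∀ᵐ x ∂halfLine, eikonal (pointAtom x₀) y x = ((dist x x₀ : ℝ) : ℂ) * (y : L2) x := by
  have h1 := LinearPMap.mem_graph _ y
  rw [eikonal_graph] at h1
  exact mem_eikonalGraph_iff.1 h1

/-- The weights are comparable for `y ∈ L₂`: `(1 + x)² ≤ 2 (x - x₀)² + 2 (1 + x₀)²` and `|x - x₀| ≤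
(1 + x₀)(1 + x)`. Hence the domain does not depend on `x₀`. -/
theorem mem_eikonal_domain_iff (y : L2) : y ∈ (eikonal (pointAtom x₀)).domain ↔
    IntegrableOn (fun x : ℝ => (1 + x) ^ 2 * ‖y x‖ ^ 2) (Ioi 0) := by
  have hm : AEStronglyMeasurable (fun x : ℝ => ((dist x x₀ : ℝ) : ℂ) * y x) halfLine :=
    (Complex.continuous_ofReal.comp (continuous_id.dist continuous_const)).aestronglyMeasurable.mul
      (Lp.aestronglyMeasurable y)
  have hm' : AEStronglyMeasurable (fun x : ℝ => (1 + x) ^ 2 * ‖y x‖ ^ 2) halfLine :=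
    ((continuous_const.add continuous_id).pow 2).aestronglyMeasurable.mul
      ((Lp.aestronglyMeasurable y).norm.pow 2)
  rw [LinearPMap.mem_domain_iff, eikonal_graph]
  constructor
  · rintro ⟨z, hz⟩
    refine (((integrable_norm_sq z).const_mul 2).add
      ((integrable_norm_sq y).const_mul (2 * (1 + (x₀ : ℝ)) ^ 2))).mono' hm' ?_
    filter_upwards [mem_eikonalGraph_iff.1 hz, ae_restrict_mem measurableSet_Ioi] with x hx hx0
    simp only [Pi.add_apply]
    rw [Real.norm_of_nonneg (by positivity), hx, norm_mul, Complex.norm_real,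
      Real.norm_of_nonneg dist_nonneg, Real.dist_eq, mul_pow, sq_abs, ← mul_assoc, ← add_mul]
    refine mul_le_mul_of_nonneg_right ?_ (by positivity)
    nlinarith [sq_nonneg ((x - x₀) - (1 + x₀))]
  · intro h
    have h1 : MemLp (fun x : ℝ => ((dist x x₀ : ℝ) : ℂ) * y x) 2 halfLine := by
      rw [memLp_two_iff_integrable_sq_norm hm]
      refine (h.const_mul ((1 + (x₀ : ℝ)) ^ 2)).mono' (hm.norm.pow 2) ?_
      filter_upwards [ae_restrict_mem measurableSet_Ioi] with x hx
      have hx' : 0 < x := hx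
      have h2 : dist x x₀ ≤ (1 + x₀) * (1 + x) := by
        rw [Real.dist_eq, abs_le]
        constructor <;> nlinarith [x₀.coe_nonneg, mul_nonneg x₀.coe_nonneg hx'.le]
      rw [Real.norm_of_nonneg (by positivity), norm_mul, Complex.norm_real,
        Real.norm_of_nonneg dist_nonneg]
      calc (dist x x₀ * ‖y x‖) ^ 2 ≤ ((1 + x₀) * (1 + x) * ‖y x‖) ^ 2 := by gcongr
        _ = _ := by ring
    refine ⟨h1.toLp _, mem_eikonalGraph_iff.2 ?_⟩
    exact h1.coeFn_toLp

theorem truncMul_mem_eikonalGraph (T : ℝ≥0) (y : L2) :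
    (proj (subspaceOn (Metric.ball (x₀ : ℝ) T)) y, truncMul x₀ T y) ∈
      eikonalGraph (pointAtom x₀) := by
  refine mem_eikonalGraph_iff.2 ?_
  rw [proj_subspaceOn Metric.isOpen_ball.measurableSet]
  filter_upwards [coeFn_truncMul x₀ T y,
    coeFn_restrictTo (Metric.isOpen_ball (x := (x₀ : ℝ)) (ε := T)).measurableSet y] with x h1 h2
  rw [h1, h2]
  by_cases hx : x ∈ Metric.ball (x₀ : ℝ) T
  · rw [indicator_of_mem hx, indicator_of_mem hx]
  · rw [indicator_of_notMem hx, indicator_of_notMem hx, mul_zero]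

theorem tendsto_proj_ball (y : L2) : Tendsto
    (fun n : ℕ => proj (subspaceOn (Metric.ball (x₀ : ℝ) (n : ℝ≥0))) y) atTop (𝓝 y) := by
  have h1 := tendsto_proj_subspaceOn (E := fun n : ℕ => Metric.ball (x₀ : ℝ) (n : ℝ≥0))
    (F := univ) (fun n => Metric.isOpen_ball.measurableSet) MeasurableSet.univ
    (Eventually.of_forall fun x => by
      obtain ⟨N, hN⟩ := exists_nat_gt (dist x x₀)
      filter_upwards [eventually_ge_atTop N] with n hn
      simp only [mem_univ, iff_true]
      rw [Metric.mem_ball, NNReal.coe_natCast]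
      exact hN.trans_le (Nat.cast_le.2 hn)) y
  rwa [proj_eq_self_iff.2 (mem_subspaceOn.2 (Eventually.of_forall fun x hx =>
    absurd (mem_univ x) hx))] at h1

theorem dense_domain_eikonal : Dense ((eikonal (pointAtom x₀)).domain : Set L2) := by
  intro y
  refine mem_closure_of_tendsto (tendsto_proj_ball (x₀ := x₀) y) (Eventually.of_forall fun n => ?_)
  refine LinearPMap.mem_domain_iff.2 ⟨truncMul x₀ n y, ?_⟩
  rw [eikonal_graph]
  exact truncMul_mem_eikonalGraph _ y

theorem inner_eikonalGraph {p p' : L2 × L2} (hp : p ∈ eikonalGraph (pointAtom x₀))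
    (hp' : p' ∈ eikonalGraph (pointAtom x₀)) : inner ℂ p.2 p'.1 = inner ℂ p.1 p'.2 := by
  rw [L2_inner_eq, L2_inner_eq]
  refine integral_congr_ae ?_
  filter_upwards [mem_eikonalGraph_iff.1 hp, mem_eikonalGraph_iff.1 hp'] with x h1 h2
  rw [h1, h2, map_mul, Complex.conj_ofReal]
  ring

theorem inner_truncMul_left (T : ℝ≥0) (y w : L2) :
    inner ℂ (truncMul x₀ T y) w = inner ℂ y (truncMul x₀ T w) := by
  rw [L2_inner_eq, L2_inner_eq]
  refine integral_congr_ae ?_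
  filter_upwards [coeFn_truncMul x₀ T y, coeFn_truncMul x₀ T w] with x h1 h2
  rw [h1, h2]
  by_cases hx : x ∈ Metric.ball (x₀ : ℝ) T
  · rw [indicator_of_mem hx, indicator_of_mem hx, map_mul, Complex.conj_ofReal]
    ring
  · rw [indicator_of_notMem hx, indicator_of_notMem hx, mul_zero, map_zero, zero_mul]

/-- An element of the adjoint is tested on truncations to balls, which lie in the domain and on
which the eikonal is bounded and symmetric. This identifies its action on every ball, so the adjoint
is not larger than the maximal multiplication operator. -/
theorem isSelfAdjoint_eikonal (x₀ : ℝ≥0) : IsSelfAdjoint (eikonal (pointAtom x₀)) := by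
  rw [LinearPMap.isSelfAdjoint_def]
  refine LinearPMap.eq_of_eq_graph (Submodule.ext fun p => ?_)
  obtain ⟨y, z⟩ := p
  rw [mem_adjoint_graph_iff dense_domain_eikonal, eikonal_graph]
  constructor
  · intro h
    have h1 : ∀ n : ℕ, proj (subspaceOn (Metric.ball (x₀ : ℝ) (n : ℝ≥0))) z =
        truncMul x₀ n y := by
      intro n
      refine ext_inner_right ℂ fun w => ?_
      have h2 := truncMul_mem_eikonalGraph (x₀ := x₀) n w
      rw [← eikonal_graph] at h2
      obtain ⟨x, hx, hx2⟩ := (LinearPMap.mem_graph_iff _).1 h2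
      have h3 := h x
      rw [hx, hx2] at h3
      rw [inner_truncMul_left, ← h3]
      exact Submodule.inner_starProjection_left_eq_right _ _ _
    refine mem_eikonalGraph_iff.2 ?_
    have h3 : ∀ n : ℕ, ∀ᵐ x ∂halfLine, x ∈ Metric.ball (x₀ : ℝ) (n : ℝ≥0) →
        z x = ((dist x x₀ : ℝ) : ℂ) * y x := by
      intro n
      have h4 := h1 n
      rw [proj_subspaceOn Metric.isOpen_ball.measurableSet] at h4
      filter_upwards [coeFn_truncMul x₀ n y, coeFn_restrictTo
        (Metric.isOpen_ball (x := (x₀ : ℝ)) (ε := (n : ℝ≥0))).measurableSet z] with x h5 h6 hx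
      rw [h4, h5, indicator_of_mem hx, indicator_of_mem hx] at h6
      exact h6.symm
    filter_upwards [ae_all_iff.2 h3] with x hx
    obtain ⟨N, hN⟩ := exists_nat_gt (dist x x₀)
    refine hx N ?_
    rw [Metric.mem_ball, NNReal.coe_natCast]
    exact hN
  · intro h x
    have h1 := LinearPMap.mem_graph _ x
    rw [eikonal_graph] at h1
    exact inner_eikonalGraph h h1

/-- Functions supported at distance more than `C + 1` from `x₀` are stretched by more than `C`. -/
theorem not_bounded_eikonal (x₀ : ℝ≥0) : ¬ ∃ C : ℝ, ∀ y : (eikonal (pointAtom x₀)).domain,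
    ‖eikonal (pointAtom x₀) y‖ ≤ C * ‖(y : L2)‖ := by
  rintro ⟨C, hC⟩
  set c : ℝ≥0 := C.toNNReal
  have hCc : C ≤ c := Real.le_coe_toNNReal C
  -- On this ball the distance to `x₀` lies strictly between `c + 1` and `c + 3`.
  set E : Set ℝ := Metric.ball (x₀ + c + 2) 1 with hE
  obtain ⟨y, hy, hy0⟩ : ∃ y ∈ subspaceOn E, y ≠ 0 := by
    by_contra! h
    have h1 : subspaceOn E ≤ subspaceOn ∅ := fun y hy => by
      rw [h y hy]
      exact (subspaceOn ∅).zero_mem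
    have h2 := null_diff_of_subspaceOn_le Metric.isOpen_ball.measurableSet MeasurableSet.empty h1
    rw [sdiff_empty] at h2
    exact halfLine_ball_ne_zero (by positivity) one_pos h2
  have hEd : ∀ x ∈ E, (c : ℝ) + 1 < dist x x₀ ∧ dist x x₀ < c + 3 := by
    intro x hx
    rw [hE, Metric.mem_ball, Real.dist_eq, abs_lt] at hx
    rw [Real.dist_eq, abs_of_pos (by linarith [hx.1, c.coe_nonneg])]
    constructor <;> linarith [hx.1, hx.2]
  have hproj : proj (subspaceOn (Metric.ball (x₀ : ℝ) ((c + 3 : ℝ≥0) : ℝ))) y = y :=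
    proj_eq_self_iff.2 (subspaceOn_mono (Eventually.of_forall fun x hx => by
      rw [Metric.mem_ball, NNReal.coe_add]
      exact (hEd x hx).2) hy)
  have h1 := truncMul_mem_eikonalGraph (x₀ := x₀) (c + 3) y
  rw [hproj, ← eikonal_graph] at h1
  obtain ⟨x, hx, -⟩ := (LinearPMap.mem_graph_iff _).1 h1
  have h2 : ‖(x : L2)‖ ≤ (c + 1 : ℝ)⁻¹ * ‖eikonal (pointAtom x₀) x‖ := by
    refine Lp.norm_le_mul_norm_of_ae_le_mul ?_
    filter_upwards [eikonal_pointAtom_ae x, mem_subspaceOn.1 hy] with s h3 h4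
    rw [h3, hx, norm_mul, Complex.norm_real, Real.norm_of_nonneg dist_nonneg]
    by_cases hs : s ∈ E
    · rw [← mul_assoc, inv_mul_eq_div]
      refine le_mul_of_one_le_left (norm_nonneg _) ?_
      rw [le_div_iff₀ (by positivity), one_mul]
      exact (hEd s hs).1.le
    · simp [h4 hs]
  have h3 := hC x
  have h4 : 0 < ‖(x : L2)‖ := by
    rw [hx]
    exact norm_pos_iff.2 hy0
  rw [inv_mul_eq_div, le_div_iff₀ (by positivity)] at h2
  nlinarith [hCc]

end Eikonal

end WaveModel

end

theorem lemma7 (q : ℝ → ℝ) (hq : ContDiffOn ℝ (⊤ : ℕ∞) q (Set.Ici 0))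
    (hlp : WaveModel.IsLimitPoint q)
    (hpos : WaveModel.IsPositiveDefinite (WaveModel.slOperator q))
    (ω : ℝ≥0 → ClosedSubmodule ℂ WaveModel.L2)
    (hω : ω ∈ WaveModel.waveSpectrum (WaveModel.slOperator q)) :
    ∃ xω : ℝ≥0,
      (∀ x : ℝ≥0, WaveModel.pointAtom x = ω ↔ x = xω) ∧
      IsSelfAdjoint (WaveModel.eikonal ω) ∧
      (¬ ∃ C : ℝ, ∀ y : (WaveModel.eikonal ω).domain,
        ‖WaveModel.eikonal ω y‖ ≤ C * ‖(y : WaveModel.L2)‖) ∧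
      (∀ y : WaveModel.L2, y ∈ (WaveModel.eikonal ω).domain ↔
        MeasureTheory.IntegrableOn (fun x : ℝ => (1 + x) ^ 2 * ‖y x‖ ^ 2) (Set.Ioi 0)) ∧
      (∀ y : (WaveModel.eikonal ω).domain, ∀ᵐ x ∂WaveModel.halfLine,
        (WaveModel.eikonal ω y) x = ((dist x (xω : ℝ) : ℝ) : ℂ) * (y : WaveModel.L2) x) := by
  obtain ⟨x₀, h⟩ := WaveModel.existsUnique_pointAtom_eq hq hpos hω
  obtain rfl := (h x₀).2 rfl
  exact ⟨x₀, h, WaveModel.isSelfAdjoint_eikonal x₀, WaveModel.not_bounded_eikonal x₀,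
    WaveModel.mem_eikonal_domain_iff, WaveModel.eikonal_pointAtom_ae⟩
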